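/- **Theorem (Isoperimetric volume ratios agree asymptotically).** Let $w\in C^\infty(\mathbb{R}^4\setminus\{0\})$ and let $g=e^{2w}|dx|^2$ be the corresponding conformal metric on $\mathbb{R}^4\setminus\{0\}$. Write $\mathrm{R}_g$, $\mathrm{Rc}_g$ for its scalar and Ricci curvature and $Q_g=-\frac1{12}\big(\triangle_g \mathrm{R}_g-\mathrm{R}_g^2+3|\mathrm{Rc}_g|_g^2\big)$ for its Paneitz $Q$ curvature. Assume that * $g$ is complete at infinity, i.e. every $C^1$ curve in $\mathbb{R}^4\setminus\{0\}$ that tends to infinity has infinite $g$-length; * $g$ has finite area over the origin, i.e. $\int_{B_R(0)}e^{4w}\,dx<\infty$ for all $R>0$; * $g$ has finite total $Q$ curvature, $\int_{\mathbb{R}^4}|Q_g|\,e^{4w}\,dx<\infty$; * for some $0<r_1\le r_2<\infty$ one has $\mathrm{R}_g\ge 0$ on $\mathbb{R}^4\setminus B_{r_2}(0)$ and on $B_{r_1}(0)\setminus\{0\}$. For $r>0$ let $\sigma$ be the Euclidean surface measure on $\partial B_r(0)$, let $H_k$ be the $k$-th elementary symmetric polynomial in the principal curvatures of $\partial B_r(0)$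 with respect to $g$ and the outward unit normal, and put $$V_4(r)=\int_{B_r(0)}e^{4w}dx,\quad V_3(r)=\tfrac14\int_{\partial B_r(0)}e^{3w}d\sigma,\quad V_2(r)=\tfrac1{12}\int_{\partial B_r(0)}H_1e^{3w}d\sigma,\quad V_1(r)=\tfrac1{12}\int_{\partial B_r(0)}H_2e^{3w}d\sigma,$$ $$C_{3,4}=\frac{V_3^{4/3}}{(\pi^2/2)^{1/3}V_4},\qquad C_{2,3}=\frac{V_2}{(\pi^2/2)^{1/3}V_3^{2/3}},\qquad C_{1,2}=\frac{V_1^{2/3}}{(\pi^2/2)^{1/3}V_2^{1/3}},$$ $$C_{2,4}=C_{3,4}^{1/3}C_{2,3}^{2/3},\qquad C_{1,3}=C_{2,3}^{1/4}C_{1,2}^{3/4},\qquad C_{1,4}=C_{3,4}^{1/9}C_{2,3}^{2/9}C_{1,2}^{2/3}.$$ Let also $$I(r)=\frac{\big(\int_{\partial B_r(0)}e^{3w}d\sigma\big)^{4/3}}{4(2\pi^2)^{1/3}\int_{B_r(0)}e^{4w}dx}.$$ 1. The limit $\mu:=\lim_{r\to0}I(r)-1$ exists in $\mathbb{R}$,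 and if $$1+\mu-\frac1{4\pi^2}\int_{\mathbb{R}^4}Q_ge^{4w}\,dx>0,$$ then for every choice of $1\le k<\ell\le4$ the limit $\nu:=\lim_{r\to\infty}C_{k,\ell}(r)$ exists in $\mathbb{R}$ and $$1-\frac1{4\pi^2}\int_{\mathbb{R}^4}Q_ge^{4w}\,dx=\nu-\mu .\qquad(*)$$ 2. The limit $\nu:=\lim_{r\to\infty}I(r)$ exists in $\mathbb{R}$, and if $$\nu+\frac1{4\pi^2}\int_{\mathbb{R}^4}Q_ge^{4w}\,dx>0,$$ then for every choice of $1\le k<\ell\le4$ the limit $\mu:=\lim_{r\to0}C_{k,\ell}(r)-1$ exists in $\mathbb{R}$ and $(*)$ holds. (The first term $1$ on the left of $(*)$ is the Euler characteristic $\chi(\mathbb{R}^4)$.) -/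

import Mathlib

open Real Set Filter Topology MeasureTheory
open scoped ContDiff

noncomputable section

namespace ConformalR4

/-- Four-dimensional Euclidean space. -/
abbrev R4 : Type := EuclideanSpace ℝ (Fin 4)

/-- The partial derivative `∂ᵢ f (x)` in the standard coordinates of `ℝ⁴`. -/
def pd (i : Fin 4) (f : R4 → ℝ) (x : R4) : ℝ :=
  fderiv ℝ f x (EuclideanSpace.single i 1)

section Curvature

/-! ### Riemannian curvature in the global coordinates of `ℝ⁴`

A metric is given by its matrix of coefficients `g x i j`. -/

/-- The Christoffel symbols `Γᵏᵢⱼ` of the Levi-Civita connection of `g`. -/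
def christoffel (g : R4 → Matrix (Fin 4) (Fin 4) ℝ) (k i j : Fin 4) (x : R4) : ℝ :=
  (1 / 2) * ∑ l, (g x)⁻¹ k l *
    (pd i (fun y => g y j l) x + pd j (fun y => g y i l) x - pd l (fun y => g y i j) x)

/-- The Ricci tensor
`Rcᵢⱼ = ∂ₖ Γᵏᵢⱼ - ∂ⱼ Γᵏᵢₖ + Γᵏₖₗ Γˡᵢⱼ - Γᵏⱼₗ Γˡᵢₖ` (positive on round spheres). -/
def ricci (g : R4 → Matrix (Fin 4) (Fin 4) ℝ) (i j : Fin 4) (x : R4) : ℝ :=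
  ∑ k, (pd k (christoffel g k i j) x - pd j (christoffel g k i k) x
    + ∑ l, (christoffel g k k l x * christoffel g l i j x
      - christoffel g k j l x * christoffel g l i k x))

/-- The scalar curvature `R_g = gⁱʲ Rcᵢⱼ`. -/
def scalarCurvature (g : R4 → Matrix (Fin 4) (Fin 4) ℝ) (x : R4) : ℝ :=
  ∑ i, ∑ j, (g x)⁻¹ i j * ricci g i j x

/-- The squared norm `|Rc_g|_g² = gⁱᵏ gʲˡ Rcᵢⱼ Rcₖₗ`. -/
def ricciNormSq (g : R4 → Matrix (Fin 4) (Fin 4) ℝ) (x : R4) : ℝ :=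
  ∑ i, ∑ j, ∑ k, ∑ l, (g x)⁻¹ i k * (g x)⁻¹ j l * ricci g i j x * ricci g k l x

/-- The Laplace-Beltrami operator `Δ_g f = gⁱʲ (∂ᵢ ∂ⱼ f - Γᵏᵢⱼ ∂ₖ f)`. -/
def laplaceBeltrami (g : R4 → Matrix (Fin 4) (Fin 4) ℝ) (f : R4 → ℝ) (x : R4) : ℝ :=
  ∑ i, ∑ j, (g x)⁻¹ i j * (pd i (pd j f) x - ∑ k, christoffel g k i j x * pd k f x)

/-- The Paneitz curvature `Q_g = -(1/12) (Δ_g R_g - R_g² + 3 |Rc_g|_g²)`. -/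
def QCurvature (g : R4 → Matrix (Fin 4) (Fin 4) ℝ) (x : R4) : ℝ :=
  -(1 / 12) * (laplaceBeltrami g (scalarCurvature g) x - scalarCurvature g x ^ 2
    + 3 * ricciNormSq g x)

/-- The coordinate matrix `(∇N)ᵏᵢ = ∂ᵢ Nᵏ + Γᵏᵢⱼ Nʲ` of the covariant derivative of a vector
field `N`. -/
def covDeriv (g : R4 → Matrix (Fin 4) (Fin 4) ℝ) (N : R4 → R4) (x : R4) :
    Matrix (Fin 4) (Fin 4) ℝ :=
  Matrix.of fun k i => pd i (fun y => N y k) x + ∑ j, christoffel g k i j x * N x j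

end Curvature

section Conformal

variable (w : R4 → ℝ)

/-- The conformal metric `g = e^{2w} |dx|²`. -/
def conformalMetric (x : R4) : Matrix (Fin 4) (Fin 4) ℝ :=
  exp (2 * w x) • (1 : Matrix (Fin 4) (Fin 4) ℝ)

/-- `e^{2w} |dx|²` is complete at infinity: every `C¹` curve in `ℝ⁴ \ {0}` that tends to infinity
has infinite `g`-length. -/
def CompleteAtInfinity : Prop :=
  ∀ γ : ℝ → R4, ContDiffOn ℝ 1 γ (Ici 0) → (∀ t ∈ Ici (0 : ℝ), γ t ≠ 0) →
    Tendsto (fun t => ‖γ t‖) atTop atTop →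
    ∫⁻ t in Ici (0 : ℝ), ENNReal.ofReal (exp (w (γ t)) * ‖derivWithin γ (Ici 0) t‖) = ⊤

/-- `e^{2w} |dx|²` has finite area over the origin: `∫_{B_R(0)} e^{4w} dx < ∞` for all `R`. -/
def FiniteAreaOverOrigin : Prop :=
  ∀ R : ℝ, IntegrableOn (fun x => exp (4 * w x)) (Metric.ball (0 : R4) R)

/-- The Euclidean surface measure on the sphere `∂B_r(0)`, `r > 0`, as a measure on `ℝ⁴`. -/
def sphereMeasure (r : ℝ) : Measure R4 :=
  ENNReal.ofReal (r ^ 3) •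
    ((volume : Measure R4).toSphere).map
      (fun θ : Metric.sphere (0 : R4) 1 => r • (θ : R4))

/-- The outward `g`-unit normal of the sphere centred at `0` through `x`, for
`g = e^{2w} |dx|²`. -/
def unitNormal (x : R4) : R4 := (exp (-w x) / ‖x‖) • x

/-- The shape operator `X ↦ ∇_X N` of the sphere centred at `0` through `x`, for
`g = e^{2w} |dx|²`, on the tangent space `x^⊥` of that sphere. Since `∇_X N` is tangent to the
sphere, the projection only restricts the codomain. -/
def shapeOperator (x : R4) :
    (Submodule.span ℝ {x})ᗮ →ₗ[ℝ] (Submodule.span ℝ {x})ᗮ :=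
  ((Submodule.span ℝ {x})ᗮ.orthogonalProjectionOnto : R4 →ₗ[ℝ] (Submodule.span ℝ {x})ᗮ) ∘ₗ
    Matrix.toEuclideanLin (covDeriv (conformalMetric w) (unitNormal w) x) ∘ₗ
    (Submodule.span ℝ {x})ᗮ.subtype

/-- `H_k[∂B_r(0)]` at `x ∈ ∂B_r(0)`: the `k`-th elementary symmetric polynomial in the principal
curvatures, i.e. in the eigenvalues, with multiplicity, of the shape operator. -/
def symCurvature (k : ℕ) (x : R4) : ℝ :=
  (shapeOperator w x).charpoly.roots.esymm k

/-- The mixed volume `V₄(r)`. -/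
def V4 (r : ℝ) : ℝ := ∫ x in Metric.ball (0 : R4) r, exp (4 * w x)

/-- The mixed volume `V₃(r)`. -/
def V3 (r : ℝ) : ℝ := (1 / 4) * ∫ x, exp (3 * w x) ∂(sphereMeasure r)

/-- The mixed volume `V₂(r)`. -/
def V2 (r : ℝ) : ℝ := (1 / 12) * ∫ x, symCurvature w 1 x * exp (3 * w x) ∂(sphereMeasure r)

/-- The mixed volume `V₁(r)`. -/
def V1 (r : ℝ) : ℝ := (1 / 12) * ∫ x, symCurvature w 2 x * exp (3 * w x) ∂(sphereMeasure r)

/-- The isoperimetric ratio `C_{3,4}(r)`. -/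
def C34 (r : ℝ) : ℝ :=
  V3 w r ^ (4 / 3 : ℝ) / ((π ^ 2 / 2) ^ (1 / 3 : ℝ) * V4 w r)

/-- The isoperimetric ratio `C_{2,3}(r)`. -/
def C23 (r : ℝ) : ℝ :=
  V2 w r / ((π ^ 2 / 2) ^ (1 / 3 : ℝ) * V3 w r ^ (2 / 3 : ℝ))

/-- The isoperimetric ratio `C_{1,2}(r)`. -/
def C12 (r : ℝ) : ℝ :=
  V1 w r ^ (2 / 3 : ℝ) / ((π ^ 2 / 2) ^ (1 / 3 : ℝ) * V2 w r ^ (1 / 3 : ℝ))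

/-- The isoperimetric ratios `C_{k,l}(r)`, `1 ≤ k < l ≤ 4` (and `0` for other `k`, `l`). -/
def isoRatio (k l : ℕ) (r : ℝ) : ℝ :=
  match k, l with
  | 3, 4 => C34 w r
  | 2, 3 => C23 w r
  | 1, 2 => C12 w r
  | 2, 4 => C34 w r ^ (1 / 3 : ℝ) * C23 w r ^ (2 / 3 : ℝ)
  | 1, 3 => C23 w r ^ (1 / 4 : ℝ) * C12 w r ^ (3 / 4 : ℝ)
  | 1, 4 => C34 w r ^ (1 / 9 : ℝ) * C23 w r ^ (2 / 9 : ℝ) * C12 w r ^ (2 / 3 : ℝ)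
  | _, _ => 0

/-- The isoperimetric quotient
`vol_g(∂B_r(0))^{4/3} / (4 (2π²)^{1/3} vol_g(B_r(0)))`, for `g = e^{2w} |dx|²`. -/
def isoQuotient (r : ℝ) : ℝ :=
  (∫ x, exp (3 * w x) ∂(sphereMeasure r)) ^ (4 / 3 : ℝ) /
    (4 * (2 * π ^ 2) ^ (1 / 3 : ℝ) * ∫ x in Metric.ball (0 : R4) r, exp (4 * w x))

/-- The total `Q` curvature `∫_{ℝ⁴} Q_g e^{4w} dx` of `g = e^{2w} |dx|²`. -/
def totalQ : ℝ := ∫ x, QCurvature (conformalMetric w) x * exp (4 * w x)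

end Conformal

end ConformalR4

end

open ConformalR4

open Real Set Filter Topology MeasureTheory
open scoped ContDiff

noncomputable section

/-! Conformal covariance of the Paneitz operator in dimension four gives Q_g e^{4w} = ½ Δ²w off the
origin (`QCurvature_conformal`). Put t = log |x| and let m(t) be the mean of w over the sphere of
radius e^t. Then m'''' - 4 m'' equals e^{4t} times the mean of Δ²w. One integration turns the right
side into a constant plus a multiple of the integral of Δ²w over a ball (`exists_const_sphInt_ode`),
and this has limits at both ends because the total Q curvature is finite.

Nonnegative scalar curvature means Δw + |∇w|² ≤ 0. Averaged over spheres, it says that the slope q =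
1 + m' satisfies q' ≤ 1 - q², so q is bounded near both ends (`bounded_of_riccati`). Boundedness
excludes the growing modes of the linear equation (`tendsto_zero_of_ode`). Hence q has limits β at
the origin and ν at infinity, and the jump ν - β = -(1/4π²) ∫ Q e^{4w} is read off from the equation
(`exists_limits_sphInt_euler`).

It remains to see that both ends look like round cones. For z = w(e^t ·) - m(t) on the unit sphere,
all moments ∫ e^{kz}, k ≥ 0, tend to the area of the sphere, and ∫ (∂_t w - m')² e^z tends to 0
(`tendsto_integral_exp_rescaled`, `tendsto_integral_sq_mul_exp_rescaled`). To prove this, w is cut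
off to a shell of ratio L around the sphere and represented by the biharmonic kernel log |x - y|.
The part coming from Δ²w on the shell is a potential of mass tending to 0 as t → ±∞. The cutoff
errors vary on the sphere by at most O(log L / L), because the mean oscillation of w on spheres is
bounded and m grows at most linearly in |t| (`exists_sphere_estimates`).

With ρ = m + t this gives V₃ ~ (A/4) e^{3ρ}, V₂ = e^{2ρ} (A q/4 + o(1)) and V₁ = e^{ρ} (A q²/4 +
o(1)), where A = 2π². For V₄ a monotonicity form of l'Hôpital's rule gives e^{4ρ}/V₄ → 4q/A
(`tendsto_div_atBot`, `tendsto_div_atTop`). Finite area over the origin forces β ≥ 0 and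
completeness forces ν ≥ 0. So `C34`, which is the isoperimetric quotient, tends to q at each end,
and when q > 0 every ratio does. The positivity hypotheses of the two statements say exactly that ν
> 0, respectively β > 0. -/

namespace ConformalR4

/-! ### Partial derivatives -/

section PartialDerivatives

variable {U : Set R4} {f g : R4 → ℝ} {x : R4} {i : Fin 4}

/-- The `i`-th standard basis vector. -/
abbrev eb (i : Fin 4) : R4 := EuclideanSpace.single i 1

theorem differentiableAt_of_smooth (hU : IsOpen U) (hf : ContDiffOn ℝ ∞ f U) (hx : x ∈ U) :
    DifferentiableAt ℝ f x :=
  (hf.contDiffAt (hU.mem_nhds hx)).differentiableAt (by simp)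

theorem contDiffOn_fderiv_apply {E : Type*} [NormedAddCommGroup E] [NormedSpace ℝ E] {U : Set E}
    (hU : IsOpen U) {f : E → ℝ} (hf : ContDiffOn ℝ ∞ f U) (v : E) :
    ContDiffOn ℝ ∞ (fun x => fderiv ℝ f x v) U :=
  (hf.fderiv_of_isOpen hU (m := ∞) (by simp)).clm_apply contDiffOn_const

theorem contDiffOn_pd (hU : IsOpen U) (hf : ContDiffOn ℝ ∞ f U) (i : Fin 4) :
    ContDiffOn ℝ ∞ (pd i f) U :=
  contDiffOn_fderiv_apply hU hf _

theorem pd_congr (h : f =ᶠ[𝓝 x] g) : pd i f x = pd i g x := by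
  simp only [pd, h.fderiv_eq]

theorem pd_eqOn (hU : IsOpen U) (h : EqOn f g U) (hx : x ∈ U) : pd i f x = pd i g x :=
  pd_congr (h.eventuallyEq_of_mem (hU.mem_nhds hx))

theorem pd_const (c : ℝ) : pd i (fun _ => c) x = 0 := by
  simp [pd]

theorem pd_add (hf : DifferentiableAt ℝ f x) (hg : DifferentiableAt ℝ g x) :
    pd i (fun y => f y + g y) x = pd i f x + pd i g x := by
  simp [pd, fderiv_fun_add hf hg]

theorem pd_sub (hf : DifferentiableAt ℝ f x) (hg : DifferentiableAt ℝ g x) :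
    pd i (fun y => f y - g y) x = pd i f x - pd i g x := by
  simp [pd, fderiv_fun_sub hf hg]

theorem pd_mul (hf : DifferentiableAt ℝ f x) (hg : DifferentiableAt ℝ g x) :
    pd i (fun y => f y * g y) x = pd i f x * g x + f x * pd i g x := by
  simp [pd, fderiv_fun_mul hf hg]; ring

theorem pd_const_mul (c : ℝ) (hf : DifferentiableAt ℝ f x) :
    pd i (fun y => c * f y) x = c * pd i f x := by
  simp [pd, fderiv_const_mul hf]

theorem pd_exp (hf : DifferentiableAt ℝ f x) :
    pd i (fun y => exp (f y)) x = exp (f x) * pd i f x := by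
  simp [pd, fderiv_exp hf]

theorem pd_sum {ι : Type*} {s : Finset ι} {F : ι → R4 → ℝ}
    (hF : ∀ k ∈ s, DifferentiableAt ℝ (F k) x) :
    pd i (fun y => ∑ k ∈ s, F k y) x = ∑ k ∈ s, pd i (F k) x := by
  simp [pd, fderiv_fun_sum hF]

theorem pd_coord (k : Fin 4) : pd i (fun y => y k) x = if k = i then 1 else 0 := by
  have h : HasFDerivAt (fun y : R4 => y k) (EuclideanSpace.proj k : R4 →L[ℝ] ℝ) x :=
    (EuclideanSpace.proj k : R4 →L[ℝ] ℝ).hasFDerivAt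
  simp [pd, h.fderiv]

theorem fderiv_eq_sum_pd (v : R4) : fderiv ℝ f x v = ∑ i, v i * pd i f x := by
  have hv : v = ∑ i, v i • eb i := by
    ext k; simp [eb, Pi.single_apply]
  conv_lhs => rw [hv]
  simp [pd, map_sum]

theorem pd_comm (hU : IsOpen U) (hf : ContDiffOn ℝ ∞ f U) (hx : x ∈ U) (i j : Fin 4) :
    pd i (pd j f) x = pd j (pd i f) x := by
  have hd : DifferentiableAt ℝ (fderiv ℝ f) x :=
    ((hf.fderiv_of_isOpen hU (m := ∞) (by simp)).contDiffAt (hU.mem_nhds hx)).differentiableAt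
      (by simp)
  have hs : IsSymmSndFDerivAt ℝ f x :=
    (hf.contDiffAt (hU.mem_nhds hx)).isSymmSndFDerivAt
      (by simp; exact WithTop.coe_le_coe.2 le_top)
  have key : ∀ a b : Fin 4, pd a (pd b f) x = fderiv ℝ (fderiv ℝ f) x (eb a) (eb b) := by
    intro a b
    have := (hd.hasFDerivAt.clm_apply (hasFDerivAt_const (eb b) x)).fderiv
    rw [show pd b f = fun y => fderiv ℝ f y (eb b) from rfl]
    simp only [pd]
    rw [this]; simp
  rw [key, key, hs]

/-- The Euclidean Laplacian. -/
def lap (f : R4 → ℝ) (x : R4) : ℝ := ∑ i, pd i (pd i f) x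

/-- The squared Euclidean norm of the gradient. -/
def gradSq (f : R4 → ℝ) (x : R4) : ℝ := ∑ i, pd i f x ^ 2

theorem contDiffOn_lap (hU : IsOpen U) (hf : ContDiffOn ℝ ∞ f U) : ContDiffOn ℝ ∞ (lap f) U :=
  ContDiffOn.sum fun i _ => contDiffOn_pd hU (contDiffOn_pd hU hf i) i

theorem contDiffOn_gradSq (hU : IsOpen U) (hf : ContDiffOn ℝ ∞ f U) :
    ContDiffOn ℝ ∞ (gradSq f) U :=
  ContDiffOn.sum fun i _ => (contDiffOn_pd hU hf i).pow 2

/-! ### Chain, product and Bochner rules for the Euclidean Laplacian. -/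

section LaplacianRules

variable (hU : IsOpen U) (hf : ContDiffOn ℝ ∞ f U) (hx : x ∈ U)
include hU hx

theorem lap_eqOn (h : EqOn f g U) : lap f x = lap g x :=
  Finset.sum_congr rfl fun _ _ => pd_eqOn hU (fun _ hy => pd_eqOn hU h hy) hx

include hf

theorem lap_const_mul (c : ℝ) : lap (fun y => c * f y) x = c * lap f x := by
  rw [lap, lap, Finset.mul_sum]
  refine Finset.sum_congr rfl fun i _ => ?_
  rw [pd_eqOn hU (fun y hy => pd_const_mul c (differentiableAt_of_smooth hU hf hy)) hx,
    pd_const_mul c (differentiableAt_of_smooth hU (contDiffOn_pd hU hf i) hx)]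

theorem lap_exp : lap (fun y => exp (f y)) x = exp (f x) * (lap f x + gradSq f x) := by
  rw [lap, lap, gradSq, ← Finset.sum_add_distrib, Finset.mul_sum]
  refine Finset.sum_congr rfl fun i _ => ?_
  have hd := differentiableAt_of_smooth hU hf hx
  rw [pd_eqOn hU (fun y hy => pd_exp (differentiableAt_of_smooth hU hf hy)) hx,
    pd_mul hd.exp (differentiableAt_of_smooth hU (contDiffOn_pd hU hf i) hx), pd_exp hd]
  ring

theorem pd_gradSq (i : Fin 4) :
    pd i (gradSq f) x = 2 * ∑ j, pd j f x * pd i (pd j f) x := by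
  have hd := fun j => differentiableAt_of_smooth hU (contDiffOn_pd hU hf j) hx
  have : gradSq f = fun y => ∑ j, pd j f y * pd j f y := by
    funext y; simp [gradSq, sq]
  rw [this, pd_sum fun j _ => (hd j).fun_mul (hd j), Finset.mul_sum]
  refine Finset.sum_congr rfl fun j _ => ?_
  rw [pd_mul (hd j) (hd j)]
  ring

theorem pd_lap (i : Fin 4) : pd i (lap f) x = ∑ j, pd j (pd j (pd i f)) x := by
  have h2 := fun j => contDiffOn_pd hU (contDiffOn_pd hU hf j) j
  rw [show lap f = fun y => ∑ j, pd j (pd j f) y from rfl,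
    pd_sum fun j _ => differentiableAt_of_smooth hU (h2 j) hx]
  refine Finset.sum_congr rfl fun j _ => ?_
  rw [pd_comm hU (contDiffOn_pd hU hf j) hx,
    pd_eqOn hU (fun y hy => pd_comm hU hf hy i j) hx]

/-- Bochner's formula in flat space. Its Hessian term cancels the squared Hessian coming from |Rc|²
in the Q curvature. -/
theorem lap_gradSq : lap (gradSq f) x =
    2 * ∑ i, ∑ j, pd i (pd j f) x ^ 2 + 2 * ∑ i, pd i f x * pd i (lap f) x := by
  have h1 := contDiffOn_pd hU hf
  have h2 := fun i j => contDiffOn_pd hU (h1 j) i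
  have hd1 := fun j => differentiableAt_of_smooth hU (h1 j) hx
  have hd2 := fun i j => differentiableAt_of_smooth hU (h2 i j) hx
  have : ∀ i, pd i (pd i (gradSq f)) x =
      2 * ∑ j, (pd i (pd j f) x ^ 2 + pd j f x * pd i (pd i (pd j f)) x) := by
    intro i
    rw [pd_eqOn hU (fun y hy => pd_gradSq hU hf hy i) hx, pd_const_mul _
      (DifferentiableAt.fun_sum fun j _ => (hd1 j).fun_mul (hd2 i j)),
      pd_sum fun j _ => (hd1 j).fun_mul (hd2 i j)]
    congr 1
    refine Finset.sum_congr rfl fun j _ => ?_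
    rw [pd_mul (hd1 j) (hd2 i j)]
    ring
  simp only [lap, this]
  rw [← Finset.mul_sum, ← mul_add]
  congr 1
  simp only [Finset.sum_add_distrib]
  congr 1
  rw [Finset.sum_comm]
  refine Finset.sum_congr rfl fun j _ => ?_
  have := pd_lap hU hf hx j
  rw [this, Finset.mul_sum]

variable (hg : ContDiffOn ℝ ∞ g U)
include hg

theorem lap_add : lap (fun y => f y + g y) x = lap f x + lap g x := by
  rw [lap, lap, lap, ← Finset.sum_add_distrib]
  refine Finset.sum_congr rfl fun i _ => ?_
  rw [pd_eqOn hU (fun y hy => pd_add (differentiableAt_of_smooth hU hf hy)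
      (differentiableAt_of_smooth hU hg hy)) hx,
    pd_add (differentiableAt_of_smooth hU (contDiffOn_pd hU hf i) hx)
      (differentiableAt_of_smooth hU (contDiffOn_pd hU hg i) hx)]

theorem lap_mul : lap (fun y => f y * g y) x =
    f x * lap g x + 2 * ∑ i, pd i f x * pd i g x + g x * lap f x := by
  rw [lap, lap, lap, Finset.mul_sum, Finset.mul_sum, Finset.mul_sum, ← Finset.sum_add_distrib,
    ← Finset.sum_add_distrib]
  refine Finset.sum_congr rfl fun i _ => ?_
  have df := differentiableAt_of_smooth hU hf hx
  have dg := differentiableAt_of_smooth hU hg hx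
  have df' := differentiableAt_of_smooth hU (contDiffOn_pd hU hf i) hx
  have dg' := differentiableAt_of_smooth hU (contDiffOn_pd hU hg i) hx
  rw [pd_eqOn hU (fun y hy => pd_mul (differentiableAt_of_smooth hU hf hy)
      (differentiableAt_of_smooth hU hg hy)) hx,
    pd_add (df'.fun_mul dg) (df.fun_mul dg'), pd_mul df' dg, pd_mul df dg']
  ring

end LaplacianRules

end PartialDerivatives

/-! ### Curvature of a conformally flat metric -/

section ConformalCurvature

variable {w : R4 → ℝ}

theorem isOpen_punctured : IsOpen ({0}ᶜ : Set R4) := isOpen_compl_singleton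

theorem conformalMetric_apply (w : R4 → ℝ) (y : R4) (i j : Fin 4) :
    conformalMetric w y i j = exp (2 * w y) * if i = j then 1 else 0 := by
  simp [conformalMetric, Matrix.one_apply]

theorem conformalMetric_inv_apply (w : R4 → ℝ) (y : R4) (i j : Fin 4) :
    (conformalMetric w y)⁻¹ i j = exp (-(2 * w y)) * if i = j then 1 else 0 := by
  have : (conformalMetric w y)⁻¹ = exp (-(2 * w y)) • (1 : Matrix (Fin 4) (Fin 4) ℝ) := by
    apply Matrix.inv_eq_right_inv
    simp [conformalMetric, smul_smul, ← exp_add]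
  simp [this, Matrix.one_apply]

variable (hw : ContDiffOn ℝ ∞ w {0}ᶜ) {x : R4} (hx : x ≠ 0)
include hw hx

theorem pd_conformalMetric (k i j : Fin 4) :
    pd k (fun y => conformalMetric w y i j) x =
      2 * exp (2 * w x) * pd k w x * if i = j then 1 else 0 := by
  have hd := differentiableAt_of_smooth isOpen_punctured hw hx
  simp only [conformalMetric_apply]
  rw [pd_mul (hd.const_mul 2).exp (differentiableAt_const _), pd_exp (hd.const_mul 2),
    pd_const_mul _ hd, pd_const]
  ring

theorem christoffel_conformal (k i j : Fin 4) :
    christoffel (conformalMetric w) k i j x =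
      (if j = k then pd i w x else 0) + (if i = k then pd j w x else 0)
        - (if i = j then pd k w x else 0) := by
  have he : exp (-(2 * w x)) * exp (2 * w x) = 1 := by rw [← exp_add]; simp
  simp only [christoffel, pd_conformalMetric hw hx, conformalMetric_inv_apply]
  simp only [mul_ite, mul_one, mul_zero, ite_mul, zero_mul, Finset.sum_ite_eq, Finset.mem_univ,
    if_true]
  have : ∀ a : ℝ, exp (-(2 * w x)) * (2 * exp (2 * w x) * a) = 2 * a := fun a => by
    linear_combination 2 * a * he
  split_ifs <;> simp [mul_add, mul_sub, this] 

theorem pd_christoffel_conformal (l k i j : Fin 4) :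
    pd l (christoffel (conformalMetric w) k i j) x =
      (if j = k then pd l (pd i w) x else 0) + (if i = k then pd l (pd j w) x else 0)
        - (if i = j then pd l (pd k w) x else 0) := by
  have hd : ∀ a, DifferentiableAt ℝ (pd a w) x := fun a =>
    differentiableAt_of_smooth isOpen_punctured (contDiffOn_pd isOpen_punctured hw a) hx
  have hE : EqOn (christoffel (conformalMetric w) k i j) (fun y =>
      ((if j = k then 1 else 0) * pd i w y + (if i = k then 1 else 0) * pd j w y)
        - (if i = j then 1 else 0) * pd k w y) {0}ᶜ := fun y hy => by
    rw [christoffel_conformal hw hy]; simp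
  rw [pd_eqOn isOpen_punctured hE hx, pd_sub (((hd i).const_mul _).fun_add ((hd j).const_mul _))
    ((hd k).const_mul _), pd_add ((hd i).const_mul _) ((hd j).const_mul _),
    pd_const_mul _ (hd i), pd_const_mul _ (hd j), pd_const_mul _ (hd k)]
  simp

/-- The general formula is -(n-2)(∇²w - dw⊗dw) - (Δw + (n-2)|∇w|²)δ, here with n = 4. The sixteen
components are checked one by one, modulo symmetry of the Hessian. -/
theorem ricci_conformal (i j : Fin 4) :
    ricci (conformalMetric w) i j x =
      -2 * (pd i (pd j w) x - pd i w x * pd j w x)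
        - (lap w x + 2 * gradSq w x) * if i = j then 1 else 0 := by
  have hc := pd_comm isOpen_punctured hw hx
  simp only [ricci, pd_christoffel_conformal hw hx, christoffel_conformal hw hx, lap, gradSq]
  fin_cases i <;> fin_cases j <;>
    (simp [Fin.sum_univ_four, hc 1 0, hc 2 0, hc 3 0, hc 2 1, hc 3 1, hc 3 2]; try ring)

theorem scalarCurvature_conformal :
    scalarCurvature (conformalMetric w) x =
      -6 * exp (-(2 * w x)) * (lap w x + gradSq w x) := by
  simp only [scalarCurvature, ricci_conformal hw hx, conformalMetric_inv_apply]
  simp only [mul_ite, mul_one, mul_zero, ite_mul, zero_mul, Finset.sum_ite_eq, Finset.mem_univ,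
    if_true]
  simp [Fin.sum_univ_four, lap, gradSq]
  ring

theorem ricciNormSq_conformal :
    ricciNormSq (conformalMetric w) x = exp (-(4 * w x)) *
      (4 * ∑ i, ∑ j, (pd i (pd j w) x - pd i w x * pd j w x) ^ 2
        + 4 * (lap w x - gradSq w x) * (lap w x + 2 * gradSq w x)
        + 4 * (lap w x + 2 * gradSq w x) ^ 2) := by
  have he : exp (-(4 * w x)) = exp (-(2 * w x)) * exp (-(2 * w x)) := by
    rw [← exp_add]; ring_nf
  simp only [ricciNormSq, ricci_conformal hw hx, conformalMetric_inv_apply]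
  simp only [mul_ite, mul_one, mul_zero, ite_mul, zero_mul, Finset.sum_ite_eq, Finset.mem_univ,
    if_true, he]
  simp only [Fin.sum_univ_four, lap, gradSq]
  simp
  ring

theorem laplaceBeltrami_conformal {f : R4 → ℝ} :
    laplaceBeltrami (conformalMetric w) f x =
      exp (-(2 * w x)) * (lap f x + 2 * ∑ i, pd i w x * pd i f x) := by
  simp only [laplaceBeltrami, christoffel_conformal hw hx, conformalMetric_inv_apply]
  simp only [mul_ite, mul_one, mul_zero, ite_mul, zero_mul, Finset.sum_ite_eq, Finset.mem_univ,
    if_true]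
  simp [Fin.sum_univ_four, lap]
  ring

-- Conformal covariance of the Paneitz operator on a flat background, where the operator is Δ². By
-- Bochner's formula everything of lower order in Δ_g R, R² and |Rc|² cancels. The factor ½ is
-- (-1/12)·(-6), the -6 coming from the scalar curvature.
omit hx in
theorem QCurvature_conformal (hx : x ≠ 0) :
    QCurvature (conformalMetric w) x * exp (4 * w x) = 1 / 2 * lap (lap w) x := by
  have hU := isOpen_punctured
  have hd1 := contDiffOn_pd hU hw
  have hF : ContDiffOn ℝ ∞ (fun y => lap w y + gradSq w y) {0}ᶜ :=
    (contDiffOn_lap hU hw).add (contDiffOn_gradSq hU hw)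
  have h2w : ContDiffOn ℝ ∞ (fun y => -2 * w y) {0}ᶜ := contDiffOn_const.mul hw
  have hE : EqOn (scalarCurvature (conformalMetric w))
      (fun y => -6 * (exp (-2 * w y) * (lap w y + gradSq w y))) {0}ᶜ := fun y hy => by
    rw [scalarCurvature_conformal hw hy]; ring_nf
  have hpR : ∀ i, pd i (scalarCurvature (conformalMetric w)) x =
      -6 * (exp (-2 * w x) * (-2 * pd i w x) * (lap w x + gradSq w x)
        + exp (-2 * w x) * pd i (fun y => lap w y + gradSq w y) x) := fun i => by
    rw [pd_eqOn hU hE hx, pd_const_mul _ (differentiableAt_of_smooth hU (h2w.exp.mul hF) hx),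
      pd_mul (differentiableAt_of_smooth hU h2w.exp hx) (differentiableAt_of_smooth hU hF hx),
      pd_exp (differentiableAt_of_smooth hU h2w hx),
      pd_const_mul _ (differentiableAt_of_smooth hU hw hx)]
  have hgs : gradSq (fun y => -2 * w y) x = ∑ i, (-2 * pd i w x) ^ 2 := by
    simp only [gradSq, pd_const_mul _ (differentiableAt_of_smooth hU hw hx)]
  have hlR : lap (scalarCurvature (conformalMetric w)) x =
      -6 * (exp (-2 * w x) * (lap (fun y => lap w y + gradSq w y) x)
        + 2 * ∑ i, (exp (-2 * w x) * (-2 * pd i w x)) * pd i (fun y => lap w y + gradSq w y) x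
        + (lap w x + gradSq w x) *
          (exp (-2 * w x) * (-2 * lap w x + ∑ i, (-2 * pd i w x) ^ 2))) := by
    rw [lap_eqOn hU hx hE, lap_const_mul hU (h2w.exp.mul hF) hx, lap_mul hU h2w.exp hx hF,
      lap_exp hU h2w hx, lap_const_mul hU hw hx]
    simp only [hgs, pd_exp (differentiableAt_of_smooth hU h2w hx),
      pd_const_mul _ (differentiableAt_of_smooth hU hw hx)]
  have hlF : lap (fun y => lap w y + gradSq w y) x = lap (lap w) x
      + (2 * ∑ i, ∑ j, pd i (pd j w) x ^ 2 + 2 * ∑ i, pd i w x * pd i (lap w) x) := by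
    rw [lap_add hU (contDiffOn_lap hU hw) hx (contDiffOn_gradSq hU hw), lap_gradSq hU hw hx]
  have hpF : ∀ i, pd i (fun y => lap w y + gradSq w y) x =
      pd i (lap w) x + 2 * ∑ j, pd j w x * pd i (pd j w) x := fun i => by
    rw [pd_add (differentiableAt_of_smooth hU (contDiffOn_lap hU hw) hx)
      (differentiableAt_of_smooth hU (contDiffOn_gradSq hU hw) hx), pd_gradSq hU hw hx]
  have hc := pd_comm hU hw hx
  have e1 : exp (-(2 * w x)) * exp (-2 * w x) * exp (4 * w x) = 1 := by
    rw [← exp_add, ← exp_add]; ring_nf; simp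
  have e2 : exp (-(4 * w x)) * exp (4 * w x) = 1 := by
    rw [← exp_add]; ring_nf; simp
  have e3 : exp (-(2 * w x)) * exp (-(2 * w x)) * exp (4 * w x) = 1 := by
    rw [← exp_add, ← exp_add]; ring_nf; simp
  rw [QCurvature, laplaceBeltrami_conformal hw hx, scalarCurvature_conformal hw hx,
    ricciNormSq_conformal hw hx, hlR]
  simp only [hpR, hlF, hpF]
  set a := exp (-(2 * w x))
  set b := exp (-2 * w x)
  set c := exp (4 * w x)
  set d := exp (-(4 * w x))
  have hl : lap w x = ∑ i, pd i (pd i w) x := rfl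
  have hg : gradSq w x = ∑ i, pd i w x ^ 2 := rfl
  set D := lap (lap w) x
  set l := lap w x
  set S := gradSq w x
  -- Each of the three curvature terms carries the weight e^{-4w}, which cancels against e^{4w}.
  -- Only a polynomial identity in the derivatives of w remains.
  have X : ∀ p q r : ℝ, -(1 / 12) * (a * (b * p) - (-6 * a * q) ^ 2 + 3 * (d * r)) * c
      = -(1 / 12) * (p - 36 * q ^ 2 + 3 * r) := by
    intro p q r
    linear_combination (-(1 / 12) * p) * e1 + (3 * q ^ 2) * e3 - (1 / 4 * r) * e2
  have Y : -6 * (b * (D + (2 * ∑ i, ∑ j, pd i (pd j w) x ^ 2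
        + 2 * ∑ i, pd i w x * pd i (lap w) x))
      + 2 * ∑ i, b * (-2 * pd i w x) * (pd i (lap w) x + 2 * ∑ j, pd j w x * pd i (pd j w) x)
      + (l + S) * (b * (-2 * l + ∑ i, (-2 * pd i w x) ^ 2)))
      + 2 * ∑ i, pd i w x * (-6 * (b * (-2 * pd i w x) * (l + S)
        + b * (pd i (lap w) x + 2 * ∑ j, pd j w x * pd i (pd j w) x)))
      = b * (-6 * (D + 2 * ∑ i, ∑ j, pd i (pd j w) x ^ 2
        + 2 * ∑ i, pd i w x * pd i (lap w) x
        + -4 * ∑ i, pd i w x * (pd i (lap w) x + 2 * ∑ j, pd j w x * pd i (pd j w) x)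
        + (l + S) * (-2 * l + 4 * S))
      + 2 * (12 * S * (l + S)
        - 6 * ∑ i, pd i w x * (pd i (lap w) x + 2 * ∑ j, pd j w x * pd i (pd j w) x))) := by
    rw [hg]
    simp only [Fin.sum_univ_four]
    ring
  rw [Y, X]
  clear X Y hpR hlR hlF hpF
  rw [hl, hg]
  simp only [Fin.sum_univ_four, hc 1 0, hc 2 0, hc 3 0, hc 2 1, hc 3 1, hc 3 2]
  ring

end ConformalCurvature

/-! ### Principal curvatures of the spheres about the origin -/

/-- The Euler vector field `x · ∇` applied to `f`. -/
def euler (f : R4 → ℝ) (x : R4) : ℝ := fderiv ℝ f x x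

theorem euler_eq_sum (f : R4 → ℝ) (x : R4) : euler f x = ∑ i, x i * pd i f x :=
  fderiv_eq_sum_pd x

theorem contDiffOn_euler {U : Set R4} (hU : IsOpen U) {f : R4 → ℝ} (hf : ContDiffOn ℝ ∞ f U) :
    ContDiffOn ℝ ∞ (euler f) U :=
  (hf.fderiv_of_isOpen hU (m := ∞) (by simp)).clm_apply contDiffOn_id

theorem charpoly_smul_one {V : Type*} [AddCommGroup V] [Module ℝ V] [FiniteDimensional ℝ V]
    (c : ℝ) : (c • (1 : V →ₗ[ℝ] V)).charpoly =
      (Polynomial.X - Polynomial.C c) ^ Module.finrank ℝ V := by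
  rw [← LinearMap.charpoly_toMatrix _ (Module.finBasis ℝ V)]
  have : LinearMap.toMatrix (Module.finBasis ℝ V) (Module.finBasis ℝ V)
      (c • (1 : V →ₗ[ℝ] V)) = Matrix.diagonal fun _ => c := by
    rw [map_smul, LinearMap.toMatrix_one, Matrix.smul_one_eq_diagonal]
  rw [this, Matrix.charpoly_diagonal]
  simp

section

variable {w : R4 → ℝ} (hw : ContDiffOn ℝ ∞ w {0}ᶜ) {x : R4} (hx : x ≠ 0)
include hw hx

/-- Modulo two rank-one terms the matrix is scalar: the first has its image along x and is killed by
the projection to the tangent space, the last vanishes on tangent vectors. Hence the coefficients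
`b` need not be known. -/
theorem covDeriv_unitNormal_apply :
    ∃ b : Fin 4 → ℝ, ∀ k i, covDeriv (conformalMetric w) (unitNormal w) x k i =
      b i * x k + (if i = k then exp (-w x) / ‖x‖ * (1 + euler w x) else 0)
        - exp (-w x) / ‖x‖ * pd k w x * x i := by
  have hn : DifferentiableAt ℝ (fun y : R4 => exp (-w y) / ‖y‖) x := by
    have hd := differentiableAt_of_smooth isOpen_punctured hw hx
    have hnx : ‖x‖ ≠ 0 := norm_ne_zero_iff.2 hx
    have hdn : DifferentiableAt ℝ (fun y : R4 => ‖y‖) x := differentiableAt_fun_id.norm ℝ hx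
    have hde : DifferentiableAt ℝ (fun y : R4 => exp (-w y)) x := hd.fun_neg.exp
    simpa only [div_eq_mul_inv] using hde.fun_mul (hdn.fun_inv hnx)
  refine ⟨fun i => pd i (fun y : R4 => exp (-w y) / ‖y‖) x + exp (-w x) / ‖x‖ * pd i w x,
    fun k i => ?_⟩
  have h1 : pd i (fun y => unitNormal w y k) x = pd i (fun y : R4 => exp (-w y) / ‖y‖) x * x k +
      exp (-w x) / ‖x‖ * if k = i then 1 else 0 := by
    have hc : DifferentiableAt ℝ (fun y : R4 => y k) x :=
      (EuclideanSpace.proj k : R4 →L[ℝ] ℝ).differentiableAt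
    rw [← pd_coord (x := x) k, ← pd_mul hn hc]
    rfl
  simp only [covDeriv, Matrix.of_apply, h1]
  clear h1
  simp only [christoffel_conformal hw hx, euler_eq_sum,
    unitNormal, PiLp.smul_apply, smul_eq_mul]
  generalize pd i (fun y : R4 => exp (-w y) / ‖y‖) x = b
  generalize exp (-w x) / ‖x‖ = c
  fin_cases i <;> fin_cases k <;> simp [Fin.sum_univ_four] <;> ring

/-- The spheres about the origin are umbilic for a conformally flat metric. -/
theorem shapeOperator_eq_smul :
    shapeOperator w x = (exp (-w x) / ‖x‖ * (1 + euler w x)) • 1 := by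
  obtain ⟨b, hb⟩ := covDeriv_unitNormal_apply hw hx
  set c := exp (-w x) / ‖x‖ * (1 + euler w x)
  ext v
  have hv : ∑ i, x i * (v : R4) i = 0 := by
    have := Submodule.mem_orthogonal_singleton_iff_inner_right.1 v.2
    simpa [PiLp.inner_apply, mul_comm] using this
  have key : Matrix.toEuclideanLin (covDeriv (conformalMetric w) (unitNormal w) x) (v : R4)
      = (∑ i, b i * (v : R4) i) • x + c • (v : R4) := by
    ext k
    simp only [Matrix.toLpLin_apply, Matrix.mulVec, dotProduct, hb, PiLp.add_apply,
      PiLp.smul_apply, smul_eq_mul]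
    have : ∀ i, (b i * x k + (if i = k then c else 0) - exp (-w x) / ‖x‖ * pd k w x * x i)
        * (v : R4) i = b i * (v : R4) i * x k + (if i = k then c * (v : R4) i else 0)
          - exp (-w x) / ‖x‖ * pd k w x * (x i * (v : R4) i) := by
      intro i; split_ifs <;> ring
    simp only [this, Finset.sum_sub_distrib, Finset.sum_add_distrib, ← Finset.mul_sum, hv,
      ← Finset.sum_mul]
    simp
  simp only [shapeOperator, LinearMap.comp_apply, Submodule.subtype_apply, key]
  have h0 : (ℝ ∙ x)ᗮ.orthogonalProjectionOnto x = 0 :=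
    Submodule.orthogonalProjectionOnto_orthogonalComplement_singleton_eq_zero x
  rw [ContinuousLinearMap.coe_coe, map_add, map_smul, map_smul, h0,
    Submodule.orthogonalProjectionOnto_mem_subspace_eq_self]
  simp

theorem symCurvature_eq (k : ℕ) : symCurvature w k x =
    (Multiset.replicate 3 (exp (-w x) / ‖x‖ * (1 + euler w x))).esymm k := by
  have : Fact (Module.finrank ℝ R4 = 3 + 1) := ⟨by simp⟩
  rw [symCurvature, shapeOperator_eq_smul hw hx, charpoly_smul_one,
    Submodule.finrank_orthogonal_span_singleton (n := 3) hx, Polynomial.roots_pow,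
    Polynomial.roots_X_sub_C, Multiset.nsmul_singleton]

theorem symCurvature_one : symCurvature w 1 x = 3 * (exp (-w x) / ‖x‖ * (1 + euler w x)) := by
  rw [symCurvature_eq hw hx]
  simp [Multiset.esymm, Multiset.replicate_succ, Multiset.powersetCard_one]
  ring

theorem symCurvature_two : symCurvature w 2 x =
    3 * (exp (-w x) / ‖x‖ * (1 + euler w x)) ^ 2 := by
  rw [symCurvature_eq hw hx]
  generalize exp (-w x) / ‖x‖ * (1 + euler w x) = c
  rw [show Multiset.replicate 3 c = c ::ₘ c ::ₘ c ::ₘ 0 from rfl]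
  simp [Multiset.esymm, Multiset.powersetCard_cons, Multiset.powersetCard_one]
  ring

end

/-! ### Integration over spheres -/

/-- The unit sphere of `ℝ⁴`. -/
abbrev S3 : Type := Metric.sphere (0 : R4) 1

/-- The surface measure of the unit sphere of `ℝ⁴`. -/
abbrev sig : Measure S3 := (volume : Measure R4).toSphere

/-- The area `2π²` of the unit sphere of `ℝ⁴`. -/
abbrev areaS3 : ℝ := 2 * π ^ 2

theorem finrank_R4 : Module.finrank ℝ R4 = 4 := by simp

theorem sig_real_univ : sig.real univ = areaS3 := by
  rw [Measure.toSphere_real_apply_univ, measureReal_def, EuclideanSpace.volume_ball]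
  have : Gamma (4 / 2 + 1) = 2 := by
    rw [show (4 / 2 + 1 : ℝ) = (2 : ℕ) + 1 by norm_num, Gamma_nat_eq_factorial]; norm_num
  have h2 : √π ^ 4 = π ^ 2 := by
    rw [show (4 : ℕ) = 2 * 2 by norm_num, pow_mul, sq_sqrt pi_pos.le]
  simp only [finrank_R4, Fintype.card_fin, ENNReal.ofReal_one, one_pow, one_mul, Nat.cast_ofNat,
    this, h2]
  rw [ENNReal.toReal_ofReal (by positivity)]
  ring

theorem areaS3_pos : 0 < areaS3 := by positivity

theorem norm_S3 (θ : S3) : ‖(θ : R4)‖ = 1 := norm_eq_of_mem_sphere θ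

theorem S3_ne_zero (θ : S3) : (θ : R4) ≠ 0 := by
  rw [← norm_ne_zero_iff, norm_S3]; norm_num

theorem smul_S3_ne_zero {r : ℝ} (hr : r ≠ 0) (θ : S3) : r • (θ : R4) ≠ 0 :=
  smul_ne_zero hr (S3_ne_zero θ)

theorem integrable_sphere {f : S3 → ℝ} (hf : Continuous f) : Integrable f sig :=
  hf.integrable_of_hasCompactSupport (HasCompactSupport.of_compactSpace f)

theorem integral_sphere_const (c : ℝ) : ∫ _ : S3, c ∂sig = areaS3 * c := by
  rw [integral_const, sig_real_univ, smul_eq_mul]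

/-- The measure on `(0, ∞)` with density `r ^ 3`. -/
abbrev radialMeasure : Measure (Ioi (0 : ℝ)) := Measure.volumeIoiPow 3

/-! ### Polar coordinates. -/

theorem measurePreserving_polar :
    MeasurePreserving (fun p : S3 × Ioi (0 : ℝ) => (p.2 : ℝ) • (p.1 : R4))
      (sig.prod radialMeasure) volume := by
  have h := (volume : Measure R4).measurePreserving_homeomorphUnitSphereProd
  have hd : Module.finrank ℝ R4 - 1 = 3 := by simp
  rw [hd] at h
  have h' := h.symm (e := (homeomorphUnitSphereProd R4).toMeasurableEquiv)
  have hv : MeasurePreserving (Subtype.val : ({0}ᶜ : Set R4) → R4)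
      (Measure.comap Subtype.val volume) volume := by
    refine ⟨measurable_subtype_coe, ?_⟩
    rw [(MeasurableEmbedding.subtype_coe (measurableSet_singleton 0).compl).map_comap]
    rw [Subtype.range_coe]
    exact restrict_compl_singleton 0
  exact hv.comp h'

theorem lintegral_radialMeasure {f : ℝ → ENNReal} (hf : Measurable f) :
    ∫⁻ r : Ioi (0 : ℝ), f r ∂radialMeasure = ∫⁻ r in Ioi (0 : ℝ), ENNReal.ofReal (r ^ 3) * f r := by
  rw [radialMeasure, Measure.volumeIoiPow, lintegral_withDensity_eq_lintegral_mul _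
    (by fun_prop) (by fun_prop)]
  exact lintegral_subtype_comap measurableSet_Ioi fun r => ENNReal.ofReal (r ^ 3) * f r

theorem lintegral_polar {f : R4 → ENNReal} (hf : Measurable f) :
    ∫⁻ x, f x = ∫⁻ r in Ioi (0 : ℝ), ENNReal.ofReal (r ^ 3) * ∫⁻ θ : S3, f (r • (θ : R4)) ∂sig := by
  have hm : Measurable fun p : S3 × ℝ => f (p.2 • (p.1 : R4)) := by fun_prop
  rw [← measurePreserving_polar.lintegral_comp hf, lintegral_prod_symm' _ (by fun_prop)]
  exact lintegral_radialMeasure (f := fun r => ∫⁻ θ : S3, f (r • (θ : R4)) ∂sig)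
    (hm.lintegral_prod_left' (f := fun p : S3 × ℝ => f (p.2 • (p.1 : R4))))

theorem integral_radialMeasure (f : ℝ → ℝ) :
    ∫ r : Ioi (0 : ℝ), f r ∂radialMeasure = ∫ r in Ioi (0 : ℝ), r ^ 3 * f r := by
  rw [radialMeasure, Measure.volumeIoiPow]
  simp only [ENNReal.ofReal]
  rw [integral_withDensity_eq_integral_smul (by fun_prop),
    integral_subtype_comap measurableSet_Ioi fun a ↦ Real.toNNReal (a ^ 3) • f a]
  refine setIntegral_congr_fun measurableSet_Ioi fun x hx => ?_
  have hx' : (0 : ℝ) ≤ x ^ 3 := pow_nonneg (le_of_lt hx) _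
  simp [NNReal.smul_def, hx']

theorem integrableOn_radialMeasure (f : ℝ → ℝ) :
    Integrable (fun r : Ioi (0 : ℝ) => f r) radialMeasure ↔
      IntegrableOn (fun r => r ^ 3 * f r) (Ioi 0) := by
  rw [radialMeasure, Measure.volumeIoiPow,
    integrable_withDensity_iff_integrable_smul' (by fun_prop) (by simp),
    integrableOn_iff_comap_subtypeVal measurableSet_Ioi]
  refine integrable_congr (.of_forall fun r => ?_)
  have hx' : (0 : ℝ) ≤ (r : ℝ) ^ 3 := pow_nonneg (le_of_lt r.2) _
  simp [ENNReal.toReal_ofReal hx']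

theorem integrable_polar {f : R4 → ℝ} (hf : Integrable f) :
    IntegrableOn (fun r => r ^ 3 * ∫ θ : S3, f (r • (θ : R4)) ∂sig) (Ioi 0) := by
  rw [← integrableOn_radialMeasure]
  exact (measurePreserving_polar.integrable_comp_of_integrable hf).integral_prod_right

theorem integral_polar {f : R4 → ℝ} (hf : Integrable f) :
    ∫ x, f x = ∫ r in Ioi (0 : ℝ), r ^ 3 * ∫ θ : S3, f (r • (θ : R4)) ∂sig := by
  have hi := measurePreserving_polar.integrable_comp_of_integrable hf
  rw [← integral_radialMeasure fun r => ∫ θ : S3, f (r • (θ : R4)) ∂sig,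
    ← integral_prod_symm (fun p : S3 × Ioi (0 : ℝ) => f ((p.2 : ℝ) • (p.1 : R4))) hi]
  have hm := measurePreserving_polar.map_eq
  have hf' := hf.aestronglyMeasurable
  rw [← hm] at hf'
  rw [← integral_map measurePreserving_polar.aemeasurable hf', hm]

/-- The action of a linear isometry on the unit sphere. -/
def sphereMap (e : R4 ≃ₗᵢ[ℝ] R4) (θ : S3) : S3 := ⟨e θ, by simp⟩

theorem continuous_sphereMap (e : R4 ≃ₗᵢ[ℝ] R4) : Continuous (sphereMap e) :=
  (e.continuous.comp continuous_subtype_val).subtype_mk _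

-- The surface measure of a set is defined through the volume of the cone over it. An isometry
-- preserves volume and commutes with the formation of cones.
open scoped Pointwise in
theorem measurePreserving_sphereMap (e : R4 ≃ₗᵢ[ℝ] R4) :
    MeasurePreserving (sphereMap e) sig sig := by
  refine ⟨(continuous_sphereMap e).measurable, ?_⟩
  ext s hs
  rw [Measure.map_apply (continuous_sphereMap e).measurable hs,
    Measure.toSphere_apply' _ ((continuous_sphereMap e).measurable hs),
    Measure.toSphere_apply' _ hs, ← e.measurePreserving.measure_preimage_equiv
      (f := e.toMeasurableEquiv) (Ioo (0 : ℝ) 1 • (Subtype.val '' s))]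
  congr 2
  ext x
  simp only [Set.mem_smul, mem_image, mem_preimage]
  constructor
  · rintro ⟨a, ha, _, ⟨θ, hθ, rfl⟩, rfl⟩
    exact ⟨a, ha, _, ⟨_, hθ, rfl⟩, by simp [sphereMap]⟩
  · rintro ⟨a, ha, _, ⟨θ, hθ, rfl⟩, h⟩
    refine ⟨a, ha, _, ⟨sphereMap e.symm θ, ?_, rfl⟩, ?_⟩
    · have : sphereMap e (sphereMap e.symm θ) = θ := by
        apply Subtype.ext; simp [sphereMap]
      change sphereMap e (sphereMap e.symm θ) ∈ s
      rwa [this]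
    · apply e.injective
      simpa [sphereMap] using h

theorem integral_sphereMap (e : R4 ≃ₗᵢ[ℝ] R4) {f : S3 → ℝ} (hf : Continuous f) :
    ∫ θ, f (sphereMap e θ) ∂sig = ∫ θ, f θ ∂sig := by
  conv_rhs => rw [← (measurePreserving_sphereMap e).map_eq]
  rw [integral_map (continuous_sphereMap e).measurable.aemeasurable hf.aestronglyMeasurable]

/-! ### Spherical integrals as functions of the logarithmic radius. -/

theorem hasDerivAt_integral_sphere {F F' : ℝ → S3 → ℝ} (hF : Continuous fun p : ℝ × S3 => F p.1 p.2)
    (hF' : Continuous fun p : ℝ × S3 => F' p.1 p.2)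
    (hd : ∀ t θ, HasDerivAt (fun s => F s θ) (F' t θ) t) (t : ℝ) :
    HasDerivAt (fun s => ∫ θ, F s θ ∂sig) (∫ θ, F' t θ ∂sig) t := by
  obtain ⟨C, hC⟩ := ((isCompact_Icc (a := t - 1) (b := t + 1)).prod
    (isCompact_univ (X := S3))).exists_bound_of_continuousOn hF'.continuousOn
  have hc : ∀ s, Continuous (F s) := fun s => hF.comp (Continuous.prodMk_right s)
  refine (hasDerivAt_integral_of_dominated_loc_of_deriv_le (bound := fun _ => C)
    (Icc_mem_nhds (by linarith : t - 1 < t) (by linarith : t < t + 1))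
    (.of_forall fun s => (hc s).aestronglyMeasurable) (integrable_sphere (hc t))
    (hF'.comp (Continuous.prodMk_right t)).aestronglyMeasurable
    (.of_forall fun θ s hs => hC (s, θ) ⟨hs, mem_univ _⟩) (integrable_const _)
    (.of_forall fun θ s _ => hd s θ)).2

/-- The integral of `f` over the sphere of radius `e^t`, with respect to the surface measure of
the unit sphere. -/
def sphInt (f : R4 → ℝ) (t : ℝ) : ℝ := ∫ θ : S3, f (exp t • (θ : R4)) ∂sig

section

variable {f g : R4 → ℝ}

theorem continuous_polar (hf : ContinuousOn f {0}ᶜ) :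
    Continuous fun p : ℝ × S3 => f (exp p.1 • (p.2 : R4)) :=
  hf.comp_continuous (by fun_prop) fun p => smul_S3_ne_zero (exp_pos _).ne' _

theorem continuous_slice (hf : ContinuousOn f {0}ᶜ) (t : ℝ) :
    Continuous fun θ : S3 => f (exp t • (θ : R4)) :=
  (continuous_polar hf).comp (Continuous.prodMk_right t)

theorem integrable_slice (hf : ContinuousOn f {0}ᶜ) (t : ℝ) :
    Integrable (fun θ : S3 => f (exp t • (θ : R4))) sig :=
  integrable_sphere (continuous_slice hf t)

theorem continuous_sphInt (hf : ContinuousOn f {0}ᶜ) : Continuous (sphInt f) := by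
  have := continuous_parametric_integral_of_continuous (μ := sig) (s := univ)
    (f := fun t (θ : S3) => f (exp t • (θ : R4))) (continuous_polar hf)
    isCompact_univ
  simp only [setIntegral_univ] at this
  exact this

theorem hasDerivAt_polar (hf : ContDiffOn ℝ ∞ f {0}ᶜ) (t : ℝ) (θ : S3) :
    HasDerivAt (fun s => f (exp s • (θ : R4))) (euler f (exp t • (θ : R4))) t := by
  have hd := (differentiableAt_of_smooth isOpen_punctured hf
    (smul_S3_ne_zero (exp_pos t).ne' θ)).hasFDerivAt
  exact hd.comp_hasDerivAt t ((hasDerivAt_exp t).smul_const (θ : R4))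

theorem hasDerivAt_sphInt (hf : ContDiffOn ℝ ∞ f {0}ᶜ) (t : ℝ) :
    HasDerivAt (sphInt f) (sphInt (euler f) t) t :=
  hasDerivAt_integral_sphere (continuous_polar hf.continuousOn)
    (continuous_polar (contDiffOn_euler isOpen_punctured hf).continuousOn)
    (hasDerivAt_polar hf) t

/-- The derivative of the integral over a ball with respect to the logarithm of its radius. -/
theorem hasDerivAt_integral_ball (hf : ContinuousOn f {0}ᶜ)
    (hi : ∀ R, IntegrableOn f (Metric.ball 0 R)) (t : ℝ) :
    HasDerivAt (fun s => ∫ x in Metric.ball (0 : R4) (exp s), f x) (exp (4 * t) * sphInt f t) t := by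
  set G : ℝ → ℝ := fun r => r ^ 3 * ∫ θ : S3, f (r • (θ : R4)) ∂sig
  have hball : ∀ R : ℝ, 0 < R → IntegrableOn G (Ioc 0 R) ∧
      ∫ x in Metric.ball (0 : R4) R, f x = ∫ r in (0 : ℝ)..R, G r := by
    intro R hR
    have hint := (integrable_indicator_iff Metric.isOpen_ball.measurableSet).2 (hi R)
    have hG : ∀ r ∈ Ioi (0 : ℝ), (r ^ 3 * ∫ θ : S3,
        (Metric.ball (0 : R4) R).indicator f (r • (θ : R4)) ∂sig) = (Iio R).indicator G r := by
      intro r hr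
      by_cases hrR : r < R
      · have : ∀ θ : S3, r • (θ : R4) ∈ Metric.ball (0 : R4) R := fun θ => by
          simpa [norm_smul, abs_of_pos (show 0 < r from hr)] using hrR
        simp [this, hrR, G]
      · have : ∀ θ : S3, r • (θ : R4) ∉ Metric.ball (0 : R4) R := fun θ => by
          simpa [norm_smul, abs_of_pos (show 0 < r from hr)] using hrR
        simp [this, hrR]
    have h1 := integrable_polar hint
    have h2 := integral_polar hint
    rw [integral_indicator Metric.isOpen_ball.measurableSet,
      setIntegral_congr_fun measurableSet_Ioi hG, setIntegral_indicator measurableSet_Iio,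
      Ioi_inter_Iio] at h2
    rw [integrableOn_congr_fun hG measurableSet_Ioi, ← integrable_indicator_iff measurableSet_Ioi,
      indicator_indicator, Ioi_inter_Iio, integrable_indicator_iff measurableSet_Ioo] at h1
    refine ⟨h1.congr_set_ae Ioo_ae_eq_Ioc.symm, ?_⟩
    rw [h2, intervalIntegral.integral_of_le hR.le, integral_Ioc_eq_integral_Ioo]
  -- For positive radii G is r³ times `sphInt f` at log r, so it inherits the continuity of `sphInt
  -- f`.
  have hGc : ContinuousAt G (exp t) := by
    have h1 : G =ᶠ[𝓝 (exp t)] fun r => r ^ 3 * sphInt f (log r) := by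
      filter_upwards [lt_mem_nhds (exp_pos t)] with r hr
      simp [G, sphInt, exp_log hr]
    refine ContinuousAt.congr ?_ h1.symm
    exact (continuousAt_id.pow 3).mul ((continuous_sphInt hf).continuousAt.comp
      (continuousAt_log (exp_pos t).ne'))
  have hGm : StronglyMeasurableAtFilter G (𝓝 (exp t)) := by
    refine ContinuousOn.stronglyMeasurableAtFilter (s := Ioi 0) isOpen_Ioi ?_ _ (exp_pos t)
    have : ContinuousOn (fun r => r ^ 3 * sphInt f (log r)) (Ioi 0) :=
      (continuousOn_id.pow 3).mul ((continuous_sphInt hf).comp_continuousOn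
        (continuousOn_log.mono fun r hr => ne_of_gt hr))
    refine this.congr fun r hr => ?_
    simp [G, sphInt, exp_log (show 0 < r from hr)]
  have hFTC := intervalIntegral.integral_hasDerivAt_right
    ((intervalIntegrable_iff_integrableOn_Ioc_of_le (exp_pos t).le).2 (hball _ (exp_pos t)).1)
    hGm hGc
  have := hFTC.comp t (hasDerivAt_exp t)
  have he : (fun s => ∫ x in Metric.ball (0 : R4) (exp s), f x) =
      (fun R => ∫ r in (0 : ℝ)..R, G r) ∘ exp := by
    funext s
    exact (hball _ (exp_pos s)).2
  rw [he]
  refine this.congr_deriv ?_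
  change exp t ^ 3 * sphInt f t * exp t = exp (4 * t) * _
  rw [show exp (4 * t) = exp t ^ 4 by rw [← exp_nat_mul]; norm_num]
  ring

end

/-! ### The quaternionic frame of the spheres -/

/-- Quaternion multiplication `x ↦ h x` on `ℝ⁴`. -/
def quatMul (h : R4) : R4 →L[ℝ] R4 :=
  LinearMap.toContinuousLinearMap
    { toFun := fun x => !₂[h 0 * x 0 - h 1 * x 1 - h 2 * x 2 - h 3 * x 3,
        h 0 * x 1 + h 1 * x 0 + h 2 * x 3 - h 3 * x 2,
        h 0 * x 2 - h 1 * x 3 + h 2 * x 0 + h 3 * x 1,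
        h 0 * x 3 + h 1 * x 2 - h 2 * x 1 + h 3 * x 0]
      map_add' := fun x y => by ext k; fin_cases k <;> simp <;> ring
      map_smul' := fun c x => by ext k; fin_cases k <;> simp <;> ring }

theorem quatMul_apply (h x : R4) : quatMul h x =
    !₂[h 0 * x 0 - h 1 * x 1 - h 2 * x 2 - h 3 * x 3,
        h 0 * x 1 + h 1 * x 0 + h 2 * x 3 - h 3 * x 2,
        h 0 * x 2 - h 1 * x 3 + h 2 * x 0 + h 3 * x 1,
        h 0 * x 3 + h 1 * x 2 - h 2 * x 1 + h 3 * x 0] := rfl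

attribute [irreducible] quatMul

theorem norm_sq_eq_sum (x : R4) : ‖x‖ ^ 2 = x 0 ^ 2 + x 1 ^ 2 + x 2 ^ 2 + x 3 ^ 2 := by
  rw [EuclideanSpace.norm_sq_eq]
  simp [Fin.sum_univ_four]

/-- Euler's four-square identity. -/
theorem norm_quatMul (h x : R4) : ‖quatMul h x‖ = ‖h‖ * ‖x‖ := by
  rw [← sq_eq_sq₀ (norm_nonneg _) (by positivity), mul_pow, norm_sq_eq_sum, norm_sq_eq_sum,
    norm_sq_eq_sum, quatMul_apply]
  simp
  ring

theorem quatMul_add_left (h k x : R4) : quatMul (h + k) x = quatMul h x + quatMul k x := by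
  simp only [quatMul_apply]
  ext i; fin_cases i <;> simp <;> ring

theorem quatMul_smul_left (c : ℝ) (h x : R4) : quatMul (c • h) x = c • quatMul h x := by
  simp only [quatMul_apply]
  ext i; fin_cases i <;> simp <;> ring

theorem quatMul_one_left (x : R4) : quatMul (eb 0) x = x := by
  rw [quatMul_apply]
  ext i; fin_cases i <;> simp

/-- Left multiplication by a unit quaternion. -/
def quatLeft (h : S3) : R4 ≃ₗᵢ[ℝ] R4 :=
  LinearIsometry.toLinearIsometryEquiv
    { toLinearMap := (quatMul h : R4 →ₗ[ℝ] R4)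
      norm_map' := fun x => by simp [norm_quatMul] } rfl

/-- Right multiplication by a unit quaternion. -/
def quatRight (θ : S3) : R4 ≃ₗᵢ[ℝ] R4 :=
  LinearIsometry.toLinearIsometryEquiv
    { toFun := fun h => quatMul h θ
      map_add' := fun h k => quatMul_add_left h k θ
      map_smul' := fun c h => quatMul_smul_left c h θ
      norm_map' := fun x => by simp [norm_quatMul] } rfl

/-- The derivative of `f` along a linear vector field. -/
def lieD (V : R4 →L[ℝ] R4) (f : R4 → ℝ) (x : R4) : ℝ := fderiv ℝ f x (V x)

section

variable {f : R4 → ℝ} (hf : ContDiffOn ℝ ∞ f {0}ᶜ)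
include hf

theorem contDiffOn_lieD (V : R4 →L[ℝ] R4) : ContDiffOn ℝ ∞ (lieD V f) {0}ᶜ :=
  (hf.fderiv_of_isOpen isOpen_punctured (m := ∞) (by simp)).clm_apply V.contDiff.contDiffOn

/-- Besides the Hessian, differentiating the linear coefficients of V contributes the first-order
term along V(Vx). For the quaternion units V² = -1, which turns it into minus the Euler derivative.
-/
theorem lieD_lieD (V : R4 →L[ℝ] R4) {x : R4} (hx : x ≠ 0) : lieD V (lieD V f) x =
    ∑ i, ∑ j, V x i * V x j * pd i (pd j f) x + ∑ j, V (V x) j * pd j f x := by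
  have h1 : ∀ j, DifferentiableAt ℝ (pd j f) x := fun j =>
    differentiableAt_of_smooth isOpen_punctured (contDiffOn_pd isOpen_punctured hf j) hx
  have hV : ∀ j, HasFDerivAt (fun y => V y j)
      ((EuclideanSpace.proj j : R4 →L[ℝ] ℝ).comp V) x := fun j =>
    ((EuclideanSpace.proj j : R4 →L[ℝ] ℝ).comp V).hasFDerivAt
  have he : lieD V f = fun y => ∑ j, V y j * pd j f y := by
    funext y; exact fderiv_eq_sum_pd _
  have hd := (HasFDerivAt.fun_sum (u := Finset.univ) fun j _ =>
    (hV j).fun_mul (h1 j).hasFDerivAt).fderiv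
  rw [he]
  simp only [lieD]
  rw [hd]
  simp only [_root_.sum_apply, _root_.add_apply,
    _root_.smul_apply, ContinuousLinearMap.comp_apply, smul_eq_mul,
    fderiv_eq_sum_pd (V x), Finset.sum_add_distrib, Finset.mul_sum]
  congr 1
  · rw [Finset.sum_comm]
    refine Finset.sum_congr rfl fun i _ => Finset.sum_congr rfl fun j _ => by ring
  · refine Finset.sum_congr rfl fun j _ => ?_
    simp; ring

/-- The vectors x, ix, jx, kx are orthogonal of length |x|, so the Hessian traced along them is |x|²
Δf. The first-order corrections are +1 from the identity and -1 from each quaternion unit, in total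
-2 Euler derivatives, which the middle term restores. -/
theorem norm_sq_mul_lap {x : R4} (hx : x ≠ 0) : ‖x‖ ^ 2 * lap f x =
    euler (euler f) x + 2 * euler f x + lieD (quatMul (eb 1)) (lieD (quatMul (eb 1)) f) x
      + lieD (quatMul (eb 2)) (lieD (quatMul (eb 2)) f) x
      + lieD (quatMul (eb 3)) (lieD (quatMul (eb 3)) f) x := by
  have hE : euler (euler f) x = lieD (.id ℝ R4) (lieD (.id ℝ R4) f) x := rfl
  have hE' : euler f x = lieD (.id ℝ R4) f x := rfl
  have hc := pd_comm isOpen_punctured hf hx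
  rw [hE, hE']
  simp only [lieD_lieD hf _ hx]
  simp only [lieD, fderiv_eq_sum_pd, lap, norm_sq_eq_sum, quatMul_apply, Fin.sum_univ_four,
    hc 1 0, hc 2 0, hc 3 0, hc 2 1, hc 3 1, hc 3 2]
  simp
  ring

omit hf in
theorem norm_sq_mul_gradSq {x : R4} : ‖x‖ ^ 2 * gradSq f x =
    euler f x ^ 2 + lieD (quatMul (eb 1)) f x ^ 2 + lieD (quatMul (eb 2)) f x ^ 2
      + lieD (quatMul (eb 3)) f x ^ 2 := by
  simp only [lieD, euler, fderiv_eq_sum_pd, gradSq, norm_sq_eq_sum, quatMul_apply,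
    Fin.sum_univ_four]
  simp
  ring

omit hf in
theorem abs_fderiv_le (x v : R4) : |fderiv ℝ f x v| ≤ √(gradSq f x) * ‖v‖ := by
  rw [fderiv_eq_sum_pd, EuclideanSpace.norm_eq]
  simp only [Real.norm_eq_abs, sq_abs]
  rw [← sqrt_mul (show 0 ≤ gradSq f x from Finset.sum_nonneg fun i _ => sq_nonneg _)]
  refine abs_le_sqrt ?_
  rw [mul_comm (gradSq f x)]
  exact Finset.sum_mul_sq_le_sq_mul_sq _ _ _

end

/-- The unit quaternion `cos s + n sin s`, for a unit imaginary quaternion `n`. -/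
def quatRot (n : R4) (s : ℝ) : R4 := cos s • eb 0 + sin s • n

theorem norm_quatRot {n : R4} (hn : ‖n‖ = 1) (hn0 : n 0 = 0) (s : ℝ) : ‖quatRot n s‖ = 1 := by
  have h1 : n 1 ^ 2 + n 2 ^ 2 + n 3 ^ 2 = 1 := by
    have := norm_sq_eq_sum n
    rw [hn, hn0] at this; linarith
  rw [← sq_eq_sq₀ (norm_nonneg _) zero_le_one, norm_sq_eq_sum, quatRot]
  simp [hn0]
  linear_combination sin s ^ 2 * h1 + sin_sq_add_cos_sq s

theorem continuous_quatMul : Continuous fun p : R4 × R4 => quatMul p.1 p.2 := by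
  simp only [quatMul_apply]
  refine (PiLp.continuous_toLp 2 _).comp (continuous_pi fun i => ?_)
  fin_cases i <;> simp <;> fun_prop

theorem _root_.Continuous.quatMul {X : Type*} [TopologicalSpace X] {u v : X → R4}
    (hu : Continuous u) (hv : Continuous v) : Continuous fun x => ConformalR4.quatMul (u x) (v x) :=
  Continuous.comp (g := fun p : R4 × R4 => ConformalR4.quatMul p.1 p.2) continuous_quatMul
    (hu.prodMk hv)

theorem continuous_quatRot (n : R4) : Continuous (quatRot n) := by
  unfold quatRot; fun_prop

/-- The shift `a` is 0 for the rotation path itself and π/2 for its velocity. -/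
theorem continuous_smul_quatRot (n : R4) (t a : ℝ) :
    Continuous fun p : ℝ × S3 => exp t • quatMul (quatRot n (p.1 + a)) (p.2 : R4) := by
  have h : Continuous fun p : ℝ × S3 => quatMul (quatRot n (p.1 + a)) (p.2 : R4) :=
    Continuous.quatMul ((continuous_quatRot n).comp
      (continuous_fst.add continuous_const)) (continuous_subtype_val.comp continuous_snd)
  have h' := h.const_smul (exp t)
  exact h'

/-- Differentiating cos s + n sin s advances the angle by a quarter turn, so the velocity stays in
the same family of unit quaternions. -/
theorem hasDerivAt_quatRot (n : R4) (s : ℝ) :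
    HasDerivAt (quatRot n) (quatRot n (s + π / 2)) s := by
  have := ((hasDerivAt_cos s).smul_const (eb 0)).add ((hasDerivAt_sin s).smul_const n)
  rw [quatRot, cos_add_pi_div_two, sin_add_pi_div_two]
  exact this

/-! ### Invariance of spherical integrals under quaternionic rotations. -/

section

variable {f : R4 → ℝ} (hf : ContDiffOn ℝ ∞ f {0}ᶜ) {n : R4} (hn : ‖n‖ = 1) (hn0 : n 0 = 0)

theorem smul_quatRot_ne_zero (hn : ‖n‖ = 1) (hn0 : n 0 = 0) (t s : ℝ) (θ : S3) :
    exp t • quatMul (quatRot n s) θ ≠ 0 := by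
  rw [← norm_ne_zero_iff, norm_smul, norm_quatMul, norm_quatRot hn hn0]
  simp [(exp_pos t).ne']

include hf hn hn0

theorem hasDerivAt_comp_quatRot (t s : ℝ) (θ : S3) :
    HasDerivAt (fun s => f (exp t • quatMul (quatRot n s) θ))
      (fderiv ℝ f (exp t • quatMul (quatRot n s) θ)
        (exp t • quatMul (quatRot n (s + π / 2)) θ)) s := by
  have hd := (differentiableAt_of_smooth isOpen_punctured hf
    (smul_quatRot_ne_zero hn hn0 t s θ)).hasFDerivAt
  have hq : HasDerivAt (fun s => quatMul (quatRot n s) θ) (quatMul (quatRot n (s + π / 2)) θ) s :=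
    (LinearMap.toContinuousLinearMap
      (quatRight θ).toLinearEquiv.toLinearMap).hasFDerivAt.comp_hasDerivAt s (hasDerivAt_quatRot n s)
  exact hd.comp_hasDerivAt s (hq.const_smul (exp t))

theorem continuous_deriv_comp_quatRot (t : ℝ) :
    Continuous fun p : ℝ × S3 => fderiv ℝ f (exp t • quatMul (quatRot n p.1) p.2)
        (exp t • quatMul (quatRot n (p.1 + π / 2)) p.2) := by
  have h1 : Continuous fun p : ℝ × S3 => exp t • quatMul (quatRot n p.1) (p.2 : R4) := by
    simpa using continuous_smul_quatRot n t 0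
  have h3 : ContinuousOn (fderiv ℝ f) {0}ᶜ :=
    (hf.fderiv_of_isOpen isOpen_punctured (m := ∞) (by simp)).continuousOn
  exact (h3.comp_continuous h1 fun p => smul_quatRot_ne_zero hn hn0 t p.1 p.2).clm_apply
    (continuous_smul_quatRot n t (π / 2))

omit hf in
theorem integral_comp_quatRot {g : R4 → ℝ} (hg : ContinuousOn g {0}ᶜ) (t s : ℝ) :
    ∫ θ : S3, g (exp t • quatMul (quatRot n s) θ) ∂sig = sphInt g t := by
  have hs : quatRot n s ∈ Metric.sphere (0 : R4) 1 := by simp [norm_quatRot hn hn0]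
  exact integral_sphereMap (quatLeft ⟨_, hs⟩) (continuous_slice hg t)

/-- The field x ↦ nx generates rotations of the sphere. The integral of f over the sphere is
constant along this flow, and its derivative at angle 0 is the integral of the Lie derivative. -/
theorem sphInt_lieD_quatMul (t : ℝ) : sphInt (lieD (quatMul n) f) t = 0 := by
  have hd := hasDerivAt_integral_sphere
    (F := fun s (θ : S3) => f (exp t • quatMul (quatRot n s) θ))
    (F' := fun s (θ : S3) => fderiv ℝ f (exp t • quatMul (quatRot n s) θ)
        (exp t • quatMul (quatRot n (s + π / 2)) θ))
    (hf.continuousOn.comp_continuous (by simpa using continuous_smul_quatRot n t 0)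
      fun p => smul_quatRot_ne_zero hn hn0 t p.1 p.2)
    (continuous_deriv_comp_quatRot hf hn hn0 t) (fun s θ => hasDerivAt_comp_quatRot hf hn hn0 t s θ)
    0
  simp only [integral_comp_quatRot hn hn0 hf.continuousOn t] at hd
  have h0 := hd.unique (hasDerivAt_const 0 _)
  have e1 : quatRot n 0 = eb 0 := by simp [quatRot]
  have e2 : quatRot n (0 + π / 2) = n := by simp [quatRot]
  rw [← h0, sphInt]
  refine integral_congr_ae (.of_forall fun θ => ?_)
  simp only [e1, e2, quatMul_one_left, lieD, map_smul]

end

/-! ### Spherical means of the Laplacian, and a Poincaré inequality. -/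

section

variable {f : R4 → ℝ} (hf : ContDiffOn ℝ ∞ f {0}ᶜ)
include hf

/-- The spherical means of the Laplacian. -/
theorem sphInt_lap (t : ℝ) : exp (2 * t) * sphInt (lap f) t =
    sphInt (euler (euler f)) t + 2 * sphInt (euler f) t := by
  have hE := contDiffOn_euler isOpen_punctured hf
  have hEE := contDiffOn_euler isOpen_punctured hE
  have hn : ∀ a : Fin 4, ‖eb a‖ = 1 := fun a => by simp
  have hL := fun a : Fin 4 => contDiffOn_lieD (contDiffOn_lieD hf (quatMul (eb a))) (quatMul (eb a))
  -- The three tangential second derivatives integrate to zero, which leaves only the radial ones.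
  have h0 := fun (a : Fin 4) (ha : a ≠ 0) =>
    sphInt_lieD_quatMul (contDiffOn_lieD hf (quatMul (eb a))) (hn a)
      (by simp [ha.symm]) t
  have hi := fun a : Fin 4 => integrable_slice (hL a).continuousOn t
  have h1 := h0 1 (by decide)
  have h2 := h0 2 (by decide)
  have h3 := h0 3 (by decide)
  have hnr : ∀ θ : S3, ‖exp t • (θ : R4)‖ ^ 2 = exp (2 * t) := fun θ => by
    rw [norm_smul, norm_S3, Real.norm_eq_abs, abs_of_pos (exp_pos t), mul_one, ← exp_nat_mul]
    rfl
  have hmain := fun θ : S3 => (congrArg (· * lap f (exp t • (θ : R4))) (hnr θ).symm).trans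
    (norm_sq_mul_lap hf (smul_S3_ne_zero (exp_pos t).ne' θ))
  have i1 := integrable_slice hEE.continuousOn t
  have i2 := (integrable_slice hE.continuousOn t).const_mul 2
  rw [sphInt, ← integral_const_mul]
  simp only [hmain]
  rw [integral_add (((i1.fun_add i2).fun_add (hi 1)).fun_add (hi 2)) (hi 3),
    integral_add ((i1.fun_add i2).fun_add (hi 1)) (hi 2), integral_add (i1.fun_add i2) (hi 1),
    integral_add i1 i2, integral_const_mul]
  simp only [sphInt] at h1 h2 h3 ⊢
  rw [h1, h2, h3]
  ring

-- The polar form of a unit quaternion. The angle in [0, π] bounds the length of the rotation path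
-- leading from 1 to h.
omit hf in
theorem exists_quatRot_eq (h : S3) :
    ∃ n : R4, ‖n‖ = 1 ∧ n 0 = 0 ∧ ∃ s ∈ Icc 0 π, quatRot n s = h := by
  have h1 := norm_sq_eq_sum (h : R4)
  rw [norm_S3, one_pow] at h1
  have hle : -1 ≤ (h : R4) 0 ∧ (h : R4) 0 ≤ 1 :=
    abs_le.1 (abs_le_one_iff_mul_self_le_one.2 (by nlinarith))
  have hs0 := sin_arccos ((h : R4) 0)
  have hc0 := cos_arccos hle.1 hle.2
  by_cases hz : √(1 - (h : R4) 0 ^ 2) = 0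
  -- For h = ±1 the imaginary part vanishes and the axis is arbitrary.
  · refine ⟨eb 1, by simp, by simp, arccos ((h : R4) 0), ⟨arccos_nonneg _, arccos_le_pi _⟩, ?_⟩
    have hz' : (h : R4) 1 ^ 2 + (h : R4) 2 ^ 2 + (h : R4) 3 ^ 2 = 0 := by
      have := sqrt_eq_zero (by nlinarith) |>.1 hz
      linarith
    have z1 : (h : R4) 1 = 0 := by nlinarith
    have z2 : (h : R4) 2 = 0 := by nlinarith
    have z3 : (h : R4) 3 = 0 := by nlinarith
    rw [quatRot, hs0, hc0, hz]
    ext i; fin_cases i <;> simp [z1, z2, z3]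
  · refine ⟨(√(1 - (h : R4) 0 ^ 2))⁻¹ • ((h : R4) - (h : R4) 0 • eb 0), ?_, by simp,
      arccos ((h : R4) 0), ⟨arccos_nonneg _, arccos_le_pi _⟩, ?_⟩
    · rw [← sq_eq_sq₀ (norm_nonneg _) zero_le_one, norm_smul, mul_pow, norm_sq_eq_sum]
      rw [Real.norm_eq_abs, sq_abs, inv_pow, sq_sqrt (by nlinarith)]
      have hz2 : 1 - (h : R4) 0 ^ 2 ≠ 0 := fun h0 => hz (by rw [h0, sqrt_zero])
      simp
      field_simp
      linarith
    · rw [quatRot, hs0, hc0, smul_smul, mul_inv_cancel₀ hz, one_smul]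
      abel

/-- Along the rotation path the speed is |x|, so the difference is at most the integral of |x||∇f|
over the path. After exchanging integrals each angle contributes the same amount by rotation
invariance, and the angles fill an interval of length at most π. -/
theorem integral_abs_comp_quatRot_sub_le {n : R4} (hn : ‖n‖ = 1) (hn0 : n 0 = 0) (t : ℝ) {s : ℝ}
    (hs : s ∈ Icc 0 π) :
    ∫ θ : S3, |f (exp t • quatMul (quatRot n s) θ) - f (exp t • (θ : R4))| ∂sig
      ≤ π * sphInt (fun x => ‖x‖ * √(gradSq f x)) t := by
  set N : R4 → ℝ := fun x => ‖x‖ * √(gradSq f x)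
  have hN : ContinuousOn N {0}ᶜ := continuous_norm.continuousOn.mul
    (contDiffOn_gradSq isOpen_punctured hf).continuousOn.sqrt
  have hN0 : 0 ≤ sphInt N t := integral_nonneg fun θ => by positivity
  have hcont := continuous_deriv_comp_quatRot hf hn hn0 t
  have hcN : Continuous fun p : ℝ × S3 => N (exp t • quatMul (quatRot n p.1) p.2) :=
    hN.comp_continuous (by simpa using continuous_smul_quatRot n t 0)
      fun p => smul_quatRot_ne_zero hn hn0 t p.1 p.2
  have hpt : ∀ θ : S3, |f (exp t • quatMul (quatRot n s) θ) - f (exp t • (θ : R4))| ≤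
      ∫ a in (0 : ℝ)..s, N (exp t • quatMul (quatRot n a) θ) := by
    intro θ
    have hc1 : Continuous fun a : ℝ => fderiv ℝ f (exp t • quatMul (quatRot n a) θ)
        (exp t • quatMul (quatRot n (a + π / 2)) θ) := by
      have h := hcont.comp (Continuous.prodMk_left θ)
      exact h
    have hc2 : Continuous fun a : ℝ => N (exp t • quatMul (quatRot n a) θ) := by
      have h := hcN.comp (Continuous.prodMk_left θ)
      exact h
    have hftc := intervalIntegral.integral_eq_sub_of_hasDerivAt
      (fun a _ => hasDerivAt_comp_quatRot hf hn hn0 t a θ) (hc1.intervalIntegrable 0 s)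
    have e1 : quatRot n 0 = eb 0 := by simp [quatRot]
    rw [e1, quatMul_one_left] at hftc
    rw [← hftc, ← Real.norm_eq_abs]
    refine (intervalIntegral.norm_integral_le_integral_norm hs.1).trans ?_
    refine intervalIntegral.integral_mono_on hs.1
      (hc1.norm.intervalIntegrable 0 s) (hc2.intervalIntegrable 0 s) fun a _ => ?_
    have hle := abs_fderiv_le (f := f) (exp t • quatMul (quatRot n a) θ)
      (exp t • quatMul (quatRot n (a + π / 2)) θ)
    refine le_trans hle (le_of_eq ?_)
    simp only [N, norm_smul, norm_quatMul, norm_quatRot hn hn0]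
    ring
  have hI : Integrable (fun p : ℝ × S3 =>
      N (exp t • quatMul (quatRot n p.1) p.2)) ((volume.restrict (uIoc 0 s)).prod sig) := by
    obtain ⟨C, hC⟩ := ((isCompact_Icc (a := 0) (b := s)).prod
      (isCompact_univ (X := S3))).exists_bound_of_continuousOn hcN.continuousOn
    have : IsFiniteMeasure (volume.restrict (uIoc 0 s)) := ⟨by simp [uIoc]⟩
    have hm : ∀ᵐ p ∂((volume.restrict (uIoc 0 s)).prod sig), p.1 ∈ uIoc 0 s :=
      (Measure.quasiMeasurePreserving_fst).ae (ae_restrict_mem measurableSet_uIoc)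
    refine Integrable.of_bound hcN.aestronglyMeasurable C ?_
    filter_upwards [hm] with p hp
    rw [uIoc_of_le hs.1] at hp
    exact hC p ⟨Ioc_subset_Icc_self hp, mem_univ _⟩
  have hfr2 : Continuous fun p : ℝ × S3 => f (exp t • quatMul (quatRot n p.1) p.2) :=
    hf.continuousOn.comp_continuous (by simpa using continuous_smul_quatRot n t 0)
      fun p => smul_quatRot_ne_zero hn hn0 t p.1 p.2
  have hfr := hfr2.comp (Continuous.prodMk_right s)
  calc _ ≤ ∫ θ : S3, (∫ a in (0 : ℝ)..s, N (exp t • quatMul (quatRot n a) θ)) ∂sig := by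
        have h1 := integrable_sphere (hfr.sub (continuous_slice hf.continuousOn t)).abs
        have h2 := hI.integral_prod_right
        rw [uIoc_of_le hs.1] at h2
        simp only [intervalIntegral.integral_of_le hs.1] at hpt ⊢
        exact integral_mono h1 h2 hpt
    _ = ∫ a in (0 : ℝ)..s, ∫ θ : S3, N (exp t • quatMul (quatRot n a) θ) ∂sig :=
        (intervalIntegral_integral_swap (f := fun (a : ℝ) (θ : S3) =>
          N (exp t • quatMul (quatRot n a) θ)) hI).symm
    _ = s * sphInt N t := by
        simp [integral_comp_quatRot hn hn0 hN]
    _ ≤ _ := mul_le_mul_of_nonneg_right hs.2 hN0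

/-- The Poincaré inequality on the sphere of radius `e^t`, in its `L¹` form. -/
theorem integral_abs_sub_mean_le (t : ℝ) :
    ∫ θ : S3, |f (exp t • (θ : R4)) - sphInt f t / areaS3| ∂sig ≤
      π * sphInt (fun x => ‖x‖ * √(gradSq f x)) t := by
  set N : R4 → ℝ := fun x => ‖x‖ * √(gradSq f x)
  have hN : ContinuousOn N {0}ᶜ := continuous_norm.continuousOn.mul
    (contDiffOn_gradSq isOpen_punctured hf).continuousOn.sqrt
  have hN0 : 0 ≤ sphInt N t := integral_nonneg fun θ => by positivity
  have hrot := fun (n : R4) hn hn0 s hs =>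
    integral_abs_comp_quatRot_sub_le hf (n := n) hn hn0 t (s := s) hs
  have hleft : ∀ h : S3, ∫ θ : S3, |f (exp t • quatMul h θ) - f (exp t • (θ : R4))| ∂sig
      ≤ π * sphInt N t := by
    intro h
    obtain ⟨n, hn, hn0, s, hs, he⟩ := exists_quatRot_eq h
    rw [← he]
    exact hrot n hn hn0 s hs
  have hc2 : Continuous fun p : S3 × S3 => f (exp t • quatMul (p.1 : R4) (p.2 : R4)) := by
    have h : Continuous fun p : S3 × S3 => quatMul (p.1 : R4) (p.2 : R4) :=
      Continuous.quatMul (continuous_subtype_val.comp continuous_fst)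
        (continuous_subtype_val.comp continuous_snd)
    have h' := h.const_smul (exp t)
    refine hf.continuousOn.comp_continuous h' fun p => ?_
    rw [mem_compl_iff, mem_singleton_iff, ← norm_eq_zero, norm_smul, norm_quatMul]
    simp [(exp_pos t).ne']
  have hc3 : Continuous fun p : S3 × S3 =>
      |f (exp t • quatMul (p.1 : R4) (p.2 : R4)) - f (exp t • (p.2 : R4))| :=
    (hc2.sub ((continuous_slice hf.continuousOn t).comp continuous_snd)).abs
  -- For fixed θ, h ↦ hθ is also an isometry of the sphere. Hence averaging f(hθ) - f(θ) over h
  -- yields the mean of f minus f(θ).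
  have hmean : ∀ θ : S3, areaS3 * |f (exp t • (θ : R4)) - sphInt f t / areaS3| ≤
      ∫ h : S3, |f (exp t • quatMul h θ) - f (exp t • (θ : R4))| ∂sig := by
    intro θ
    have h1 : ∫ h : S3, f (exp t • quatMul h θ) ∂sig = sphInt f t :=
      integral_sphereMap (quatRight θ) (continuous_slice hf.continuousOn t)
    have h2 : ∫ h : S3, (f (exp t • quatMul h θ) - f (exp t • (θ : R4))) ∂sig =
        sphInt f t - areaS3 * f (exp t • (θ : R4)) := by
      have hi : Integrable (fun h : S3 => f (exp t • quatMul h θ)) sig :=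
        integrable_sphere (hc2.comp (Continuous.prodMk_left θ))
      rw [integral_sub hi (integrable_const _), h1, integral_sphere_const]
    rw [← abs_of_pos areaS3_pos, ← abs_mul, abs_of_pos areaS3_pos, mul_sub,
      mul_div_cancel₀ _ areaS3_pos.ne', ← neg_sub, ← h2, abs_neg]
    exact abs_integral_le_integral_abs
  have hI : Integrable (fun p : S3 × S3 =>
      |f (exp t • quatMul (p.1 : R4) (p.2 : R4)) - f (exp t • (p.2 : R4))|) (sig.prod sig) :=
    hc3.integrable_of_hasCompactSupport (HasCompactSupport.of_compactSpace _)
  have hfin : areaS3 * ∫ θ : S3, |f (exp t • (θ : R4)) - sphInt f t / areaS3| ∂sig ≤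
      areaS3 * (π * sphInt N t) := by
    rw [← integral_const_mul, ← integral_sphere_const]
    calc _ ≤ ∫ θ : S3, (∫ h : S3, |f (exp t • quatMul h θ) - f (exp t • (θ : R4))| ∂sig) ∂sig :=
          integral_mono ((integrable_sphere ((continuous_slice hf.continuousOn t).sub
            continuous_const).abs).const_mul _) hI.integral_prod_right hmean
      _ = ∫ h : S3, (∫ θ : S3, |f (exp t • quatMul h θ) - f (exp t • (θ : R4))| ∂sig) ∂sig :=
          (integral_integral_swap hI).symm
      _ ≤ _ := integral_mono hI.integral_prod_left (integrable_const _) hleft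
  exact le_of_mul_le_mul_left hfin areaS3_pos

end

/-! ### Ordinary differential equations and inequalities -/

/-- A function on a half-line with `q' ≤ 1 - q²` is bounded. -/
theorem bounded_of_riccati {q q' : ℝ → ℝ} {T : ℝ} (hd : ∀ t, HasDerivAt q (q' t) t)
    (hq : ∀ t, T ≤ t → q' t ≤ 1 - q t ^ 2) : ∃ C, ∀ t, T ≤ t → |q t| ≤ C := by
  have hc : Continuous q := continuous_iff_continuousAt.2 fun t => (hd t).continuousAt
  -- Since 1 - q² ≤ -2(q - 1), the tangent line at q = 1, the quantity (q - 1)e^{2s} decreases.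
  have hup : ∀ t, T ≤ t → q t ≤ max (q T) 1 := by
    intro t ht
    have hanti : AntitoneOn (fun s => (q s - 1) * exp (2 * s)) (Ici T) := by
      refine antitoneOn_of_hasDerivWithinAt_nonpos
        (f' := fun s => q' s * exp (2 * s) + (q s - 1) * (exp (2 * s) * 2)) (convex_Ici T) (by fun_prop)
        (fun s _ => ?_) fun s hs => ?_
      · have h2 : HasDerivAt (fun s : ℝ => exp (2 * s)) (exp (2 * s) * 2) s := by
          simpa using ((hasDerivAt_id s).const_mul 2).exp
        exact (((hd s).sub_const 1).mul h2).hasDerivWithinAt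
      · rw [interior_Ici] at hs
        have := hq s (le_of_lt hs)
        have he := exp_pos (2 * s)
        have : q' s + 2 * (q s - 1) ≤ 0 := by nlinarith [sq_nonneg (q s - 1)]
        nlinarith
    have h := hanti (mem_Ici.2 le_rfl) (mem_Ici.2 ht) ht
    by_contra hcon
    rw [not_le, max_lt_iff] at hcon
    simp only at h
    have h1 : exp (2 * T) ≤ exp (2 * t) := exp_le_exp.2 (by linarith)
    have := exp_pos (2 * t)
    have := exp_pos (2 * T)
    nlinarith [mul_le_mul_of_nonneg_left h1 (by linarith [hcon.2] : (0 : ℝ) ≤ q t - 1)]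
  -- Below -1 the inequality forces blow-up to -∞ in finite time, which is impossible for a function
  -- differentiable on the whole line. The tangent line of 1 - q² at q = -1 first shows that q never
  -- climbs back above q t₀.
  have hlow : ∀ t, T ≤ t → -1 ≤ q t := by
    intro t₀ ht₀
    by_contra hcon
    rw [not_le] at hcon
    have hanti : ∀ t, t₀ ≤ t → q t ≤ q t₀ := by
      intro t ht
      have hA : AntitoneOn (fun s => (q s + 1) * exp (-(2 * s))) (Ici t₀) := by
        refine antitoneOn_of_hasDerivWithinAt_nonpos
          (f' := fun s => q' s * exp (-(2 * s)) + (q s + 1) * (exp (-(2 * s)) * (-2)))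
          (convex_Ici t₀) (by fun_prop) (fun s _ => ?_) fun s hs => ?_
        · have h2 : HasDerivAt (fun s : ℝ => exp (-(2 * s))) (exp (-(2 * s)) * (-2)) s := by
            simpa using ((hasDerivAt_id s).const_mul 2).neg.exp
          exact (((hd s).add_const 1).mul h2).hasDerivWithinAt
        · rw [interior_Ici] at hs
          have := hq s (ht₀.trans (le_of_lt hs))
          have he := exp_pos (-(2 * s))
          have : q' s - 2 * (q s + 1) ≤ 0 := by nlinarith [sq_nonneg (q s + 1)]
          nlinarith
      have h := hA (mem_Ici.2 le_rfl) (mem_Ici.2 ht) ht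
      simp only at h
      have h1 : exp (-(2 * t)) ≤ exp (-(2 * t₀)) := exp_le_exp.2 (by linarith)
      have h2 := exp_pos (-(2 * t))
      have h3 : (q t + 1) * exp (-(2 * t)) ≤ (q t₀ + 1) * exp (-(2 * t)) := by
        refine h.trans ?_
        nlinarith
      have := le_of_mul_le_mul_right h3 h2
      linarith
    -- (1/q)' ≥ 1 - 1/q² ≥ c. As 1/q starts above -1, it becomes positive by time t₀ + 1/c, although
    -- q is still negative there.
    set c : ℝ := 1 - 1 / q t₀ ^ 2 with hcdef
    have hc0 : 0 < c := by
      have : 1 < q t₀ ^ 2 := by nlinarith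
      have := (div_lt_one (by linarith : 0 < q t₀ ^ 2)).2 this
      linarith
    have hmono : MonotoneOn (fun s => (q s)⁻¹ - c * s) (Ici t₀) := by
      have hne : ∀ s, t₀ ≤ s → q s < -1 := fun s hs => (hanti s hs).trans_lt hcon
      refine monotoneOn_of_hasDerivWithinAt_nonneg
        (f' := fun s => -q' s / q s ^ 2 - c * 1) (convex_Ici t₀) ?_ (fun s hs => ?_) fun s hs => ?_
      · exact (hc.continuousOn.inv₀ fun s hs => by
          have := hne s hs; intro h0; linarith).sub (by fun_prop)
      · rw [interior_Ici] at hs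
        have := hne s (le_of_lt hs)
        exact (((hd s).fun_inv (by intro h0; linarith)).sub
          ((hasDerivAt_id s).const_mul c)).hasDerivWithinAt
      · rw [interior_Ici] at hs
        have h1 := hne s (le_of_lt hs)
        have h2 := hanti s (le_of_lt hs)
        have h3 := hq s (ht₀.trans (le_of_lt hs))
        have h4 : 0 < q s ^ 2 := by nlinarith
        have h5 : 0 < q t₀ ^ 2 := by nlinarith
        have h6 : q t₀ ^ 2 ≤ q s ^ 2 := by nlinarith
        have h7 : 1 / q s ^ 2 ≤ 1 / q t₀ ^ 2 := one_div_le_one_div_of_le h5 h6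
        have h8 : 1 - 1 / q s ^ 2 ≤ -q' s / q s ^ 2 := by
          rw [le_div_iff₀ h4, sub_mul, one_div, inv_mul_cancel₀ h4.ne']
          linarith
        linarith
    have ht : t₀ ≤ t₀ + 1 / c := by have := one_div_pos.2 hc0; linarith
    have h := hmono (mem_Ici.2 le_rfl) (mem_Ici.2 ht) ht
    simp only at h
    have h1 : (q (t₀ + 1 / c))⁻¹ < 0 := inv_lt_zero.2 (by linarith [hanti _ ht])
    have h2 : -1 < (q t₀)⁻¹ := by
      rw [lt_inv_of_neg (by norm_num) (by linarith)]; norm_num; linarith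
    have h3 : c * (t₀ + 1 / c) = c * t₀ + 1 := by field_simp
    linarith
  refine ⟨max |max (q T) 1| 1, fun t ht => abs_le.2 ⟨?_, ?_⟩⟩
  · have := hlow t ht
    have := le_max_right |max (q T) 1| 1
    linarith
  · exact (hup t ht).trans ((le_abs_self _).trans (le_max_left _ _))

/-- A bounded solution of `D'' = 4 D + ε` with `ε → 0` tends to zero, with its derivative. -/
theorem tendsto_zero_of_ode {D D' D'' ε : ℝ → ℝ} (hD : ∀ t, HasDerivAt D (D' t) t)
    (hD' : ∀ t, HasDerivAt D' (D'' t) t) (hode : ∀ t, D'' t = 4 * D t + ε t)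
    (hε : Tendsto ε atTop (𝓝 0)) {C T₀ : ℝ} (hC : ∀ t, T₀ ≤ t → |D t| ≤ C) :
    Tendsto D atTop (𝓝 0) ∧ Tendsto D' atTop (𝓝 0) := by
  have hDc : Continuous D := continuous_iff_continuousAt.2 fun t => (hD t).continuousAt
  have hD'c : Continuous D' := continuous_iff_continuousAt.2 fun t => (hD' t).continuousAt
  have hC0 : 0 ≤ C := (abs_nonneg _).trans (hC T₀ le_rfl)
  have hexp : ∀ (a s : ℝ), HasDerivAt (fun s : ℝ => exp (a * s)) (exp (a * s) * a) s := fun a s => by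
    simpa using ((hasDerivAt_id s).const_mul a).exp
  -- the derivative is bounded along a sequence
  have hseq : ∀ s, T₀ ≤ s → ∃ t ∈ Ioo s (s + 1), |D' t| ≤ 2 * C := by
    intro s hs
    obtain ⟨t, ht, hteq⟩ := exists_hasDerivAt_eq_slope D D' (by linarith : s < s + 1)
      hDc.continuousOn fun x _ => hD x
    refine ⟨t, ht, ?_⟩
    rw [hteq, add_sub_cancel_left, div_one]
    calc _ ≤ |D (s + 1)| + |D s| := abs_sub _ _
      _ ≤ _ := by linarith [hC s hs, hC (s + 1) (by linarith)]
  -- The operator factors as D'' - 4D = (d/dt - 2)(d/dt + 2)D. So h solves the unstable equation h'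
  -- = 2h + ε, and D is recovered from the stable equation D' + 2D = h.
  set h : ℝ → ℝ := fun t => D' t + 2 * D t with hh
  have hhc : Continuous h := by fun_prop
  have hhd : ∀ t, HasDerivAt h (D'' t + 2 * D' t) t := fun t => (hD' t).add ((hD t).const_mul 2)
  -- If ±h exceeded e at some time, then e^{-2s}(±h - e) would stay above a positive constant from
  -- then on. This contradicts the bound on h at arbitrarily late times.
  have hsmall : ∀ e > 0, ∀ T, T₀ ≤ T → (∀ t, T ≤ t → |ε t| ≤ 2 * e) → ∀ t, T ≤ t → |h t| ≤ e := by
    intro e he T hT hεT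
    have hM : ∀ σ : ℝ, |σ| = 1 → MonotoneOn (fun s => exp (-2 * s) * (σ * h s - e)) (Ici T) := by
      intro σ hσ
      refine monotoneOn_of_hasDerivWithinAt_nonneg
        (f' := fun s => exp (-2 * s) * (-2) * (σ * h s - e) +
          exp (-2 * s) * (σ * (D'' s + 2 * D' s))) (convex_Ici T) (by fun_prop)
        (fun s _ => ((hexp (-2) s).mul (((hhd s).const_mul σ).sub_const e)).hasDerivWithinAt)
        fun s hs => ?_
      rw [interior_Ici] at hs
      have h1 := abs_le.1 (hεT s (le_of_lt hs))
      have h2 : -(2 * e) ≤ σ * ε s := by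
        have := neg_abs_le (σ * ε s)
        rw [abs_mul, hσ, one_mul] at this
        linarith [hεT s (le_of_lt hs)]
      have h3 := exp_pos (-2 * s)
      simp only [hh, hode]
      nlinarith
    have hσ : ∀ σ : ℝ, |σ| = 1 → ∀ t, T ≤ t → σ * h t ≤ e := by
      intro σ hσ t ht
      by_contra hcon
      rw [not_le] at hcon
      set δ := exp (-2 * t) * (σ * h t - e)
      have hδ : 0 < δ := mul_pos (exp_pos _) (by linarith)
      have hlim : Tendsto (fun s : ℝ => exp (-2 * s) * (4 * C)) atTop (𝓝 0) := by
        have : Tendsto (fun s : ℝ => -2 * s) atTop atBot :=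
          tendsto_id.const_mul_atTop_of_neg (by norm_num)
        simpa using (tendsto_exp_atBot.comp this).mul_const (4 * C)
      obtain ⟨s, hs1, hs2⟩ := ((hlim.eventually_lt_const hδ).and (eventually_ge_atTop t)).exists
      obtain ⟨r, hr, hrD⟩ := hseq s (hT.trans (ht.trans hs2))
      have hr0 : t ≤ r := hs2.trans hr.1.le
      have hm := hM σ hσ (mem_Ici.2 ht) (mem_Ici.2 (ht.trans hr0)) hr0
      have h5 : exp (-2 * r) ≤ exp (-2 * s) := exp_le_exp.2 (by linarith [hr.1])
      have h6 : σ * h r - e ≤ 4 * C := by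
        have := le_abs_self (σ * h r)
        rw [abs_mul, hσ, one_mul] at this
        have h7 : |h r| ≤ |D' r| + 2 * |D r| := by
          refine (abs_add_le _ _).trans ?_
          rw [abs_mul, abs_two]
        linarith [hC r (hT.trans (ht.trans hr0))]
      have h8 : exp (-2 * r) * (σ * h r - e) ≤ exp (-2 * s) * (4 * C) :=
        (mul_le_mul_of_nonneg_left h6 (exp_pos _).le).trans
          (mul_le_mul_of_nonneg_right h5 (by linarith))
      have : δ ≤ exp (-2 * r) * (σ * h r - e) := hm
      linarith
    intro t ht
    refine abs_le.2 ⟨?_, ?_⟩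
    · linarith [hσ (-1) (by simp) t ht]
    · linarith [hσ 1 (by simp) t ht]
  have hh0 : Tendsto h atTop (𝓝 0) := by
    rw [Metric.tendsto_atTop] at hε ⊢
    intro e he
    obtain ⟨T, hT⟩ := hε e he
    refine ⟨max T T₀, fun t ht => ?_⟩
    rw [dist_zero_right, Real.norm_eq_abs]
    refine (hsmall (e / 2) (by linarith) (max T T₀) (le_max_right _ _) (fun s hs => ?_) t ht).trans_lt
      (by linarith)
    have := hT s ((le_max_left _ _).trans hs)
    rw [dist_zero_right, Real.norm_eq_abs] at this
    linarith
  have hD0 : Tendsto D atTop (𝓝 0) := by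
    rw [Metric.tendsto_atTop]
    intro e he
    obtain ⟨T, hT⟩ := Metric.tendsto_atTop.1 hh0 (e / 2) (by linarith)
    -- In the stable equation the homogeneous part decays like e^{-2s}, so D is eventually at most
    -- of the size of h.
    have hA : ∀ σ : ℝ, |σ| = 1 → AntitoneOn (fun s => exp (2 * s) * (σ * D s - e / 4)) (Ici T) := by
      intro σ hσ
      refine antitoneOn_of_hasDerivWithinAt_nonpos
        (f' := fun s => exp (2 * s) * 2 * (σ * D s - e / 4) + exp (2 * s) * (σ * D' s))
        (convex_Ici T) (by fun_prop)
        (fun s _ => ((hexp 2 s).mul (((hD s).const_mul σ).sub_const (e / 4))).hasDerivWithinAt)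
        fun s hs => ?_
      rw [interior_Ici] at hs
      have h1 := hT s (le_of_lt hs)
      rw [dist_zero_right, Real.norm_eq_abs] at h1
      have h2 : σ * h s ≤ e / 2 := by
        have := le_abs_self (σ * h s)
        rw [abs_mul, hσ, one_mul] at this
        linarith
      have h3 := exp_pos (2 * s)
      have : σ * D' s = σ * h s - 2 * (σ * D s) := by simp only [hh]; ring
      rw [this]
      nlinarith
    set K := exp (2 * T) * (|D T| + e)
    have hlim : Tendsto (fun s : ℝ => exp (-2 * s) * K) atTop (𝓝 0) := by
      have : Tendsto (fun s : ℝ => -2 * s) atTop atBot :=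
        tendsto_id.const_mul_atTop_of_neg (by norm_num)
      simpa using (tendsto_exp_atBot.comp this).mul_const K
    obtain ⟨T', hT'⟩ := eventually_atTop.1 (hlim.eventually_lt_const (by linarith : 0 < e / 2))
    refine ⟨max T T', fun t ht => ?_⟩
    have hσ : ∀ σ : ℝ, |σ| = 1 → σ * D t ≤ e / 4 + exp (-2 * t) * K := by
      intro σ hσ
      have h1 := hA σ hσ (mem_Ici.2 le_rfl) (mem_Ici.2 ((le_max_left _ _).trans ht))
        ((le_max_left _ _).trans ht)
      simp only at h1
      have h2 : σ * D T - e / 4 ≤ |D T| + e := by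
        have := le_abs_self (σ * D T)
        rw [abs_mul, hσ, one_mul] at this
        linarith
      have h3 : exp (2 * t) * (σ * D t - e / 4) ≤ K :=
        h1.trans (mul_le_mul_of_nonneg_left h2 (exp_pos _).le)
      have h4 : exp (-2 * t) * exp (2 * t) = 1 := by rw [← exp_add]; simp
      have h5 := mul_le_mul_of_nonneg_left h3 (exp_pos (-2 * t)).le
      rw [← mul_assoc, h4, one_mul] at h5
      linarith
    have hK := hT' t ((le_max_right _ _).trans ht)
    rw [dist_zero_right, Real.norm_eq_abs]
    exact abs_lt.2 ⟨by linarith [hσ (-1) (by simp)], by linarith [hσ 1 (by simp)]⟩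
  refine ⟨hD0, ?_⟩
  have : D' = fun t => h t - 2 * D t := by funext t; simp only [hh]; ring
  rw [this]
  simpa using hh0.sub (hD0.const_mul 2)

/-! ### The spherical mean of the conformal factor -/

section

variable {w : R4 → ℝ} (hw : ContDiffOn ℝ ∞ w {0}ᶜ)
include hw

/-- The fourth order equation of the spherical mean. -/
theorem exists_const_sphInt_ode (hB : Integrable (lap (lap w))) :
    ∃ c, ∀ t, sphInt (euler (euler (euler w))) t =
      4 * sphInt (euler w) t + c + ∫ x in Metric.ball (0 : R4) (exp t), lap (lap w) x := by
  have hU := isOpen_punctured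
  have h1 := contDiffOn_euler hU hw
  have h2 := contDiffOn_euler hU h1
  have h3 := contDiffOn_euler hU h2
  have hl := contDiffOn_lap hU hw
  have hl1 := contDiffOn_euler hU hl
  have d1 := hasDerivAt_sphInt h1
  have d2 := hasDerivAt_sphInt h2
  have d3 := hasDerivAt_sphInt h3
  have hexp : ∀ t : ℝ, HasDerivAt (fun s : ℝ => exp (-2 * s)) (exp (-2 * t) * -2) t := fun t => by
    simpa using ((hasDerivAt_id t).const_mul (-2 : ℝ)).exp
  have hee : ∀ t : ℝ, exp (-2 * t) * exp (2 * t) = 1 := fun t => by rw [← exp_add]; simp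
  have ha : sphInt (lap w) =
      fun t => exp (-2 * t) * (sphInt (euler (euler w)) t + 2 * sphInt (euler w) t) := by
    funext t
    rw [← sphInt_lap hw t, ← mul_assoc, hee, one_mul]
  have ha1 : sphInt (euler (lap w)) = fun t => exp (-2 * t) *
      (sphInt (euler (euler (euler w))) t - 4 * sphInt (euler w) t) := by
    funext t
    have hx := hasDerivAt_sphInt hl t
    rw [ha] at hx
    rw [hx.unique ((hexp t).mul ((d2 t).add ((d1 t).const_mul 2)))]
    ring
  have ha2 : ∀ t, sphInt (euler (euler (lap w))) t = exp (-2 * t) *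
      (sphInt (euler (euler (euler (euler w)))) t - 4 * sphInt (euler (euler w)) t
        - 2 * sphInt (euler (euler (euler w))) t + 8 * sphInt (euler w) t) := by
    intro t
    have hx := hasDerivAt_sphInt hl1 t
    rw [ha1] at hx
    rw [hx.unique ((hexp t).mul ((d3 t).sub ((d1 t).const_mul 4)))]
    ring
  -- The formula for spherical means of a Laplacian is applied twice, to w and to Δw. The factor
  -- e^{-2t} in between shifts the exponents, and the odd-order terms cancel.
  have hode : ∀ t, sphInt (euler (euler (euler (euler w)))) t - 4 * sphInt (euler (euler w)) t =
      exp (4 * t) * sphInt (lap (lap w)) t := by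
    intro t
    have hx := sphInt_lap hl t
    rw [ha2, ha1] at hx
    have h4 : exp (4 * t) = exp (2 * t) * exp (2 * t) := by rw [← exp_add]; ring_nf
    rw [h4, mul_assoc, hx]
    linear_combination -(sphInt (euler (euler (euler (euler w)))) t
      - 4 * sphInt (euler (euler w)) t) * hee t
  -- e^{4t} times the spherical integral of Δ²w is the t-derivative of its integral over the ball,
  -- so the equation integrates once with a constant.
  have hd : ∀ t, HasDerivAt (fun t => sphInt (euler (euler (euler w))) t
      - 4 * sphInt (euler w) t - ∫ x in Metric.ball (0 : R4) (exp t), lap (lap w) x) 0 t := by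
    intro t
    have hx := ((d3 t).sub ((d1 t).const_mul 4)).sub (hasDerivAt_integral_ball
      (contDiffOn_lap hU hl).continuousOn (fun R => hB.integrableOn) t)
    rw [hode, sub_self] at hx
    exact hx
  refine ⟨sphInt (euler (euler (euler w))) 0 - 4 * sphInt (euler w) 0
    - ∫ x in Metric.ball (0 : R4) (exp 0), lap (lap w) x, fun t => ?_⟩
  have := is_const_of_deriv_eq_zero (fun t => (hd t).differentiableAt) (fun t => (hd t).deriv) t 0
  linarith

omit hw in
theorem tendsto_integral_ball_atTop {f : R4 → ℝ} (hf : Integrable f) :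
    Tendsto (fun t => ∫ x in Metric.ball (0 : R4) (exp t), f x) atTop (𝓝 (∫ x, f x)) := by
  have hmono : Monotone fun t : ℝ => Metric.ball (0 : R4) (exp t) := fun a b hab =>
    Metric.ball_subset_ball (exp_le_exp.2 hab)
  have h := tendsto_setIntegral_of_monotone (μ := volume) (f := f)
    (fun t : ℝ => Metric.isOpen_ball.measurableSet) hmono hf.integrableOn
  have hU : ⋃ t : ℝ, Metric.ball (0 : R4) (exp t) = univ := by
    refine eq_univ_of_forall fun x => mem_iUnion.2 ⟨‖x‖, ?_⟩
    rw [mem_ball_zero_iff]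
    linarith [add_one_le_exp ‖x‖]
  rwa [hU, setIntegral_univ] at h

omit hw in
theorem tendsto_integral_ball_atBot {f : R4 → ℝ} (hf : ∀ R, IntegrableOn f (Metric.ball 0 R)) :
    Tendsto (fun t => ∫ x in Metric.ball (0 : R4) (exp t), f x) atBot (𝓝 0) := by
  have hanti : Antitone fun t : ℝ => Metric.ball (0 : R4) (exp (-t)) := fun a b hab =>
    Metric.ball_subset_ball (exp_le_exp.2 (by linarith))
  have h := tendsto_setIntegral_of_antitone (μ := volume) (f := f)
    (fun t : ℝ => Metric.isOpen_ball.measurableSet) hanti ⟨0, hf _⟩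
  have hU : ⋂ t : ℝ, Metric.ball (0 : R4) (exp (-t)) = {0} := by
    refine Subset.antisymm (fun x hx => ?_) (fun x hx => mem_iInter.2 fun t => ?_)
    · by_contra hne
      have hx0 : 0 < ‖x‖ := norm_pos_iff.2 hne
      have := mem_iInter.1 hx (-log ‖x‖)
      rw [mem_ball_zero_iff, neg_neg, exp_log hx0] at this
      exact lt_irrefl _ this
    · rw [mem_singleton_iff.1 hx]
      exact Metric.mem_ball_self (exp_pos _)
  rw [hU, Measure.restrict_singleton, measure_singleton, zero_smul, integral_zero_measure] at h
  have := h.comp tendsto_neg_atBot_atTop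
  simpa [Function.comp_def] using this

/-- The integrated form of `Δw + |∇w|² ≤ 0` on a sphere. -/
theorem sphInt_le_of_scalarCurvature_nonneg {t : ℝ}
    (hR : ∀ x : R4, ‖x‖ = exp t → 0 ≤ scalarCurvature (conformalMetric w) x) :
    sphInt (euler (euler w)) t + 2 * sphInt (euler w) t
      + exp (2 * t) * sphInt (gradSq w) t ≤ 0 := by
  have hU := isOpen_punctured
  rw [← sphInt_lap hw, ← mul_add]
  refine mul_nonpos_of_nonneg_of_nonpos (exp_pos _).le ?_
  rw [sphInt, sphInt, ← integral_add (integrable_slice (contDiffOn_lap hU hw).continuousOn t)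
    (integrable_slice (contDiffOn_gradSq hU hw).continuousOn t)]
  refine integral_nonpos fun θ => ?_
  have hx := smul_S3_ne_zero (exp_pos t).ne' θ
  have := hR (exp t • (θ : R4)) (by simp [norm_smul])
  rw [scalarCurvature_conformal hw hx] at this
  have he := exp_pos (-(2 * w (exp t • (θ : R4))))
  simp only [Pi.zero_apply]
  by_contra hcon
  rw [not_le] at hcon
  nlinarith

/-- Nonnegativity of the variance of the radial derivative, together with its pointwise bound by
|x|²|∇w|². -/
theorem sq_sphInt_euler_le (t : ℝ) :
    sphInt (euler w) t ^ 2 ≤ areaS3 * (exp (2 * t) * sphInt (gradSq w) t) := by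
  have hU := isOpen_punctured
  have h1 := contDiffOn_euler hU hw
  have i1 := integrable_slice h1.continuousOn t
  have i2 : Integrable (fun θ : S3 => euler w (exp t • (θ : R4)) ^ 2) sig :=
    integrable_slice (h1.continuousOn.pow 2) t
  have i3 := integrable_slice (contDiffOn_gradSq hU hw).continuousOn t
  have hle : ∫ θ : S3, euler w (exp t • (θ : R4)) ^ 2 ∂sig ≤
      exp (2 * t) * sphInt (gradSq w) t := by
    rw [sphInt, ← integral_const_mul]
    refine integral_mono i2 (i3.const_mul _) fun θ => ?_
    have hnr : exp (2 * t) = ‖exp t • (θ : R4)‖ ^ 2 := by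
      rw [norm_smul, norm_S3, Real.norm_eq_abs, abs_of_pos (exp_pos t), mul_one, ← exp_nat_mul]
      rfl
    have hg := norm_sq_mul_gradSq (f := w) (x := exp t • (θ : R4))
    simp only [hnr, hg]
    nlinarith [sq_nonneg (lieD (quatMul (eb 1)) w (exp t • (θ : R4))),
      sq_nonneg (lieD (quatMul (eb 2)) w (exp t • (θ : R4))),
      sq_nonneg (lieD (quatMul (eb 3)) w (exp t • (θ : R4)))]
  refine le_trans ?_ (mul_le_mul_of_nonneg_left hle areaS3_pos.le)
  set S := sphInt (euler w) t with hS
  have h0 : 0 ≤ ∫ θ : S3, (euler w (exp t • (θ : R4)) - S / areaS3) ^ 2 ∂sig :=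
    integral_nonneg fun θ => sq_nonneg _
  have he : ∀ θ : S3, (euler w (exp t • (θ : R4)) - S / areaS3) ^ 2 =
      euler w (exp t • (θ : R4)) ^ 2 - 2 * (S / areaS3) * euler w (exp t • (θ : R4))
        + (S / areaS3) ^ 2 := fun θ => by ring
  simp only [he] at h0
  have i4 : Integrable (fun θ : S3 => euler w (exp t • (θ : R4)) ^ 2
      - 2 * (S / areaS3) * euler w (exp t • (θ : R4))) sig := i2.sub (i1.const_mul _)
  rw [integral_add i4 (integrable_const _),
    integral_sub i2 (i1.const_mul _), integral_const_mul, integral_sphere_const] at h0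
  change 0 ≤ _ - 2 * (S / areaS3) * S + _ at h0
  have hA := areaS3_pos
  have h5 : areaS3 * (S / areaS3) ^ 2 = S / areaS3 * S := by field_simp
  have h6 : areaS3 * (S / areaS3 * S) = S ^ 2 := by field_simp
  have h7 : S / areaS3 * S ≤ ∫ θ : S3, euler w (exp t • (θ : R4)) ^ 2 ∂sig := by linarith
  have := mul_le_mul_of_nonneg_left h7 hA.le
  linarith

/-- The averaged curvature inequality and the variance bound give m'' + 2m' + m'² ≤ 0. Completing
the square makes 1 + m' the natural unknown. -/
theorem riccati_of_scalarCurvature_nonneg {t : ℝ}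
    (hR : ∀ x : R4, ‖x‖ = exp t → 0 ≤ scalarCurvature (conformalMetric w) x) :
    sphInt (euler (euler w)) t / areaS3 ≤ 1 - (sphInt (euler w) t / areaS3 + 1) ^ 2 := by
  have h1 := sphInt_le_of_scalarCurvature_nonneg hw hR
  have h2 := sq_sphInt_euler_le hw t
  have hA := areaS3_pos
  have h3 : (sphInt (euler w) t / areaS3) ^ 2 ≤ exp (2 * t) * sphInt (gradSq w) t / areaS3 := by
    rw [div_pow, div_le_div_iff₀ (by positivity) hA]
    nlinarith
  have h4 : sphInt (euler (euler w)) t / areaS3 + 2 * (sphInt (euler w) t / areaS3)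
      + exp (2 * t) * sphInt (gradSq w) t / areaS3 ≤ 0 := by
    have := div_nonpos_of_nonpos_of_nonneg h1 hA.le
    rwa [add_div, add_div, mul_div_assoc] at this
  nlinarith

end

/-! ### Limits of the logarithmic slope at both ends. -/

section

variable {w : R4 → ℝ} (hw : ContDiffOn ℝ ∞ w {0}ᶜ)
  (hQ : Integrable (fun x => |QCurvature (conformalMetric w) x| * exp (4 * w x)))
include hw

theorem QCurvature_ae_eq :
    (fun x => QCurvature (conformalMetric w) x * exp (4 * w x)) =ᵐ[volume]
      fun x => 1 / 2 * lap (lap w) x := by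
  have : ({0}ᶜ : Set R4) ∈ ae (volume : Measure R4) :=
    compl_mem_ae_iff.2 (measure_singleton 0)
  filter_upwards [this] with x hx
  exact QCurvature_conformal hw hx

theorem totalQ_eq : totalQ w = 1 / 2 * ∫ x, lap (lap w) x := by
  rw [totalQ, integral_congr_ae (QCurvature_ae_eq hw), integral_const_mul]

include hQ in
theorem integrable_lap_lap : Integrable (lap (lap w)) := by
  have hm : AEStronglyMeasurable (lap (lap w)) (volume : Measure R4) := by
    have h1 := (contDiffOn_lap isOpen_punctured
      (contDiffOn_lap isOpen_punctured hw)).continuousOn.aestronglyMeasurable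
      (μ := (volume : Measure R4)) isOpen_punctured.measurableSet
    rwa [restrict_compl_singleton] at h1
  refine (hQ.const_mul 2).mono' hm ?_
  filter_upwards [QCurvature_ae_eq hw] with x hx
  have : lap (lap w) x = 2 * (QCurvature (conformalMetric w) x * exp (4 * w x)) := by
    rw [hx]; ring
  rw [this, Real.norm_eq_abs, abs_mul, abs_mul, abs_two, abs_of_pos (exp_pos _)]

include hQ in
/-- The limits of the logarithmic derivative of the spherical mean of the conformal factor, and
the uniform bound of its mean oscillation on spheres. -/
theorem exists_limits_sphInt_euler (r₁ r₂ : ℝ) (hr₁ : 0 < r₁) (hr₁₂ : r₁ ≤ r₂)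
    (hRinfty : ∀ x : R4, r₂ ≤ ‖x‖ → 0 ≤ scalarCurvature (conformalMetric w) x)
    (hRorigin : ∀ x : R4, x ≠ 0 → ‖x‖ < r₁ → 0 ≤ scalarCurvature (conformalMetric w) x) :
    ∃ β ν : ℝ, Tendsto (fun t => sphInt (euler w) t / areaS3 + 1) atBot (𝓝 β) ∧
      Tendsto (fun t => sphInt (euler w) t / areaS3 + 1) atTop (𝓝 ν) ∧
      ν - β = -(1 / (4 * π ^ 2) * totalQ w) ∧
      ∃ C, ∀ t, ∫ θ : S3, |w (exp t • (θ : R4)) - sphInt w t / areaS3| ∂sig ≤ C := by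
  have hU := isOpen_punctured
  have h1 := contDiffOn_euler hU hw
  have h2 := contDiffOn_euler hU h1
  have d1 := hasDerivAt_sphInt h1
  have d2 := hasDerivAt_sphInt h2
  have hA := areaS3_pos
  have hB := integrable_lap_lap hw hQ
  obtain ⟨c, hc⟩ := exists_const_sphInt_ode hw hB
  have hRt : ∀ t, log r₂ ≤ t → ∀ x : R4, ‖x‖ = exp t →
      0 ≤ scalarCurvature (conformalMetric w) x := fun t ht x hx => by
    refine hRinfty x ?_
    rw [hx, ← exp_log (hr₁.trans_le hr₁₂)]
    exact exp_le_exp.2 ht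
  -- The summand 1 makes e^{-t} strictly smaller than r₁, as the hypothesis near the origin
  -- requires.
  have hRb : ∀ t, 1 - log r₁ ≤ t → ∀ x : R4, ‖x‖ = exp (-t) →
      0 ≤ scalarCurvature (conformalMetric w) x := fun t ht x hx => by
    refine hRorigin x (norm_ne_zero_iff.1 (by rw [hx]; exact (exp_pos _).ne')) ?_
    rw [hx, ← exp_log hr₁]
    exact exp_lt_exp.2 (by linarith)
  have dneg : ∀ {f f' : ℝ → ℝ}, (∀ t, HasDerivAt f (f' t) t) →
      ∀ t, HasDerivAt (fun t => f (-t)) (-f' (-t)) t := fun hf t => by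
    have h := (hf (-t)).scomp t (hasDerivAt_neg t)
    rw [neg_one_smul] at h
    exact h
  have bound : ∀ {C T : ℝ} {g : ℝ → ℝ} (k : ℝ), (∀ t, T ≤ t → |g t / areaS3 + 1| ≤ C) →
      ∀ t, T ≤ t → |g t + k / 4| ≤ areaS3 * (C + 1) + |k / 4| := fun {C T g} k hC t ht => by
    refine (abs_add_le _ _).trans (add_le_add ?_ le_rfl)
    have e : g t = areaS3 * ((g t / areaS3 + 1) - 1) := by field_simp; ring
    rw [e, abs_mul, abs_of_pos hA]
    refine mul_le_mul_of_nonneg_left ((abs_sub _ _).trans ?_) hA.le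
    rw [abs_one]
    linarith [hC t ht]
  -- behaviour at infinity
  obtain ⟨C₁, hC₁⟩ := bounded_of_riccati (q := fun t => sphInt (euler w) t / areaS3 + 1)
    (fun t => ((d1 t).div_const areaS3).add_const 1)
    (fun t ht => riccati_of_scalarCurvature_nonneg hw (hRt t ht))
  -- The constant shift is a quarter of the limit of the forcing term, so that what is left of the
  -- forcing tends to 0.
  have htop := tendsto_zero_of_ode (D := fun t => sphInt (euler w) t
      + (c + ∫ x, lap (lap w) x) / 4)
    (ε := fun t => (∫ x in Metric.ball (0 : R4) (exp t), lap (lap w) x) - ∫ x, lap (lap w) x)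
    (fun t => (d1 t).add_const _) d2 (fun t => by rw [hc]; ring)
    (by simpa using (tendsto_integral_ball_atTop hB).sub_const (∫ x, lap (lap w) x))
    (bound _ hC₁)
  -- behaviour at the origin
  obtain ⟨C₂, hC₂⟩ := bounded_of_riccati (q := fun t => -(sphInt (euler w) (-t) / areaS3 + 1))
    -- Reversing time and the sign of q preserves the Riccati inequality, so the origin is treated
    -- like infinity.
    (q' := fun t => sphInt (euler (euler w)) (-t) / areaS3)
    (fun t => by
      have := (((dneg d1 t).div_const areaS3).add_const 1).neg
      rwa [neg_div, neg_neg] at this)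
    (fun t ht => by
      have := riccati_of_scalarCurvature_nonneg hw (hRb t ht)
      rwa [neg_sq])
  have hbot := tendsto_zero_of_ode (D := fun t => sphInt (euler w) (-t) + c / 4)
    (ε := fun t => ∫ x in Metric.ball (0 : R4) (exp (-t)), lap (lap w) x)
    (fun t => (dneg d1 t).add_const _)
    (fun t => by
      have := (dneg d2 t).neg
      rwa [neg_neg] at this)
    (fun t => by rw [hc]; ring)
    ((tendsto_integral_ball_atBot fun R => hB.integrableOn).comp tendsto_neg_atTop_atBot)
    (bound (g := fun t => sphInt (euler w) (-t)) c fun t ht => by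
      have := hC₂ t ht; rwa [abs_neg] at this)
  have lt : Tendsto (sphInt (euler w)) atTop (𝓝 (-((c + ∫ x, lap (lap w) x) / 4))) := by
    simpa using htop.1.sub_const ((c + ∫ x, lap (lap w) x) / 4)
  have lb : Tendsto (sphInt (euler w)) atBot (𝓝 (-(c / 4))) := by
    have := (hbot.1.sub_const (c / 4)).comp tendsto_neg_atBot_atTop
    simpa [Function.comp_def] using this
  refine ⟨_, _, (lb.div_const areaS3).add_const 1, (lt.div_const areaS3).add_const 1, ?_, ?_⟩
  · rw [totalQ_eq hw]
    field_simp
    ring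
  -- The curvature inequality bounds the energy by -(m'' + 2m') up to the area factor. This
  -- converges at both ends, and the range in between is compact.
  have hG : ∃ C, ∀ t, exp (2 * t) * sphInt (gradSq w) t ≤ C := by
    have hcG : Continuous fun t => exp (2 * t) * sphInt (gradSq w) t :=
      (by fun_prop : Continuous fun t : ℝ => exp (2 * t)).mul
        (continuous_sphInt (contDiffOn_gradSq hU hw).continuousOn)
    have b1 : ∃ T C, ∀ t, T ≤ t → exp (2 * t) * sphInt (gradSq w) t ≤ C := by
      obtain ⟨a, hl⟩ : ∃ a, Tendsto _ _ (𝓝 a) := ⟨_, (htop.2.add (lt.const_mul 2)).neg⟩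
      obtain ⟨T, hT⟩ := eventually_atTop.1 (hl.eventually_lt_const (lt_add_one a))
      refine ⟨max T (log r₂), a + 1, fun t ht => ?_⟩
      have h3 := sphInt_le_of_scalarCurvature_nonneg hw (hRt t ((le_max_right _ _).trans ht))
      exact le_trans (by linarith) (hT t ((le_max_left _ _).trans ht)).le
    have b2 : ∃ T C, ∀ t, t ≤ T → exp (2 * t) * sphInt (gradSq w) t ≤ C := by
      have hl0 : Tendsto (sphInt (euler (euler w))) atBot (𝓝 0) := by
        have := hbot.2.neg.comp tendsto_neg_atBot_atTop
        simpa [Function.comp_def] using this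
      obtain ⟨a, hl⟩ : ∃ a, Tendsto _ _ (𝓝 a) := ⟨_, (hl0.add (lb.const_mul 2)).neg⟩
      obtain ⟨T, hT⟩ := eventually_atBot.1 (hl.eventually_lt_const (lt_add_one a))
      refine ⟨min T (-(1 - log r₁)), a + 1, fun t ht => ?_⟩
      have hR := hRb (-t) (by linarith [min_le_right T (-(1 - log r₁))])
      rw [neg_neg] at hR
      have h3 := sphInt_le_of_scalarCurvature_nonneg hw hR
      exact le_trans (by linarith) (hT t (ht.trans (min_le_left _ _))).le
    obtain ⟨T₁, D₁, hD₁⟩ := b1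
    obtain ⟨T₂, D₂, hD₂⟩ := b2
    obtain ⟨D₃, hD₃⟩ := (isCompact_Icc (a := T₂) (b := T₁)).exists_bound_of_continuousOn
      hcG.continuousOn
    refine ⟨max D₁ (max D₂ D₃), fun t => ?_⟩
    rcases le_total T₁ t with h | h
    · exact (hD₁ t h).trans (le_max_left _ _)
    rcases le_total t T₂ with h' | h'
    · exact (hD₂ t h').trans ((le_max_left _ _).trans (le_max_right _ _))
    · exact ((le_abs_self _).trans (hD₃ t ⟨h', h⟩)).trans
        ((le_max_right _ _).trans (le_max_right _ _))
  obtain ⟨C, hC⟩ := hG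
  refine ⟨π * ((areaS3 + C) / 2), fun t => (integral_abs_sub_mean_le hw t).trans
    (mul_le_mul_of_nonneg_left ?_ pi_pos.le)⟩
  have iG := integrable_slice (contDiffOn_gradSq hU hw).continuousOn t
  have iN := integrable_slice (f := fun x => ‖x‖ * √(gradSq w x)) (continuous_norm.continuousOn.mul
    (contDiffOn_gradSq isOpen_punctured hw).continuousOn.sqrt) t
  -- |x||∇w| ≤ (1 + |x|²|∇w|²)/2 reduces the right side of the Poincaré inequality to the energy.
  calc sphInt (fun x => ‖x‖ * √(gradSq w x)) t
      ≤ ∫ θ : S3, (1 / 2 + exp (2 * t) / 2 * gradSq w (exp t • (θ : R4))) ∂sig := by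
        refine integral_mono iN ((integrable_const _).add (iG.const_mul _)) fun θ => ?_
        have hg : 0 ≤ gradSq w (exp t • (θ : R4)) := Finset.sum_nonneg fun i _ => sq_nonneg _
        have hs := sq_sqrt hg
        have hn : ‖exp t • (θ : R4)‖ = exp t := by simp [norm_smul]
        have he : exp (2 * t) = exp t ^ 2 := by rw [← exp_nat_mul]; rfl
        simp only [hn, he]
        nlinarith [sq_nonneg (exp t * √(gradSq w (exp t • (θ : R4))) - 1)]
    _ = areaS3 * (1 / 2) + exp (2 * t) / 2 * sphInt (gradSq w) t := by
        rw [integral_add (integrable_const _) (iG.const_mul _), integral_sphere_const,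
          integral_const_mul]
        rfl
    _ ≤ _ := by linarith [hC t]

end

/-! ### Integration by parts -/

section IntegrationByParts

variable {U : Set R4} {a b : R4 → ℝ}

theorem tsupport_pd_subset (i : Fin 4) (a : R4 → ℝ) : tsupport (pd i a) ⊆ tsupport a :=
  tsupport_fderiv_apply_subset ℝ _

theorem tsupport_lap_subset (a : R4 → ℝ) : tsupport (lap a) ⊆ tsupport a := by
  refine closure_minimal (fun x hx => ?_) isClosed_closure
  obtain ⟨i, -, hi⟩ := Finset.exists_ne_zero_of_sum_ne_zero (Function.mem_support.1 hx)
  exact tsupport_pd_subset i a (tsupport_pd_subset i _ (subset_tsupport _ hi))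

theorem contDiff_pd (ha : ContDiff ℝ ∞ a) (i : Fin 4) : ContDiff ℝ ∞ (pd i a) :=
  contDiffOn_univ.1 (contDiffOn_pd isOpen_univ ha.contDiffOn i)

theorem contDiff_lap (ha : ContDiff ℝ ∞ a) : ContDiff ℝ ∞ (lap a) :=
  contDiffOn_univ.1 (contDiffOn_lap isOpen_univ ha.contDiffOn)

theorem hasCompactSupport_pd (ha : HasCompactSupport a) (i : Fin 4) : HasCompactSupport (pd i a) :=
  ha.mono' ((subset_tsupport _).trans (tsupport_pd_subset i a))

theorem hasCompactSupport_lap (ha : HasCompactSupport a) : HasCompactSupport (lap a) :=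
  ha.mono' ((subset_tsupport _).trans (tsupport_lap_subset a))

variable (hU : IsOpen U)
include hU

theorem continuous_mul_of_tsupport (ha : Continuous a) (haU : tsupport a ⊆ U)
    (hb : ContinuousOn b U) : Continuous fun x => a x * b x :=
  continuous_of_tsupport fun _ hx => ha.continuousAt.mul
    (hb.continuousAt (hU.mem_nhds (haU (tsupport_mul_subset_left hx))))

theorem integrable_mul_of_tsupport (ha : Continuous a) (hac : HasCompactSupport a)
    (haU : tsupport a ⊆ U) (hb : ContinuousOn b U) : Integrable fun x => a x * b x :=
  (continuous_mul_of_tsupport hU ha haU hb).integrable_of_hasCompactSupport hac.mul_right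

variable (ha : ContDiff ℝ ∞ a) (hac : HasCompactSupport a) (haU : tsupport a ⊆ U)
  (hb : ContDiffOn ℝ ∞ b U)
include ha hac haU hb

/-- No boundary terms occur because `a` has compact support in U. Only `a` has to be smooth
everywhere; `b` may be singular off U. -/
theorem integral_mul_pd (i : Fin 4) : ∫ x, a x * pd i b x = -∫ x, pd i a x * b x := by
  have h1 := integrable_mul_of_tsupport hU (contDiff_pd ha i).continuous
    (hasCompactSupport_pd hac i) ((tsupport_pd_subset i a).trans haU) hb.continuousOn
  have h2 := integrable_mul_of_tsupport hU ha.continuous hac haU (contDiffOn_pd hU hb i).continuousOn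
  have h3 := integrable_mul_of_tsupport hU ha.continuous hac haU hb.continuousOn
  exact integral_mul_fderiv_eq_neg_fderiv_mul_of_integrable h1 h2 h3
    (fun x _ => (ha.differentiable (by simp)).differentiableAt)
    (fun x hx => differentiableAt_of_smooth hU hb (haU hx))

theorem integral_mul_lap : ∫ x, a x * lap b x = ∫ x, lap a x * b x := by
  have hp := fun i => contDiffOn_pd hU hb i
  have key : ∀ i, ∫ x, a x * pd i (pd i b) x = ∫ x, pd i (pd i a) x * b x := fun i => by
    rw [integral_mul_pd hU ha hac haU (hp i), integral_mul_pd hU (contDiff_pd ha i)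
      (hasCompactSupport_pd hac i) ((tsupport_pd_subset i a).trans haU) hb, neg_neg]
  simp only [lap, Finset.mul_sum, Finset.sum_mul]
  rw [integral_finsetSum, integral_finsetSum]
  · exact Finset.sum_congr rfl fun i _ => key i
  · exact fun i _ => integrable_mul_of_tsupport hU (contDiff_pd (contDiff_pd ha i) i).continuous
      (hasCompactSupport_pd (hasCompactSupport_pd hac i) i)
      ((tsupport_pd_subset i _).trans ((tsupport_pd_subset i a).trans haU)) hb.continuousOn
  · exact fun i _ => integrable_mul_of_tsupport hU ha.continuous hac haU
      (contDiffOn_pd hU (hp i) i).continuousOn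

theorem integral_mul_lap_lap : ∫ x, a x * lap (lap b) x = ∫ x, lap (lap a) x * b x := by
  rw [integral_mul_lap hU ha hac haU (contDiffOn_lap hU hb), integral_mul_lap hU (contDiff_lap ha)
    (hasCompactSupport_lap hac) ((tsupport_lap_subset a).trans haU) hb]

end IntegrationByParts

/-! ### The regularized biharmonic fundamental solution -/

/-- With s = |x|² the Laplacian in dimension n is 4sφ'' + 2nφ', and n = 4. Derivatives are needed
for s ≥ 0 only, which suits log (s + e). -/
theorem lap_radial {φ φ' φ'' : ℝ → ℝ} (h1 : ∀ s, 0 ≤ s → HasDerivAt φ (φ' s) s)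
    (h2 : ∀ s, 0 ≤ s → HasDerivAt φ' (φ'' s) s) (x : R4) :
    lap (fun y => φ (‖y‖ ^ 2)) x = 4 * ‖x‖ ^ 2 * φ'' (‖x‖ ^ 2) + 8 * φ' (‖x‖ ^ 2) := by
  have hn : ∀ (ψ ψ' : ℝ → ℝ), (∀ s, 0 ≤ s → HasDerivAt ψ (ψ' s) s) → ∀ y : R4,
      DifferentiableAt ℝ (fun y : R4 => ψ (‖y‖ ^ 2)) y ∧
      ∀ i, pd i (fun y => ψ (‖y‖ ^ 2)) y = 2 * y i * ψ' (‖y‖ ^ 2) := by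
    intro ψ ψ' hψ y
    have hd := (hψ _ (sq_nonneg ‖y‖)).comp_hasFDerivAt y (hasStrictFDerivAt_norm_sq y).hasFDerivAt
    refine ⟨hd.differentiableAt, fun i => ?_⟩
    have : pd i (fun y => ψ (‖y‖ ^ 2)) y = _ := congrArg (· (eb i)) hd.fderiv
    rw [this]
    simp [EuclideanSpace.inner_single_right]
    ring
  have e : ∀ i, pd i (fun y => φ (‖y‖ ^ 2)) = fun y => 2 * y i * φ' (‖y‖ ^ 2) := fun i => by
    funext y; exact (hn φ φ' h1 y).2 i
  have hc : ∀ i : Fin 4, DifferentiableAt ℝ (fun y : R4 => y i) x := fun i =>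
    (EuclideanSpace.proj i : R4 →L[ℝ] ℝ).differentiableAt
  have e2 : ∀ i, pd i (pd i fun y => φ (‖y‖ ^ 2)) x =
      2 * φ' (‖x‖ ^ 2) + 4 * (x i) ^ 2 * φ'' (‖x‖ ^ 2) := fun i => by
    rw [e, pd_mul ((hc i).const_mul 2) (hn φ' φ'' h2 x).1, (hn φ' φ'' h2 x).2,
      pd_const_mul _ (hc i), pd_coord]
    simp; ring
  simp only [lap, e2, Fin.sum_univ_four]
  linear_combination (-4 * φ'' (‖x‖ ^ 2)) * norm_sq_eq_sum x

/-- The regularization `½ log(|x|² + e)` of `log |x|`. -/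
def regLog (e : ℝ) (x : R4) : ℝ := 1 / 2 * log (‖x‖ ^ 2 + e)

theorem contDiff_regLog {e : ℝ} (he : 0 < e) : ContDiff ℝ ∞ (regLog e) :=
  contDiff_const.mul (((contDiff_norm_sq ℝ).add contDiff_const).log fun x => by positivity)

/-- For e = ε² the right side is minus the rescaled profile ε^{-4} K(x/ε) with K(z) = 48/(|z|² +
1)⁴, that is, a multiple of an approximate identity. -/
theorem lap_lap_regLog {e : ℝ} (he : 0 < e) (x : R4) :
    lap (lap (regLog e)) x = -(48 * e ^ 2 / (‖x‖ ^ 2 + e) ^ 4) := by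
  have hb : ∀ s, HasDerivAt (fun s => s + e) 1 s := fun s => (hasDerivAt_id s).add_const e
  have hne : ∀ s, 0 ≤ s → s + e ≠ 0 := fun s hs => by positivity
  have hinv : ∀ (c : ℝ) (n : ℕ) (s : ℝ), 0 ≤ s →
      HasDerivAt (fun s => c / (s + e) ^ (n + 1)) (-(c * (n + 1)) / (s + e) ^ (n + 2)) s := by
    intro c n s hs
    have h := ((hb s).fun_pow (n + 1)).fun_inv (pow_ne_zero _ (hne s hs))
    refine (h.const_mul c).congr_deriv ?_
    have := hne s hs
    simp only [Nat.add_sub_cancel]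
    field_simp
    push_cast
    ring
  -- The exponents are written as 0 + 1 and 1 + 1 so that `hinv` differentiates both terms.
  have h1 : lap (regLog e) = fun y => (fun s => 2 / (s + e) ^ (0 + 1) + 2 * e / (s + e) ^ (1 + 1))
      (‖y‖ ^ 2) := by
    funext y
    have := lap_radial (φ := fun s => 1 / 2 * log (s + e)) (φ' := fun s => (1 / 2) / (s + e) ^ (0 + 1))
      (φ'' := fun s => -(1 / 2 * ((0 : ℕ) + 1)) / (s + e) ^ (0 + 2))
      (fun s hs => (((hb s).log (hne s hs)).const_mul (1 / 2)).congr_deriv (by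
        have := hne s hs; field_simp; ring)) (hinv _ 0) y
    unfold regLog
    rw [this]
    have := hne _ (sq_nonneg ‖y‖)
    field_simp
    ring
  rw [h1]
  have := lap_radial (fun s hs => (hinv 2 0 s hs).add (hinv (2 * e) 1 s hs))
    (fun s hs => (hinv (-(2 * ((0 : ℕ) + 1))) 1 s hs).add (hinv (-(2 * e * ((1 : ℕ) + 1))) 2 s hs)) x
  refine Eq.trans this ?_
  have := hne _ (sq_nonneg ‖x‖)
  simp only [Nat.reduceAdd]
  field_simp
  push_cast
  ring

theorem pd_comp_sub (i : Fin 4) (f : R4 → ℝ) (a : R4) :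
    pd i (fun y => f (y - a)) = fun y => pd i f (y - a) := by
  funext y
  simp [pd, fderiv_comp_sub]

theorem lap_comp_sub (f : R4 → ℝ) (a : R4) :
    lap (fun y => f (y - a)) = fun y => lap f (y - a) := by
  funext y
  simp [lap, pd_comp_sub]

/-- The normalizing constant of the biharmonic fundamental solution. -/
def bihConst : ℝ := ∫ z : R4, 48 / (‖z‖ ^ 2 + 1) ^ 4

theorem integrable_bihKernel : Integrable fun z : R4 => 48 / (‖z‖ ^ 2 + 1) ^ 4 := by
  have h := (integrable_rpow_neg_one_add_norm_sq (E := R4) (μ := volume) (r := 8)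
    (by norm_num)).const_mul 48
  refine h.congr (.of_forall fun z => ?_)
  have h0 : (0 : ℝ) < 1 + ‖z‖ ^ 2 := by positivity
  simp only
  rw [show (-8 / 2 : ℝ) = -((4 : ℕ) : ℝ) by norm_num, rpow_neg h0.le, rpow_natCast, add_comm]
  rfl

theorem bihConst_pos : 0 < bihConst := by
  refine (integral_pos_iff_support_of_nonneg (fun z => by positivity) integrable_bihKernel).2 ?_
  have : Function.support (fun z : R4 => 48 / (‖z‖ ^ 2 + 1) ^ 4) = univ :=
    eq_univ_of_forall fun z => by
      have : (48 : ℝ) / (‖z‖ ^ 2 + 1) ^ 4 ≠ 0 := by positivity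
      exact this
  rw [this]
  simp

/-! ### Approximate identities produced by the regularized logarithm. -/

section Representation

variable {f : R4 → ℝ} (hf : ContDiff ℝ ∞ f) (hfc : HasCompactSupport f)
include hf hfc

/-- Both Laplacians are moved onto the regularized logarithm. In the substitution y = x + εz the
Jacobian ε⁴ cancels the normalization of the rescaled profile. -/
theorem integral_regLog_mul_lap_lap {ε : ℝ} (hε : 0 < ε) (x : R4) :
    ∫ y, regLog (ε ^ 2) (y - x) * lap (lap f) y =
      -∫ z : R4, 48 / (‖z‖ ^ 2 + 1) ^ 4 * f (x + ε • z) := by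
  have hG : ContDiff ℝ ∞ fun y => regLog (ε ^ 2) (y - x) :=
    (contDiff_regLog (by positivity)).comp (contDiff_id.sub contDiff_const)
  have h1 := integral_mul_lap_lap isOpen_univ hf hfc (subset_univ _) hG.contDiffOn
  have h2 : ∀ y, regLog (ε ^ 2) (y - x) * lap (lap f) y =
      lap (lap f) y * regLog (ε ^ 2) (y - x) := fun y => mul_comm _ _
  simp only [h2]
  rw [← h1, lap_comp_sub, lap_comp_sub]
  simp only [lap_lap_regLog (show 0 < ε ^ 2 by positivity)]
  rw [← integral_add_left_eq_self _ x, ← integral_neg]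
  have h3 := Measure.integral_comp_smul (volume : Measure R4)
    (fun y => f (x + y) * -(48 * (ε ^ 2) ^ 2 / (‖x + y - x‖ ^ 2 + ε ^ 2) ^ 4)) ε
  rw [finrank_R4, abs_of_pos (by positivity)] at h3
  have h4 : ∫ y, f (x + y) * -(48 * (ε ^ 2) ^ 2 / (‖x + y - x‖ ^ 2 + ε ^ 2) ^ 4) =
      ε ^ 4 * ∫ z, f (x + ε • z) * -(48 * (ε ^ 2) ^ 2 / (‖x + ε • z - x‖ ^ 2 + ε ^ 2) ^ 4) := by
    rw [h3, smul_eq_mul, ← mul_assoc, mul_inv_cancel₀ (by positivity), one_mul]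
  rw [h4, ← integral_const_mul]
  refine integral_congr_ae (.of_forall fun z => ?_)
  have h5 : (0 : ℝ) < ‖z‖ ^ 2 + 1 := by positivity
  have h6 : (0 : ℝ) < (ε * ‖z‖) ^ 2 + ε ^ 2 := by positivity
  simp only [add_sub_cancel_left, norm_smul, Real.norm_eq_abs, abs_of_pos hε]
  have h7 : (ε * ‖z‖) ^ 2 + ε ^ 2 = ε ^ 2 * (‖z‖ ^ 2 + 1) := by ring
  rw [h7]
  field_simp

theorem tendsto_integral_bihKernel {ε : ℕ → ℝ} (hε : Tendsto ε atTop (𝓝 0)) (x : R4) :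
    Tendsto (fun n => ∫ z : R4, 48 / (‖z‖ ^ 2 + 1) ^ 4 * f (x + ε n • z)) atTop
      (𝓝 (bihConst * f x)) := by
  obtain ⟨C, hC⟩ := hfc.exists_bound_of_continuous hf.continuous
  rw [bihConst, ← integral_mul_const]
  refine tendsto_integral_of_dominated_convergence (fun z : R4 => 48 / (‖z‖ ^ 2 + 1) ^ 4 * C)
    (fun n => ?_) (integrable_bihKernel.mul_const C) (fun n => .of_forall fun z => ?_)
    (.of_forall fun z => ?_)
  · exact integrable_bihKernel.aestronglyMeasurable.mul
      (hf.continuous.comp (by fun_prop)).aestronglyMeasurable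
  · rw [norm_mul, Real.norm_of_nonneg (by positivity)]
    exact mul_le_mul_of_nonneg_left (hC _) (by positivity)
  · have h : Tendsto (fun n => x + ε n • z) atTop (𝓝 (x + (0 : ℝ) • z)) :=
      tendsto_const_nhds.add (hε.smul_const z)
    rw [zero_smul, add_zero] at h
    exact ((hf.continuous.tendsto x).comp h).const_mul _

end Representation

/-- The singularity is weaker than the dimension. Negative p is allowed, so the growing kernel |y -
x| is covered as well. -/
theorem integrable_norm_rpow_mul {p : ℝ} (hp : p < 4) {h : R4 → ℝ} (hh : Continuous h)
    (hhc : HasCompactSupport h) (x : R4) : Integrable fun y => ‖y - x‖ ^ (-p) * |h y| := by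
  obtain ⟨C, hC⟩ := hhc.exists_bound_of_continuous hh
  obtain ⟨R, hR⟩ := hhc.isCompact.isBounded.subset_ball x
  have hball : IntegrableOn (fun y : R4 => ‖y - x‖ ^ (-p)) (Metric.ball x R) := by
    have h0 : IntegrableOn (fun y : R4 => ‖y‖ ^ (-p)) (Metric.ball 0 R) := by
      rcases le_or_gt R 0 with hR0 | hR0
      · simp [Metric.ball_eq_empty.2 hR0]
      refine (integrableOn_fun_norm_addHaar (f := fun s => s ^ (-p)) volume).2 ?_
      rw [finrank_R4]
      refine ((intervalIntegral.integrableOn_Ioo_rpow_iff (s := 3 - p) hR0).2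
        (by linarith)).congr_fun (fun s hs => ?_) measurableSet_Ioo
      rw [smul_eq_mul, ← rpow_natCast, ← rpow_add hs.1]
      norm_num
      ring_nf
    rw [← integrable_indicator_iff Metric.isOpen_ball.measurableSet] at h0 ⊢
    refine (h0.comp_sub_right x).congr (.of_forall fun y => ?_)
    by_cases hy : y ∈ Metric.ball x R
    · have : y - x ∈ Metric.ball (0 : R4) R := by simpa [dist_eq_norm] using hy
      simp [hy, this]
    · have : y - x ∉ Metric.ball (0 : R4) R := by simpa [dist_eq_norm] using hy
      simp [hy, this]
  have hsupp : Function.support (fun y => ‖y - x‖ ^ (-p) * |h y|) ⊆ Metric.ball x R := by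
    intro y hy
    refine hR (subset_tsupport _ fun h0 => hy ?_)
    simp [h0]
  rw [← integrableOn_iff_integrable_of_support_subset hsupp]
  refine (hball.mul_const C).mono' ?_ (.of_forall fun y => ?_)
  · have : Measurable fun y : R4 => ‖y - x‖ ^ (-p) := by fun_prop
    exact (this.aestronglyMeasurable.mul hh.abs.aestronglyMeasurable)
  · rw [norm_mul, Real.norm_of_nonneg (by positivity), Real.norm_eq_abs, abs_abs]
    exact mul_le_mul_of_nonneg_left (hC y) (by positivity)

/-! ### Representation of a function and of its radial derivative by their kernels. -/

section BiharmonicKernel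

/-- The majorant d + d⁻¹ serves for the logarithm, its regularizations and their gradients alike, so
a single domination argument covers all kernels. -/
theorem abs_log_le_add_inv {d : ℝ} (hd : 0 < d) : |log d| ≤ d + d⁻¹ := by
  have h1 := log_le_sub_one_of_pos hd
  have h2 := log_le_sub_one_of_pos (inv_pos.2 hd)
  have h3 := inv_pos.2 hd
  rw [log_inv] at h2
  rw [abs_le]
  constructor <;> linarith

theorem abs_regLog_le {ε : ℝ} (hε : 0 < ε) (hε1 : ε ≤ 1) {z : R4} (hz : z ≠ 0) :
    |regLog (ε ^ 2) z| ≤ ‖z‖ + ‖z‖⁻¹ := by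
  have hd : 0 < ‖z‖ := norm_pos_iff.2 hz
  have h3 := inv_pos.2 hd
  have hl : log (‖z‖ ^ 2) ≤ log (‖z‖ ^ 2 + ε ^ 2) := log_le_log (by positivity) (by nlinarith)
  have hu : log (‖z‖ ^ 2 + ε ^ 2) ≤ log ((‖z‖ + 1) ^ 2) :=
    log_le_log (by positivity) (by nlinarith)
  rw [log_pow] at hl hu
  push_cast at hl hu
  have h1 := log_le_sub_one_of_pos (show 0 < ‖z‖ + 1 by positivity)
  have h2 := log_le_sub_one_of_pos (inv_pos.2 hd)
  rw [log_inv] at h2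
  unfold regLog
  rw [abs_le]
  constructor <;> linarith

theorem pd_regLog {e : ℝ} (he : 0 < e) (i : Fin 4) (z : R4) :
    pd i (regLog e) z = z i / (‖z‖ ^ 2 + e) := by
  have hne : ‖z‖ ^ 2 + e ≠ 0 := by positivity
  have hd := ((((hasStrictFDerivAt_norm_sq z).hasFDerivAt.add_const e).log hne).const_mul (1 / 2))
  have : pd i (regLog e) z = _ := congrArg (· (eb i)) hd.fderiv
  rw [this]
  simp [EuclideanSpace.inner_single_right]
  field_simp

theorem integrable_norm_add_inv_mul {h : R4 → ℝ} (hh : Continuous h) (hhc : HasCompactSupport h)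
    (x : R4) : Integrable fun y => (‖y - x‖ + ‖y - x‖⁻¹) * |h y| := by
  have h1 := integrable_norm_rpow_mul (show (-1 : ℝ) < 4 by norm_num) hh hhc x
  have h2 := integrable_norm_rpow_mul (show (1 : ℝ) < 4 by norm_num) hh hhc x
  refine (h1.add h2).congr (.of_forall fun y => ?_)
  simp [rpow_neg_one, add_mul]

theorem integrable_mul_of_le_norm_add_inv {h : R4 → ℝ} (hh : Continuous h)
    (hhc : HasCompactSupport h) {K : R4 → ℝ} (hK : Measurable K) {x : R4}
    (hle : ∀ y ≠ x, |K y| ≤ ‖y - x‖ + ‖y - x‖⁻¹) : Integrable fun y => K y * h y := by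
  refine (integrable_norm_add_inv_mul hh hhc x).mono'
    (hK.aestronglyMeasurable.mul hh.aestronglyMeasurable) ?_
  filter_upwards [Measure.ae_ne volume x] with y hy
  rw [norm_mul]
  exact mul_le_mul_of_nonneg_right (hle y hy) (abs_nonneg _)

theorem tendsto_integral_kernel_mul {h : R4 → ℝ} (hh : Continuous h) (hhc : HasCompactSupport h)
    {K : ℕ → R4 → ℝ} {k : R4 → ℝ} {x : R4} (hK : ∀ n, Continuous (K n))
    (hle : ∀ n, ∀ y ≠ x, |K n y| ≤ ‖y - x‖ + ‖y - x‖⁻¹)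
    (hlim : ∀ y ≠ x, Tendsto (fun n => K n y) atTop (𝓝 (k y))) :
    Tendsto (fun n => ∫ y, K n y * h y) atTop (𝓝 (∫ y, k y * h y)) := by
  refine tendsto_integral_of_dominated_convergence _
    (fun n => ((hK n).mul hh).aestronglyMeasurable) (integrable_norm_add_inv_mul hh hhc x)
    (fun n => ?_) ?_
  · filter_upwards [Measure.ae_ne volume x] with y hy
    rw [norm_mul]
    exact mul_le_mul_of_nonneg_right (hle n y hy) (abs_nonneg _)
  · filter_upwards [Measure.ae_ne volume x] with y hy
    exact (hlim y hy).mul_const _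

theorem tendsto_one_div_succ_sq : Tendsto (fun n : ℕ => (1 / ((n : ℝ) + 1)) ^ 2) atTop (𝓝 0) := by
  simpa using (tendsto_one_div_add_atTop_nhds_zero_nat (𝕜 := ℝ)).pow 2

variable {f : R4 → ℝ} (hf : ContDiff ℝ ∞ f) (hfc : HasCompactSupport f)
include hf hfc

/-- `log |x|` is, up to the factor `-bihConst`, a fundamental solution of the bi-Laplacian. -/
theorem bihConst_mul_eq (x : R4) :
    bihConst * f x = -∫ y, log ‖y - x‖ * lap (lap f) y := by
  have hε : ∀ n : ℕ, (0 : ℝ) < 1 / ((n : ℝ) + 1) := fun n => by positivity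
  have hε1 : ∀ n : ℕ, 1 / ((n : ℝ) + 1) ≤ 1 := fun n =>
    (div_le_one (by positivity)).2 (by linarith [(Nat.cast_nonneg n : (0 : ℝ) ≤ n)])
  have h1 := tendsto_integral_bihKernel hf hfc tendsto_one_div_add_atTop_nhds_zero_nat x
  have hh := contDiff_lap (contDiff_lap hf)
  have h2 := tendsto_integral_kernel_mul (x := x) (k := fun y => log ‖y - x‖)
    (K := fun n y => regLog ((1 / ((n : ℝ) + 1)) ^ 2) (y - x)) hh.continuous
    (hasCompactSupport_lap (hasCompactSupport_lap hfc))
    (fun n => (contDiff_regLog (by positivity)).continuous.comp (continuous_sub_right x))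
    (fun n y hy => abs_regLog_le (hε n) (hε1 n) (sub_ne_zero.2 hy)) (fun y hy => ?_)
  · simp only [integral_regLog_mul_lap_lap hf hfc (hε _)] at h2
    have := tendsto_nhds_unique h1.neg h2
    linarith
  · have hd : 0 < ‖y - x‖ := norm_pos_iff.2 (sub_ne_zero.2 hy)
    have h3 := ((tendsto_const_nhds (x := ‖y - x‖ ^ 2)).add tendsto_one_div_succ_sq).log
      (by positivity)
    have h4 := h3.const_mul (1 / 2)
    rw [add_zero, log_pow] at h4
    refine h4.congr_dist ?_ |>.trans (le_of_eq ?_)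
    · simp [regLog]
    · congr 1; push_cast; ring

/-- The approximate identity is applied to ∂ᵢf. The derivative is moved onto the kernel while it is
still smooth, and only then does ε tend to 0. -/
theorem bihConst_mul_pd_eq (i : Fin 4) (x : R4) :
    bihConst * pd i f x = ∫ y, (y - x) i / ‖y - x‖ ^ 2 * lap (lap f) y := by
  have hε : ∀ n : ℕ, (0 : ℝ) < 1 / ((n : ℝ) + 1) := fun n => by positivity
  have hp := contDiff_pd hf i
  have h1 := tendsto_integral_bihKernel hp (hasCompactSupport_pd hfc i)
    tendsto_one_div_add_atTop_nhds_zero_nat x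
  have hh := contDiff_lap (contDiff_lap hf)
  have hhc := hasCompactSupport_lap (hasCompactSupport_lap hfc)
  have hcomm : ∀ g : R4 → ℝ, ContDiff ℝ ∞ g → lap (pd i g) = pd i (lap g) := fun g hg => by
    funext y
    exact (pd_lap isOpen_univ hg.contDiffOn (mem_univ y) i).symm
  have key : ∀ n : ℕ, ∫ y, regLog ((1 / ((n : ℝ) + 1)) ^ 2) (y - x) * lap (lap (pd i f)) y =
      -∫ y, (y - x) i / (‖y - x‖ ^ 2 + (1 / ((n : ℝ) + 1)) ^ 2) * lap (lap f) y := by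
    intro n
    have he : 0 < (1 / ((n : ℝ) + 1)) ^ 2 := pow_pos (hε n) 2
    have hG : ContDiff ℝ ∞ fun y => regLog ((1 / ((n : ℝ) + 1)) ^ 2) (y - x) :=
      (contDiff_regLog he).comp (contDiff_id.sub contDiff_const)
    rw [hcomm f hf, hcomm _ (contDiff_lap hf)]
    have h3 := integral_mul_pd isOpen_univ hh hhc (subset_univ _) hG.contDiffOn i
    rw [pd_comp_sub] at h3
    simp only [pd_regLog he] at h3
    have h4 : ∀ y, regLog ((1 / ((n : ℝ) + 1)) ^ 2) (y - x) * pd i (lap (lap f)) y =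
      pd i (lap (lap f)) y * regLog ((1 / ((n : ℝ) + 1)) ^ 2) (y - x) := fun y => mul_comm _ _
    have h5 : ∀ y, (y - x) i / (‖y - x‖ ^ 2 + (1 / ((n : ℝ) + 1)) ^ 2) * lap (lap f) y =
      lap (lap f) y * ((y - x) i / (‖y - x‖ ^ 2 + (1 / ((n : ℝ) + 1)) ^ 2)) :=
      fun y => mul_comm _ _
    simp only [h4, h5]
    linarith
  have h2 := tendsto_integral_kernel_mul (x := x) (k := fun y => (y - x) i / ‖y - x‖ ^ 2)
    (K := fun (n : ℕ) y => (y - x) i / (‖y - x‖ ^ 2 + (1 / ((n : ℝ) + 1)) ^ 2)) hh.continuous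
    hhc (fun n => ?_) (fun n y hy => ?_) (fun y hy => ?_)
  · have h6 : ∀ n : ℕ, ∫ y, (y - x) i / (‖y - x‖ ^ 2 + (1 / ((n : ℝ) + 1)) ^ 2) * lap (lap f) y =
      ∫ z : R4, 48 / (‖z‖ ^ 2 + 1) ^ 4 * pd i f (x + (1 / ((n : ℝ) + 1)) • z) := fun n => by
      have := key n
      rw [integral_regLog_mul_lap_lap hp (hasCompactSupport_pd hfc i) (hε n)] at this
      linarith
    simp only [h6] at h2
    exact tendsto_nhds_unique h1 h2
  · refine Continuous.div ?_ (by fun_prop) fun y => by positivity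
    exact (EuclideanSpace.proj i : R4 →L[ℝ] ℝ).continuous.comp (continuous_sub_right x)
  · have hd : 0 < ‖y - x‖ := norm_pos_iff.2 (sub_ne_zero.2 hy)
    have hi : |(y - x) i| ≤ ‖y - x‖ := by simpa using PiLp.norm_apply_le (y - x) i
    rw [abs_div, abs_of_pos (show 0 < ‖y - x‖ ^ 2 + (1 / ((n : ℝ) + 1)) ^ 2 by positivity)]
    calc |(y - x) i| / (‖y - x‖ ^ 2 + (1 / ((n : ℝ) + 1)) ^ 2) ≤ ‖y - x‖ / ‖y - x‖ ^ 2 := by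
          gcongr; simp; positivity
      _ = ‖y - x‖⁻¹ := by field_simp
      _ ≤ _ := by linarith
  · have hd : 0 < ‖y - x‖ := norm_pos_iff.2 (sub_ne_zero.2 hy)
    have h3 := (tendsto_const_nhds (x := (y - x) i)).div
      ((tendsto_const_nhds (x := ‖y - x‖ ^ 2)).add tendsto_one_div_succ_sq) (by positivity)
    rwa [add_zero] at h3

theorem integrable_pd_kernel_mul (i : Fin 4) (x : R4) :
    Integrable fun y => (y - x) i / ‖y - x‖ ^ 2 * lap (lap f) y := by
  refine integrable_mul_of_le_norm_add_inv (x := x)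
    (contDiff_lap (contDiff_lap hf)).continuous
    (hasCompactSupport_lap (hasCompactSupport_lap hfc)) ?_ fun y hy => ?_
  · have : Measurable fun y : R4 => (y - x) i :=
      ((EuclideanSpace.proj i : R4 →L[ℝ] ℝ).continuous.comp (continuous_sub_right x)).measurable
    exact this.div (by fun_prop)
  · have hd : 0 < ‖y - x‖ := norm_pos_iff.2 (sub_ne_zero.2 hy)
    have hi : |(y - x) i| ≤ ‖y - x‖ := by simpa using PiLp.norm_apply_le (y - x) i
    rw [abs_div, abs_of_pos (show 0 < ‖y - x‖ ^ 2 by positivity)]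
    calc |(y - x) i| / ‖y - x‖ ^ 2 ≤ ‖y - x‖ / ‖y - x‖ ^ 2 := by gcongr
      _ = ‖y - x‖⁻¹ := by field_simp
      _ ≤ _ := by linarith

theorem bihConst_mul_euler_eq (x : R4) :
    bihConst * euler f x = -∫ y, inner ℝ x (x - y) / ‖y - x‖ ^ 2 * lap (lap f) y := by
  rw [euler, fderiv_eq_sum_pd, Finset.mul_sum, ← integral_neg]
  have h1 : ∀ y, -(inner ℝ x (x - y) / ‖y - x‖ ^ 2 * lap (lap f) y) =
      ∑ i, x i * ((y - x) i / ‖y - x‖ ^ 2 * lap (lap f) y) := fun y => by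
    simp only [PiLp.inner_apply, RCLike.inner_apply, conj_trivial, PiLp.sub_apply]
    rw [Finset.sum_div, Finset.sum_mul, ← Finset.sum_neg_distrib]
    refine Finset.sum_congr rfl fun i _ => by ring
  simp only [h1]
  rw [integral_finsetSum _ fun i _ => (integrable_pd_kernel_mul hf hfc i x).const_mul _]
  refine Finset.sum_congr rfl fun i _ => ?_
  rw [integral_const_mul, ← bihConst_mul_pd_eq hf hfc]
  ring

end BiharmonicKernel

/-! ### Cutoff functions -/

/-- The closed annulus `1/2 ≤ |η| ≤ 3`. -/
def annulus : Set R4 := {η | 1 / 2 ≤ ‖η‖ ∧ ‖η‖ ≤ 3}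

theorem isClosed_annulus : IsClosed annulus :=
  (isClosed_le continuous_const continuous_norm).inter (isClosed_le continuous_norm continuous_const)

theorem isCompact_annulus : IsCompact annulus :=
  (isCompact_closedBall (0 : R4) 3).of_isClosed_subset isClosed_annulus fun η hη => by
    simpa using hη.2

theorem annulus_subset : annulus ⊆ {0}ᶜ := fun η hη h0 => by
  have h1 := hη.1
  rw [mem_singleton_iff.1 h0, norm_zero] at h1
  norm_num at h1

/-- A smooth function equal to `1` on the unit ball, supported in the ball of radius `2`. -/
def bump : R4 → ℝ := (⟨1, 2, by norm_num, by norm_num⟩ : ContDiffBump (0 : R4))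

theorem contDiff_bump : ContDiff ℝ ∞ bump := ContDiffBump.contDiff _

theorem bump_eq_one {y : R4} (hy : ‖y‖ ≤ 1) : bump y = 1 :=
  ContDiffBump.one_of_mem_closedBall _ (by simpa using hy)

theorem bump_eq_zero {y : R4} (hy : 2 ≤ ‖y‖) : bump y = 0 :=
  ContDiffBump.zero_of_le_dist _ (by simpa using hy)

theorem bump_nonneg (y : R4) : 0 ≤ bump y := ContDiffBump.nonneg _

theorem bump_le_one (y : R4) : bump y ≤ 1 := ContDiffBump.le_one _

/-- A smooth function equal to `1` for `1 ≤ |y| ≤ 2`, supported in `annulus`. -/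
def ringBump (y : R4) : ℝ :=
  (⟨2, 3, by norm_num, by norm_num⟩ : ContDiffBump (0 : R4)) y *
    (1 - (⟨1 / 2, 1, by norm_num, by norm_num⟩ : ContDiffBump (0 : R4)) y)

theorem contDiff_ringBump : ContDiff ℝ ∞ ringBump :=
  (ContDiffBump.contDiff _).mul (contDiff_const.sub (ContDiffBump.contDiff _))

theorem ringBump_eq_one {y : R4} (h1 : 1 ≤ ‖y‖) (h2 : ‖y‖ ≤ 2) : ringBump y = 1 := by
  rw [ringBump, ContDiffBump.one_of_mem_closedBall _ (by simpa using h2),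
    ContDiffBump.zero_of_le_dist _ (by simpa using h1), sub_zero, mul_one]

theorem ringBump_eq_zero {y : R4} (hy : y ∉ annulus) : ringBump y = 0 := by
  by_contra h
  refine hy ⟨?_, ?_⟩ <;> by_contra! h1
  · exact h (by rw [ringBump, ContDiffBump.one_of_mem_closedBall (x := y) ⟨1 / 2, 1, _, _⟩
      (by simpa using h1.le), sub_self, mul_zero])
  · exact h (by rw [ringBump, ContDiffBump.zero_of_le_dist (x := y) ⟨2, 3, _, _⟩
      (by simpa using h1.le), zero_mul])

theorem tsupport_subset_annulus {f : R4 → ℝ} (h : ∀ y ∉ annulus, f y = 0) :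
    tsupport f ⊆ annulus :=
  closure_minimal (fun y hy => by by_contra hya; exact hy (h y hya)) isClosed_annulus

/-- The commutator of the bi-Laplacian with `bump`, extended by `0` to the origin. -/
def bumpComm (v : R4 → ℝ) (y : R4) : ℝ :=
  ringBump y * (lap (lap fun z => bump z * v z) y - bump y * lap (lap v) y)

theorem bumpComm_eq_zero (v : R4 → ℝ) {y : R4} (hy : y ∉ annulus) : bumpComm v y = 0 := by
  rw [bumpComm, ringBump_eq_zero hy, zero_mul]

theorem hasCompactSupport_bumpComm (v : R4 → ℝ) : HasCompactSupport (bumpComm v) :=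
  .intro' isCompact_annulus isClosed_annulus fun _ hy => bumpComm_eq_zero v hy

theorem pd_const_mul_field (c : ℝ) (f : R4 → ℝ) (i : Fin 4) :
    pd i (fun y => c * f y) = fun y => c * pd i f y := by
  funext y
  have h := congrFun (fderiv_const_smul_field (𝕜 := ℝ) (f := f) c) y
  exact congrArg (· (eb i)) h

theorem lap_const_mul_field (c : ℝ) (f : R4 → ℝ) :
    lap (fun y => c * f y) = fun y => c * lap f y := by
  funext y
  simp only [lap, pd_const_mul_field, Finset.mul_sum]

theorem pd_comp_smul (f : R4 → ℝ) (c : ℝ) (i : Fin 4) :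
    pd i (fun y => f (c • y)) = fun y => c * pd i f (c • y) := by
  funext y
  simp [pd, fderiv_comp_smul]

theorem lap_comp_smul (f : R4 → ℝ) (c : ℝ) :
    lap (fun y => f (c • y)) = fun y => c ^ 2 * lap f (c • y) := by
  funext y
  simp only [lap, Finset.mul_sum]
  refine Finset.sum_congr rfl fun i _ => ?_
  rw [pd_comp_smul, pd_const_mul_field, pd_comp_smul]
  ring

theorem lap_lap_comp_smul (f : R4 → ℝ) (c : ℝ) :
    lap (lap fun y => f (c • y)) = fun y => c ^ 4 * lap (lap f) (c • y) := by
  rw [lap_comp_smul, lap_const_mul_field, lap_comp_smul]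
  funext y
  ring

theorem contDiffOn_comp_smul {v : R4 → ℝ} (hv : ContDiffOn ℝ ∞ v {0}ᶜ) {c : ℝ} (hc : c ≠ 0) :
    ContDiffOn ℝ ∞ (fun y => v (c • y)) {0}ᶜ :=
  hv.comp (contDiff_id.const_smul c).contDiffOn fun _ hy => smul_ne_zero hc hy

section Cutoff

variable {v : R4 → ℝ} (hv : ContDiffOn ℝ ∞ v {0}ᶜ)
include hv

theorem contDiffOn_bump_mul : ContDiffOn ℝ ∞ (fun y => bump y * v y) {0}ᶜ :=
  contDiff_bump.contDiffOn.mul hv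

/-- `ringBump` equals 1 wherever derivatives of `bump` live and vanishes near the origin, so it
removes the singularity of v without changing the commutator elsewhere. -/
theorem continuous_bumpComm : Continuous (bumpComm v) :=
  continuous_mul_of_tsupport isOpen_punctured contDiff_ringBump.continuous
    ((tsupport_subset_annulus fun _ => ringBump_eq_zero).trans annulus_subset)
    ((contDiffOn_lap isOpen_punctured (contDiffOn_lap isOpen_punctured
      (contDiffOn_bump_mul hv))).continuousOn.sub (contDiff_bump.continuous.continuousOn.mul
      (contDiffOn_lap isOpen_punctured (contDiffOn_lap isOpen_punctured hv)).continuousOn))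

end Cutoff

/-- Three regions: `bump` is locally 1 inside the unit ball, `ringBump` is 1 on 1 ≤ |y| ≤ 2, and
`bump` is locally 0 outside. No regularity of v is needed, so the origin is included. -/
theorem lap_lap_bump_mul (v : R4 → ℝ) (y : R4) :
    lap (lap fun z => bump z * v z) y = bumpComm v y + bump y * lap (lap v) y := by
  rcases lt_or_ge ‖y‖ 1 with h1 | h1
  · have hy1 : y ∈ Metric.ball (0 : R4) 1 := by simpa using h1
    have hE : EqOn (fun z => bump z * v z) v (Metric.ball 0 1) := fun z hz => by
      simp [bump_eq_one (show ‖z‖ ≤ 1 by simpa using (mem_ball_zero_iff.1 hz).le)]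
    have h2 := lap_eqOn Metric.isOpen_ball hy1 fun z hz => lap_eqOn Metric.isOpen_ball hz hE
    rw [bumpComm, h2, bump_eq_one h1.le]
    ring
  rcases le_or_gt ‖y‖ 2 with h2 | h2
  · rw [bumpComm, ringBump_eq_one h1 h2]
    ring
  · have hU : IsOpen {z : R4 | 2 < ‖z‖} := isOpen_lt continuous_const continuous_norm
    have hE : EqOn (fun z => bump z * v z) (fun z => 0 * v z) {z | 2 < ‖z‖} := fun z hz => by
      simp [bump_eq_zero (le_of_lt (show 2 < ‖z‖ from hz))]
    have h3 := lap_eqOn hU (show y ∈ {z : R4 | 2 < ‖z‖} from h2) fun z hz => lap_eqOn hU hz hE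
    rw [lap_const_mul_field, lap_const_mul_field] at h3
    rw [bumpComm, h3, bump_eq_zero h2.le]
    ring

theorem lap_lap_bump_smul_mul (v : R4 → ℝ) {c : ℝ} (hc : c ≠ 0) (y : R4) :
    lap (lap fun z => bump (c • z) * v z) y =
      c ^ 4 * bumpComm (fun z => v (c⁻¹ • z)) (c • y) + bump (c • y) * lap (lap v) y := by
  have h1 : (fun z => bump (c • z) * v z) =
      fun z => (fun z' => bump z' * v (c⁻¹ • z')) (c • z) := by
    funext z
    simp [smul_smul, inv_mul_cancel₀ hc]
  rw [h1, lap_lap_comp_smul (fun z' => bump z' * v (c⁻¹ • z'))]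
  simp only [lap_lap_bump_mul (fun z' => v (c⁻¹ • z')), lap_lap_comp_smul v]
  rw [smul_smul, inv_mul_cancel₀ hc, one_smul]
  field_simp

/-- A cutoff function supported in the shell `L⁻¹ ≤ |y| ≤ 2 L`. -/
def shellCut (L : ℝ) (y : R4) : ℝ := bump (L⁻¹ • y) - bump (L • y)

/-! ### Cutoff to a shell and the resulting commutators. -/

section Shell

variable {L : ℝ} (hL : 2 ≤ L)
include hL

theorem shellCut_eq_zero_of_le {y : R4} (hy : ‖y‖ ≤ L⁻¹) : shellCut L y = 0 := by
  have h0 : 0 < L := by linarith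
  have h1 : L⁻¹ ≤ 1 := inv_le_one_of_one_le₀ (by linarith)
  have h2 : 0 < L⁻¹ := inv_pos.2 h0
  rw [shellCut, bump_eq_one, bump_eq_one, sub_self]
  · rw [norm_smul, norm_of_nonneg h0.le]
    calc L * ‖y‖ ≤ L * L⁻¹ := by gcongr
      _ = 1 := mul_inv_cancel₀ h0.ne'
  · rw [norm_smul, norm_of_nonneg h2.le]
    nlinarith [norm_nonneg y]

theorem shellCut_eq_zero_of_ge {y : R4} (hy : 2 * L ≤ ‖y‖) : shellCut L y = 0 := by
  have h0 : 0 < L := by linarith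
  have h2 : 0 < L⁻¹ := inv_pos.2 h0
  rw [shellCut, bump_eq_zero, bump_eq_zero, sub_self]
  · rw [norm_smul, norm_of_nonneg h0.le]
    nlinarith
  · rw [norm_smul, norm_of_nonneg h2.le]
    calc 2 = L⁻¹ * (2 * L) := by field_simp
      _ ≤ _ := by gcongr

theorem shellCut_eq_one {y : R4} (h1 : 1 / 2 < ‖y‖) (h2 : ‖y‖ < 2) (hL4 : 4 ≤ L) :
    shellCut L y = 1 := by
  have h0 : 0 < L := by linarith
  have h3 : L⁻¹ ≤ 4⁻¹ := inv_anti₀ (by norm_num) hL4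
  have h4 : 0 < L⁻¹ := inv_pos.2 h0
  rw [shellCut, bump_eq_one, bump_eq_zero, sub_zero]
  · rw [norm_smul, norm_of_nonneg h0.le]
    nlinarith
  · rw [norm_smul, norm_of_nonneg h4.le]
    nlinarith

omit hL in
theorem abs_shellCut_le_one (L : ℝ) (y : R4) : |shellCut L y| ≤ 1 := by
  have := bump_nonneg (L⁻¹ • y)
  have := bump_nonneg (L • y)
  have := bump_le_one (L⁻¹ • y)
  have := bump_le_one (L • y)
  rw [shellCut, abs_le]
  constructor <;> linarith

omit hL in
theorem contDiff_shellCut (L : ℝ) : ContDiff ℝ ∞ (shellCut L) :=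
  (contDiff_bump.comp (contDiff_id.const_smul _)).sub
    (contDiff_bump.comp (contDiff_id.const_smul _))

theorem shellCut_mem {y : R4} (hy : shellCut L y ≠ 0) : L⁻¹ ≤ ‖y‖ ∧ ‖y‖ ≤ 2 * L := by
  constructor <;> by_contra! h
  · exact hy (shellCut_eq_zero_of_le hL h.le)
  · exact hy (shellCut_eq_zero_of_ge hL h.le)

theorem tsupport_shellCut : tsupport (shellCut L) ⊆ {y | L⁻¹ ≤ ‖y‖ ∧ ‖y‖ ≤ 2 * L} :=
  closure_minimal (fun _ hy => shellCut_mem hL hy)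
    ((isClosed_le continuous_const continuous_norm).inter
      (isClosed_le continuous_norm continuous_const))

theorem tsupport_shellCut_punctured : tsupport (shellCut L) ⊆ {0}ᶜ := fun y hy h0 => by
  have h1 := (tsupport_shellCut hL hy).1
  rw [mem_singleton_iff.1 h0, norm_zero] at h1
  have : 0 < L⁻¹ := inv_pos.2 (by linarith)
  linarith

theorem hasCompactSupport_shellCut : HasCompactSupport (shellCut L) :=
  .of_support_subset_isCompact (isCompact_closedBall (0 : R4) (2 * L)) fun _ hy => by
    simpa using (shellCut_mem hL hy).2

variable {v : R4 → ℝ} (hv : ContDiffOn ℝ ∞ v {0}ᶜ)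
include hv

theorem contDiff_shellCut_mul : ContDiff ℝ ∞ fun y => shellCut L y * v y :=
  contDiff_iff_contDiffAt.2 fun y => by
    by_cases hy : y ∈ tsupport (shellCut L)
    · exact (contDiff_shellCut L).contDiffAt.mul
        (hv.contDiffAt (isOpen_punctured.mem_nhds (tsupport_shellCut_punctured hL hy)))
    · have h := notMem_tsupport_iff_eventuallyEq.1 hy
      refine (contDiffAt_const (c := (0 : ℝ))).congr_of_eventuallyEq ?_
      filter_upwards [h] with z hz
      simp [hz]

theorem lap_lap_shellCut_mul {y : R4} (hy : y ≠ 0) :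
    lap (lap fun z => shellCut L z * v z) y = shellCut L y * lap (lap v) y +
      (L⁻¹ ^ 4 * bumpComm (fun z => v (L • z)) (L⁻¹ • y) -
        L ^ 4 * bumpComm (fun z => v (L⁻¹ • z)) (L • y)) := by
  have h0 : L ≠ 0 := by linarith
  have hs : ∀ c : ℝ, ContDiffOn ℝ ∞ (fun z => bump (c • z) * v z) {0}ᶜ := fun c =>
    (contDiff_bump.comp (contDiff_id.const_smul c)).contDiffOn.mul hv
  have h1 : (fun z => shellCut L z * v z) =
      fun z => bump (L⁻¹ • z) * v z + (-1) * (bump (L • z) * v z) := by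
    funext z; simp only [shellCut]; ring
  have hs' : ContDiffOn ℝ ∞ (fun z => (-1) * (bump (L • z) * v z)) {0}ᶜ :=
    contDiffOn_const.mul (hs L)
  have h2 : ∀ z ∈ ({0}ᶜ : Set R4), lap (fun z => shellCut L z * v z) z =
      lap (fun z => bump (L⁻¹ • z) * v z) z + lap (fun z => (-1) * (bump (L • z) * v z)) z :=
    fun z hz => by rw [h1, lap_add isOpen_punctured (hs _) hz hs']
  rw [lap_eqOn isOpen_punctured hy h2, lap_add isOpen_punctured
    (contDiffOn_lap isOpen_punctured (hs _)) hy (contDiffOn_lap isOpen_punctured hs'),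
    lap_const_mul_field, lap_const_mul_field, lap_lap_bump_smul_mul v (inv_ne_zero h0)]
  simp only [lap_lap_bump_smul_mul v h0]
  rw [inv_inv, shellCut]
  ring

/-- The shell cutoff is a difference of two dilated bumps, so its errors live at the scales L and
L⁻¹. Rescaling each to the fixed annulus absorbs the factors L^{∓4} as Jacobians. -/
theorem integral_mul_lap_lap_shellCut {K : R4 → ℝ} (hK : Measurable K) {x : R4}
    (hle : ∀ y ≠ x, |K y| ≤ ‖y - x‖ + ‖y - x‖⁻¹) :
    ∫ y, K y * lap (lap fun z => shellCut L z * v z) y =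
      (∫ y, K y * (shellCut L y * lap (lap v) y)) +
      ((∫ η, K (L • η) * bumpComm (fun z => v (L • z)) η) -
        ∫ η, K (L⁻¹ • η) * bumpComm (fun z => v (L⁻¹ • z)) η) := by
  have h0 : 0 < L := by linarith
  have hscale : ∀ (c : ℝ) (F : R4 → ℝ), 0 < c →
      ∫ y, K y * (c ^ 4 * F (c • y)) = ∫ η, K (c⁻¹ • η) * F η := fun c F hc => by
    have h := Measure.integral_comp_smul (volume : Measure R4) (fun η => K (c⁻¹ • η) * F η) c
    rw [finrank_R4, abs_of_pos (by positivity), smul_eq_mul] at h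
    have h2 : ∀ y, K y * (c ^ 4 * F (c • y)) = c ^ 4 * (K (c⁻¹ • c • y) * F (c • y)) := fun y => by
      rw [smul_smul, inv_mul_cancel₀ hc.ne', one_smul]
      ring
    simp only [h2]
    rw [integral_const_mul, h, ← mul_assoc, mul_inv_cancel₀ (by positivity), one_mul]
  have hLi : L⁻¹ ≠ 0 := (inv_pos.2 h0).ne'
  have hcomm : ∀ c : ℝ, c ≠ 0 → Integrable fun y =>
      K y * (c ^ 4 * bumpComm (fun z => v (c⁻¹ • z)) (c • y)) := fun c hc => by
    refine integrable_mul_of_le_norm_add_inv (x := x) ?_ ?_ hK hle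
    · exact continuous_const.mul ((continuous_bumpComm (contDiffOn_comp_smul hv
        (inv_ne_zero hc))).comp (continuous_const_smul c))
    · exact ((hasCompactSupport_bumpComm _).comp_homeomorph (Homeomorph.smulOfNeZero c hc)).mul_left
  have h1 : Integrable fun y => K y * (shellCut L y * lap (lap v) y) :=
    integrable_mul_of_le_norm_add_inv (x := x) (continuous_mul_of_tsupport isOpen_punctured
      (contDiff_shellCut L).continuous (tsupport_shellCut_punctured hL)
      (contDiffOn_lap isOpen_punctured (contDiffOn_lap isOpen_punctured hv)).continuousOn)
      (hasCompactSupport_shellCut hL).mul_right hK hle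
  have e1 := hscale L⁻¹ (bumpComm fun z => v (L • z)) (inv_pos.2 h0)
  have e2 := hscale L (bumpComm fun z => v (L⁻¹ • z)) h0
  have i1 := hcomm L⁻¹ hLi
  have i2 := hcomm L h0.ne'
  rw [inv_inv] at e1 i1
  have i3 := i1.sub i2
  simp only [Pi.sub_def] at i3
  rw [← e1, ← e2, ← integral_sub i1 i2, ← integral_add h1 i3]
  refine integral_congr_ae ?_
  filter_upwards [Measure.ae_ne volume (0 : R4)] with y hy
  rw [lap_lap_shellCut_mul hL hv hy]
  ring

end Shell

/-! ### Smooth families of kernels -/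

/-- The `i`-th partial derivative in the second variable of a function on `ℝ⁴ × ℝ⁴`. -/
def pdSnd (i : Fin 4) (F : R4 × R4 → ℝ) (q : R4 × R4) : ℝ := fderiv ℝ F q (0, eb i)

/-- The Laplacian in the second variable of a function on `ℝ⁴ × ℝ⁴`. -/
def lapSnd (F : R4 × R4 → ℝ) (q : R4 × R4) : ℝ := ∑ i, pdSnd i (pdSnd i F) q

section SmoothFamily

variable {F : R4 × R4 → ℝ}

theorem tsupport_pdSnd_subset (i : Fin 4) (F : R4 × R4 → ℝ) :
    tsupport (pdSnd i F) ⊆ tsupport F :=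
  tsupport_fderiv_apply_subset ℝ _

theorem tsupport_lapSnd_subset (F : R4 × R4 → ℝ) : tsupport (lapSnd F) ⊆ tsupport F := by
  refine closure_minimal (fun x hx => ?_) isClosed_closure
  obtain ⟨i, -, hi⟩ := Finset.exists_ne_zero_of_sum_ne_zero (Function.mem_support.1 hx)
  exact tsupport_pdSnd_subset i F (tsupport_pdSnd_subset i _ (subset_tsupport _ hi))

theorem contDiff_pdSnd (hF : ContDiff ℝ ∞ F) (i : Fin 4) : ContDiff ℝ ∞ (pdSnd i F) :=
  contDiffOn_univ.1 (contDiffOn_fderiv_apply isOpen_univ hF.contDiffOn _)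

theorem contDiff_lapSnd (hF : ContDiff ℝ ∞ F) : ContDiff ℝ ∞ (lapSnd F) :=
  ContDiff.sum fun i _ => contDiff_pdSnd (contDiff_pdSnd hF i) i

theorem pd_slice (hF : ContDiff ℝ ∞ F) (i : Fin 4) (p : R4) :
    pd i (fun η => F (p, η)) = fun η => pdSnd i F (p, η) := by
  funext η
  have h := ((hF.differentiable (by simp)) (p, η)).hasFDerivAt.comp η
    (hasFDerivAt_prodMk_right (𝕜 := ℝ) p η)
  have h2 : pd i (fun η => F (p, η)) η = _ := congrArg (· (eb i)) h.fderiv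
  rw [h2]
  simp [pdSnd]

theorem lap_slice (hF : ContDiff ℝ ∞ F) (p : R4) :
    lap (fun η => F (p, η)) = fun η => lapSnd F (p, η) := by
  funext η
  simp only [lap, lapSnd, pd_slice hF, pd_slice (contDiff_pdSnd hF _)]

theorem lap_lap_slice (hF : ContDiff ℝ ∞ F) (p : R4) :
    lap (lap fun η => F (p, η)) = fun η => lapSnd (lapSnd F) (p, η) := by
  rw [lap_slice hF, lap_slice (contDiff_lapSnd hF)]

end SmoothFamily

/-- The pairing of a test function `a` supported in the annulus with `bumpComm v`, after all
derivatives have been moved away from `v`. -/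
theorem integral_mul_bumpComm {v : R4 → ℝ} (hv : ContDiffOn ℝ ∞ v {0}ᶜ) {a : R4 → ℝ}
    (ha : ContDiff ℝ ∞ a) (hsupp : ∀ y ∉ annulus, a y = 0) :
    ∫ y, a y * (lap (lap fun z => bump z * v z) y - bump y * lap (lap v) y) =
      ∫ y, (bump y * lap (lap a) y - lap (lap fun z => a z * bump z) y) * v y := by
  have hU := isOpen_punctured
  have hac : HasCompactSupport a := .intro' isCompact_annulus isClosed_annulus hsupp
  have haU : tsupport a ⊆ {0}ᶜ := (tsupport_subset_annulus hsupp).trans annulus_subset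
  have hbv := contDiffOn_bump_mul hv
  have hab : ContDiff ℝ ∞ fun z => a z * bump z := ha.mul contDiff_bump
  have habc : HasCompactSupport fun z => a z * bump z := hac.mul_right
  have habU : tsupport (fun z => a z * bump z) ⊆ {0}ᶜ := tsupport_mul_subset_left.trans haU
  have hll := (contDiffOn_lap hU (contDiffOn_lap hU hv)).continuousOn
  have h1 := integral_mul_lap_lap hU ha hac haU hbv
  have h2 := integral_mul_lap_lap hU hab habc habU hv
  have i1 := integrable_mul_of_tsupport hU ha.continuous hac haU
    (contDiffOn_lap hU (contDiffOn_lap hU hbv)).continuousOn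
  have i2 := integrable_mul_of_tsupport hU hab.continuous habc habU hll
  have i3 := integrable_mul_of_tsupport hU (contDiff_lap (contDiff_lap ha)).continuous
    (hasCompactSupport_lap (hasCompactSupport_lap hac))
    ((tsupport_lap_subset _).trans ((tsupport_lap_subset a).trans haU)) hbv.continuousOn
  have i4 := integrable_mul_of_tsupport hU (contDiff_lap (contDiff_lap hab)).continuous
    (hasCompactSupport_lap (hasCompactSupport_lap habc))
    ((tsupport_lap_subset _).trans ((tsupport_lap_subset _).trans habU)) hv.continuousOn
  calc _ = ∫ y, (a y * lap (lap fun z => bump z * v z) y - a y * bump y * lap (lap v) y) := by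
        congr 1; funext y; ring
    _ = ∫ y, (lap (lap a) y * (bump y * v y) - lap (lap fun z => a z * bump z) y * v y) := by
        rw [integral_sub i1 i2, integral_sub i3 i4, h1, h2]
    _ = _ := by congr 1; funext y; ring

/-- A kernel depending smoothly on a parameter pairs with `bumpComm v` in a Lipschitz way, with
respect to the `L¹` norm of `v` on the annulus. -/
theorem exists_abs_integral_bumpComm_sub_le {N : R4 → R4 → ℝ}
    (hN : ∀ p η, ‖p‖ ≤ 1 / 8 → η ∈ annulus →
      ContDiffAt ℝ ∞ (fun q : R4 × R4 => N q.1 q.2) (p, η)) :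
    ∃ C : ℝ, 0 ≤ C ∧ ∀ p : R4, ‖p‖ ≤ 1 / 16 → ∀ v : R4 → ℝ, ContDiffOn ℝ ∞ v {0}ᶜ →
      |(∫ η, N p η * bumpComm v η) - ∫ η, N 0 η * bumpComm v η| ≤
        C * ‖p‖ * ∫ η in annulus, |v η| := by
  let κ : R4 → ℝ := (⟨1 / 16, 1 / 8, by norm_num, by norm_num⟩ : ContDiffBump (0 : R4))
  have hκ : ContDiff ℝ ∞ κ := ContDiffBump.contDiff _
  have hκ1 : ∀ p : R4, ‖p‖ ≤ 1 / 16 → κ p = 1 := fun p hp =>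
    ContDiffBump.one_of_mem_closedBall _ (by simpa using hp)
  have hκ0 : ∀ p : R4, 1 / 8 < ‖p‖ → κ p = 0 := fun p hp =>
    ContDiffBump.zero_of_le_dist _ (by simpa using hp.le)
  -- Multiplication by cutoffs in both variables makes the kernel smooth and compactly supported on
  -- the whole product, without changing it where it is paired.
  let F : R4 × R4 → ℝ := fun q => κ q.1 * ringBump q.2 * N q.1 q.2
  set S : Set (R4 × R4) := Metric.closedBall (0 : R4) (1 / 8) ×ˢ annulus with hS
  have hSc : IsCompact S := (isCompact_closedBall _ _).prod isCompact_annulus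
  have hF0 : ∀ q ∉ S, F q = 0 := fun q hq => by
    simp only [F]
    by_cases h1 : q.2 ∈ annulus
    · have : κ q.1 = 0 := hκ0 _ (by
        by_contra! h2
        exact hq ⟨by simpa using h2, h1⟩)
      simp [this]
    · simp [ringBump_eq_zero h1]
  have hFt : tsupport F ⊆ S :=
    closure_minimal (fun q hq => by by_contra h; exact hq (hF0 q h)) hSc.isClosed
  have hF : ContDiff ℝ ∞ F := contDiff_iff_contDiffAt.2 fun q => by
    by_cases hq : q ∈ S
    · exact ((hκ.comp contDiff_fst).mul (contDiff_ringBump.comp contDiff_snd)).contDiffAt.mul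
        (hN q.1 q.2 (by simpa using hq.1) hq.2)
    · refine (contDiffAt_const (c := (0 : ℝ))).congr_of_eventuallyEq ?_
      filter_upwards [hSc.isClosed.isOpen_compl.mem_nhds hq] with z hz
      exact hF0 z hz
  let F2 : R4 × R4 → ℝ := fun q => F q * bump q.2
  have hF2 : ContDiff ℝ ∞ F2 := hF.mul (contDiff_bump.comp contDiff_snd)
  let G : R4 × R4 → ℝ := fun q => bump q.2 * lapSnd (lapSnd F) q - lapSnd (lapSnd F2) q
  have hG : ContDiff ℝ ∞ G := ((contDiff_bump.comp contDiff_snd).mul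
    (contDiff_lapSnd (contDiff_lapSnd hF))).sub (contDiff_lapSnd (contDiff_lapSnd hF2))
  have hG0 : ∀ q ∉ S, G q = 0 := fun q hq => by
    have h1 : lapSnd (lapSnd F) q = 0 := image_eq_zero_of_notMem_tsupport fun h =>
      hq (hFt (tsupport_lapSnd_subset _ (tsupport_lapSnd_subset _ h)))
    have h2 : lapSnd (lapSnd F2) q = 0 := image_eq_zero_of_notMem_tsupport fun h =>
      hq (hFt (tsupport_mul_subset_left (tsupport_lapSnd_subset _ (tsupport_lapSnd_subset _ h))))
    simp [G, h1, h2]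
  -- G is the kernel left over once all derivatives are off v. Its Lipschitz constant does not
  -- depend on v.
  obtain ⟨C, hC⟩ := hG.lipschitzWith_of_hasCompactSupport
    (.intro' hSc hSc.isClosed hG0) (by simp)
  refine ⟨C, C.2, fun p hp v hv => ?_⟩
  have hslice : ∀ p : R4, ‖p‖ ≤ 1 / 16 →
      ∫ η, N p η * bumpComm v η = ∫ η, G (p, η) * v η := fun p hp => by
    have ha : ContDiff ℝ ∞ fun η => F (p, η) := hF.comp (contDiff_const.prodMk contDiff_id)
    have h1 := integral_mul_bumpComm hv ha fun y hy => hF0 _ fun h => hy h.2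
    have h2 : (fun η => N p η * bumpComm v η) = fun η => F (p, η) *
        (lap (lap fun z => bump z * v z) η - bump η * lap (lap v) η) := by
      funext η
      simp only [F, bumpComm, hκ1 p hp]
      ring
    rw [h2, h1, lap_lap_slice hF, show (fun z => F (p, z) * bump z) = fun z => F2 (p, z) from rfl,
      lap_lap_slice hF2]
  have hGi : ∀ p : R4, Integrable fun η => G (p, η) * v η := fun p => by
    have h0 : ∀ y ∉ annulus, G (p, y) = 0 := fun y hy => hG0 _ fun h => hy h.2
    exact integrable_mul_of_tsupport isOpen_punctured
      (hG.comp (contDiff_const.prodMk contDiff_id)).continuous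
      (.intro' isCompact_annulus isClosed_annulus h0)
      ((tsupport_subset_annulus h0).trans annulus_subset) hv.continuousOn
  rw [hslice p hp, hslice 0 (by simp), ← integral_sub (hGi p) (hGi 0), ← integral_const_mul,
    ← integral_indicator isClosed_annulus.measurableSet]
  refine abs_integral_le_integral_abs.trans (integral_mono_of_nonneg
    (.of_forall fun _ => abs_nonneg _) ?_ (.of_forall fun η => ?_))
  · refine (integrable_indicator_iff isClosed_annulus.measurableSet).2 ?_
    exact (((hv.continuousOn.mono annulus_subset).abs).integrableOn_compact
      isCompact_annulus).const_mul _
  · by_cases hη : η ∈ annulus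
    · simp only [indicator_of_mem hη, ← sub_mul, abs_mul]
      refine mul_le_mul_of_nonneg_right ?_ (abs_nonneg _)
      have := hC.dist_le_mul (p, η) (0, η)
      simpa [Real.dist_eq, Prod.dist_eq] using this
    · simp [indicator_of_notMem hη, hG0 (p, η) fun h => hη h.2, hG0 (0, η) fun h => hη h.2]

/-- Seen from the rescaled annuli, a point x of the unit sphere enters only through p = x/L, up to a
constant `k L`. Since |p| = 1/L, replacing p by 0 costs a factor 1/L. What remains varying in x is
the potential of the bi-Laplacian on the shell. -/
theorem exists_abs_integral_kernel_sub_le {K : R4 → R4 → ℝ} {k : ℝ → ℝ} {No Ni : R4 → R4 → ℝ}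
    (hK : ∀ x, Measurable (K x)) (hle : ∀ x, ‖x‖ = 1 → ∀ y ≠ x, |K x y| ≤ ‖y - x‖ + ‖y - x‖⁻¹)
    (hNo : ∀ p η, ‖p‖ ≤ 1 / 8 → η ∈ annulus →
      ContDiffAt ℝ ∞ (fun q : R4 × R4 => No q.1 q.2) (p, η))
    (hNi : ∀ p η, ‖p‖ ≤ 1 / 8 → η ∈ annulus →
      ContDiffAt ℝ ∞ (fun q : R4 × R4 => Ni q.1 q.2) (p, η))
    (ho : ∀ L : ℝ, 16 ≤ L → ∀ x, ‖x‖ = 1 → ∀ η ∈ annulus, K x (L • η) = k L + No (L⁻¹ • x) η)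
    (hi : ∀ L : ℝ, 16 ≤ L → ∀ x, ‖x‖ = 1 → ∀ η ∈ annulus, K x (L⁻¹ • η) = Ni (L⁻¹ • x) η) :
    ∃ C : ℝ, 0 ≤ C ∧ ∀ L : ℝ, 16 ≤ L → ∀ v : R4 → ℝ, ContDiffOn ℝ ∞ v {0}ᶜ → ∃ a : ℝ,
      ∀ x, ‖x‖ = 1 →
        |(∫ y, K x y * lap (lap fun z => shellCut L z * v z) y) - a| ≤
          (∫ y, |K x y| * |shellCut L y * lap (lap v) y|) +
          C / L * ((∫ η in annulus, |v (L • η)|) + ∫ η in annulus, |v (L⁻¹ • η)|) := by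
  obtain ⟨Co, hCo, ho'⟩ := exists_abs_integral_bumpComm_sub_le hNo
  obtain ⟨Ci, hCi, hi'⟩ := exists_abs_integral_bumpComm_sub_le hNi
  refine ⟨Co + Ci, by positivity, fun L hL v hv => ?_⟩
  have h0 : 0 < L := by linarith
  have hLi : 0 < L⁻¹ := inv_pos.2 h0
  have hvo := contDiffOn_comp_smul hv h0.ne'
  have hvi := contDiffOn_comp_smul hv hLi.ne'
  -- The constant consists of the commutator terms evaluated at p = 0.
  refine ⟨(∫ η, k L * bumpComm (fun z => v (L • z)) η) +
    (∫ η, No 0 η * bumpComm (fun z => v (L • z)) η) -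
    ∫ η, Ni 0 η * bumpComm (fun z => v (L⁻¹ • z)) η, fun x hx => ?_⟩
  have hp : ‖L⁻¹ • x‖ = L⁻¹ := by rw [norm_smul, hx, mul_one, norm_of_nonneg hLi.le]
  have hp16 : L⁻¹ ≤ 1 / 16 := by
    rw [one_div]
    exact inv_anti₀ (by norm_num) hL
  have ho1 := ho' (L⁻¹ • x) (by rw [hp]; exact hp16) _ hvo
  have hi1 := hi' (L⁻¹ • x) (by rw [hp]; exact hp16) _ hvi
  rw [hp] at ho1 hi1
  have eo : ∫ η, K x (L • η) * bumpComm (fun z => v (L • z)) η =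
      (∫ η, k L * bumpComm (fun z => v (L • z)) η) +
        ∫ η, No (L⁻¹ • x) η * bumpComm (fun z => v (L • z)) η := by
    rw [← integral_add]
    · refine integral_congr_ae (.of_forall fun η => ?_)
      by_cases hη : η ∈ annulus
      · simp only [ho L hL x hx η hη]
        ring
      · simp [bumpComm_eq_zero _ hη]
    · exact (continuous_const.mul (continuous_bumpComm hvo)).integrable_of_hasCompactSupport
        (hasCompactSupport_bumpComm _).mul_left
    · rw [← integrableOn_iff_integrable_of_support_subset (s := annulus) fun η hη => by
        by_contra h
        exact hη (by simp [bumpComm_eq_zero _ h])]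
      refine ContinuousOn.integrableOn_compact isCompact_annulus (ContinuousOn.mul ?_
        (continuous_bumpComm hvo).continuousOn)
      intro η hη
      have h1 := (hNo (L⁻¹ • x) η (by rw [hp]; linarith) hη).continuousAt
      have h2 : ContinuousAt (fun η : R4 => (L⁻¹ • x, η)) η := by fun_prop
      exact (ContinuousAt.comp (f := fun η : R4 => (L⁻¹ • x, η)) h1 h2).continuousWithinAt
  have ei : ∫ η, K x (L⁻¹ • η) * bumpComm (fun z => v (L⁻¹ • z)) η =
      ∫ η, Ni (L⁻¹ • x) η * bumpComm (fun z => v (L⁻¹ • z)) η := by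
    refine integral_congr_ae (.of_forall fun η => ?_)
    by_cases hη : η ∈ annulus
    · simp only [hi L hL x hx η hη]
    · simp [bumpComm_eq_zero _ hη]
  rw [integral_mul_lap_lap_shellCut (by linarith) hv (hK x) (hle x hx), eo, ei]
  have hmain : |∫ y, K x y * (shellCut L y * lap (lap v) y)| ≤
      ∫ y, |K x y| * |shellCut L y * lap (lap v) y| := by
    refine abs_integral_le_integral_abs.trans (le_of_eq ?_)
    simp only [abs_mul]
  have hA : 0 ≤ ∫ η in annulus, |v (L • η)| := integral_nonneg fun _ => abs_nonneg _
  have hB : 0 ≤ ∫ η in annulus, |v (L⁻¹ • η)| := integral_nonneg fun _ => abs_nonneg _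
  set A := ∫ η in annulus, |v (L • η)|
  set B := ∫ η in annulus, |v (L⁻¹ • η)|
  have hsum : Co * L⁻¹ * A + Ci * L⁻¹ * B ≤ (Co + Ci) / L * (A + B) := by
    rw [div_eq_mul_inv]
    have : 0 ≤ Co * L⁻¹ * B + Ci * L⁻¹ * A := by positivity
    nlinarith
  rw [abs_le] at ho1 hi1 hmain ⊢
  constructor <;> linarith [ho1.1, ho1.2, hi1.1, hi1.2, hmain.1, hmain.2]

theorem sub_ne_zero_of_mem_annulus {p η : R4} (hp : ‖p‖ ≤ 1 / 8) (hη : η ∈ annulus) :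
    η - p ≠ 0 := fun h => by
  have h1 := hη.1
  rw [sub_eq_zero.1 h] at h1
  linarith

/-- With p = x/L and |x| = 1 this is |L⁻¹η - x|². The inner product is at most 3/8, so the value
stays at least 1/4. -/
theorem reflectedNormSq_pos {p η : R4} (hp : ‖p‖ ≤ 1 / 8) (hη : η ∈ annulus) :
    0 < 1 - 2 * inner ℝ p η + ‖p‖ ^ 2 * ‖η‖ ^ 2 := by
  have h1 := real_inner_le_norm p η
  have h2 : ‖p‖ * ‖η‖ ≤ 1 / 8 * 3 := mul_le_mul hp hη.2 (norm_nonneg _) (by norm_num)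
  nlinarith [mul_nonneg (norm_nonneg p) (norm_nonneg η)]

theorem norm_smul_sub_eq (x : R4) {L : ℝ} (hL : 0 < L) (η : R4) :
    ‖L • η - x‖ = L * ‖η - L⁻¹ • x‖ := by
  rw [show L • η - x = L • (η - L⁻¹ • x) by
    rw [smul_sub, smul_smul, mul_inv_cancel₀ hL.ne', one_smul], norm_smul, norm_of_nonneg hL.le]

theorem norm_smul_sub_sq {x : R4} (hx : ‖x‖ = 1) (s : ℝ) (η : R4) :
    ‖s • η - x‖ ^ 2 = 1 - 2 * inner ℝ (s • x) η + ‖s • x‖ ^ 2 * ‖η‖ ^ 2 := by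
  rw [norm_sub_sq_real, norm_smul, norm_smul, hx, real_inner_smul_left, real_inner_smul_left,
    real_inner_comm]
  ring

/-! ### Oscillation on the unit sphere controlled by potentials. -/

section Local

theorem contDiffAt_inner_fst_snd (q : R4 × R4) :
    ContDiffAt ℝ ∞ (fun q : R4 × R4 => inner ℝ q.1 q.2) q :=
  contDiffAt_fst.inner ℝ contDiffAt_snd

theorem contDiffAt_reflectedNormSq (q : R4 × R4) : ContDiffAt ℝ ∞
    (fun q : R4 × R4 => 1 - 2 * inner ℝ q.1 q.2 + ‖q.1‖ ^ 2 * ‖q.2‖ ^ 2) q :=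
  (contDiffAt_const.sub (contDiffAt_const.mul (contDiffAt_inner_fst_snd q))).add
    ((contDiffAt_fst.norm_sq ℝ).mul (contDiffAt_snd.norm_sq ℝ))

/-- Up to a constant, a function smooth off the origin is controlled on the unit sphere by the
logarithmic potential of its bi-Laplacian on a shell and by its `L¹` norm far away. -/
theorem exists_abs_sub_le_log_potential :
    ∃ C : ℝ, 0 ≤ C ∧ ∀ L : ℝ, 16 ≤ L → ∀ v : R4 → ℝ, ContDiffOn ℝ ∞ v {0}ᶜ → ∃ a : ℝ,
      ∀ x, ‖x‖ = 1 → |bihConst * v x - a| ≤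
          (∫ y, |log ‖y - x‖| * |shellCut L y * lap (lap v) y|) +
          C / L * ((∫ η in annulus, |v (L • η)|) + ∫ η in annulus, |v (L⁻¹ • η)|) := by
  have hex := exists_abs_integral_kernel_sub_le (K := fun x y => log ‖y - x‖)
    -- log |Lη - x| = log L + log |η - x/L|, while log |L⁻¹η - x| is half the logarithm of its
    -- square, a smooth function of x/L and η.
    (k := log) (No := fun p η => log ‖η - p‖)
    (Ni := fun p η => 1 / 2 * log (1 - 2 * inner ℝ p η + ‖p‖ ^ 2 * ‖η‖ ^ 2))
    (fun x => by fun_prop)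
    (fun x _ y hy => abs_log_le_add_inv (norm_pos_iff.2 (sub_ne_zero.2 hy)))
    (fun p η hp hη => ?_) (fun p η hp hη => ?_) (fun L hL x hx η hη => ?_)
    (fun L hL x hx η hη => ?_)
  · obtain ⟨C, hC, h⟩ := hex
    refine ⟨C, hC, fun L hL v hv => ?_⟩
    obtain ⟨a, ha⟩ := h L hL v hv
    refine ⟨-a, fun x hx => ?_⟩
    have hf := contDiff_shellCut_mul (by linarith : 2 ≤ L) hv
    have hfc : HasCompactSupport fun y => shellCut L y * v y :=
      (hasCompactSupport_shellCut (by linarith)).mul_right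
    have h1 := bihConst_mul_eq hf hfc x
    simp only [shellCut_eq_one (by linarith : 2 ≤ L) (by rw [hx]; norm_num)
      (by rw [hx]; norm_num) (by linarith : 4 ≤ L), one_mul] at h1
    have h2 := ha x hx
    rw [h1, ← abs_neg]
    convert h2 using 2
    ring
  · have h1 := sub_ne_zero_of_mem_annulus hp hη
    exact ((contDiffAt_snd.sub contDiffAt_fst).norm ℝ h1).log (norm_ne_zero_iff.2 h1)
  · exact contDiffAt_const.mul ((contDiffAt_reflectedNormSq _).log (reflectedNormSq_pos hp hη).ne')
  · have hL0 : 0 < L := by linarith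
    have hp : ‖L⁻¹ • x‖ ≤ 1 / 8 := by
      rw [norm_smul, hx, mul_one, norm_of_nonneg (inv_pos.2 hL0).le, inv_le_comm₀ hL0 (by norm_num)]
      norm_num
      linarith
    rw [norm_smul_sub_eq x hL0, log_mul hL0.ne'
      (norm_ne_zero_iff.2 (sub_ne_zero_of_mem_annulus hp hη))]
  · rw [← norm_smul_sub_sq hx, log_pow]
    push_cast
    ring

/-- The analogue of `exists_abs_sub_le_log_potential` for the radial derivative. -/
theorem exists_abs_euler_sub_le_potential :
    ∃ C : ℝ, 0 ≤ C ∧ ∀ L : ℝ, 16 ≤ L → ∀ v : R4 → ℝ, ContDiffOn ℝ ∞ v {0}ᶜ → ∃ a : ℝ,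
      ∀ x, ‖x‖ = 1 → |bihConst * euler v x - a| ≤
          (∫ y, ‖y - x‖⁻¹ * |shellCut L y * lap (lap v) y|) +
          C / L * ((∫ η in annulus, |v (L • η)|) + ∫ η in annulus, |v (L⁻¹ • η)|) := by
  have hKle : ∀ x : R4, ‖x‖ = 1 → ∀ y, |inner ℝ x (x - y) / ‖y - x‖ ^ 2| ≤ ‖y - x‖⁻¹ := by
    intro x hx y
    rcases eq_or_ne y x with rfl | hy
    · simp
    have hd : 0 < ‖y - x‖ := norm_pos_iff.2 (sub_ne_zero.2 hy)
    have h1 := abs_real_inner_le_norm x (x - y)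
    rw [hx, one_mul, norm_sub_rev] at h1
    rw [abs_div, abs_of_pos (show 0 < ‖y - x‖ ^ 2 by positivity)]
    calc _ ≤ ‖y - x‖ / ‖y - x‖ ^ 2 := by gcongr
      _ = ‖y - x‖⁻¹ := by field_simp
  have hex := exists_abs_integral_kernel_sub_le
    (K := fun x y => inner ℝ x (x - y) / ‖y - x‖ ^ 2)
    (k := fun _ => 0) (No := fun p η => (‖p‖ ^ 2 - inner ℝ p η) / ‖η - p‖ ^ 2)
    (Ni := fun p η => (1 - inner ℝ p η) / (1 - 2 * inner ℝ p η + ‖p‖ ^ 2 * ‖η‖ ^ 2))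
    (fun x => by fun_prop) (fun x hx y hy => (hKle x hx y).trans (by simp))
    (fun p η hp hη => ?_) (fun p η hp hη => ?_) (fun L hL x hx η hη => ?_)
    (fun L hL x hx η hη => ?_)
  · obtain ⟨C, hC, h⟩ := hex
    refine ⟨C, hC, fun L hL v hv => ?_⟩
    have hL2 : 2 ≤ L := by linarith
    obtain ⟨a, ha⟩ := h L hL v hv
    refine ⟨-a, fun x hx => ?_⟩
    have hf := contDiff_shellCut_mul hL2 hv
    have hfc : HasCompactSupport fun y => shellCut L y * v y :=
      (hasCompactSupport_shellCut hL2).mul_right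
    have h1 := bihConst_mul_euler_eq hf hfc x
    -- A radial derivative is compared, so the cutoff has to be 1 in a neighbourhood of the sphere
    -- and not only on it.
    have hloc : (fun y => shellCut L y * v y) =ᶠ[𝓝 x] v := by
      have hU : IsOpen {y : R4 | 1 / 2 < ‖y‖ ∧ ‖y‖ < 2} :=
        (isOpen_lt continuous_const continuous_norm).inter
          (isOpen_lt continuous_norm continuous_const)
      filter_upwards [hU.mem_nhds (show x ∈ {y : R4 | 1 / 2 < ‖y‖ ∧ ‖y‖ < 2} by
        constructor <;> rw [hx] <;> norm_num)] with y hy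
      rw [shellCut_eq_one hL2 hy.1 hy.2 (by linarith), one_mul]
    have h3 : euler (fun y => shellCut L y * v y) x = euler v x := by
      rw [euler, euler, hloc.fderiv_eq]
    rw [h3] at h1
    have h2 := ha x hx
    have h4 : (∫ y, |inner ℝ x (x - y) / ‖y - x‖ ^ 2| * |shellCut L y * lap (lap v) y|) ≤
        ∫ y, ‖y - x‖⁻¹ * |shellCut L y * lap (lap v) y| := by
      refine integral_mono_of_nonneg (.of_forall fun y => by positivity) ?_
        (.of_forall fun y => mul_le_mul_of_nonneg_right (hKle x hx y) (abs_nonneg _))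
      have h5 := integrable_norm_rpow_mul (show (1 : ℝ) < 4 by norm_num)
        (continuous_mul_of_tsupport isOpen_punctured (contDiff_shellCut L).continuous
          (tsupport_shellCut_punctured hL2) (contDiffOn_lap isOpen_punctured
            (contDiffOn_lap isOpen_punctured hv)).continuousOn)
        (hasCompactSupport_shellCut hL2).mul_right x
      simpa [rpow_neg_one] using h5
    rw [h1, ← abs_neg]
    refine le_trans (le_of_eq ?_) (h2.trans (add_le_add_left h4 _))
    congr 1
    ring
  · have h1 := sub_ne_zero_of_mem_annulus hp hη
    refine ((contDiffAt_fst.norm_sq ℝ).sub (contDiffAt_inner_fst_snd _)).div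
      ((contDiffAt_snd.sub contDiffAt_fst).norm_sq ℝ) ?_
    exact pow_ne_zero _ (norm_ne_zero_iff.2 h1)
  · exact (contDiffAt_const.sub (contDiffAt_inner_fst_snd _)).div (contDiffAt_reflectedNormSq _)
      (reflectedNormSq_pos hp hη).ne'
  · have hL0 : 0 < L := by linarith
    rw [norm_smul_sub_eq x hL0, inner_sub_right, real_inner_self_eq_norm_sq, hx,
      real_inner_smul_right, real_inner_smul_left, norm_smul, hx, norm_of_nonneg (inv_pos.2 hL0).le,
      mul_pow, zero_add, ← mul_div_mul_left _ (‖η - L⁻¹ • x‖ ^ 2) (pow_ne_zero 2 hL0.ne')]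
    congr 1
    field_simp
  · rw [← norm_smul_sub_sq hx, inner_sub_right, real_inner_self_eq_norm_sq, hx,
      real_inner_smul_right, real_inner_smul_left, one_pow]

end Local

/-! ### Averages of Riesz potentials over the unit sphere -/

/-- The exponent 5/2 is below the dimension 3 of the sphere. To see uniformity in y, thicken the
sphere: with d = |y - θ| and 1 < r ≤ 1 + d/2 one has |rθ - y| ≤ 3d/2, so integrating |rθ - y|^{-7/2}
over r yields at least a multiple of d^{-5/2}. Then polar coordinates bound everything by a volume
integral with exponent 7/2 < 4. -/
theorem exists_lintegral_norm_rpow_le :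
    ∃ C : ℝ, 0 < C ∧ ∀ y : R4,
      ∫⁻ θ : S3, ENNReal.ofReal (‖y - (θ : R4)‖ ^ (-(5 / 2) : ℝ)) ∂sig ≤ ENNReal.ofReal C := by
  let h : R4 → ℝ := (⟨3, 4, by norm_num, by norm_num⟩ : ContDiffBump (0 : R4))
  have hh : Continuous h := ContDiffBump.continuous _
  have hhc : HasCompactSupport h := ContDiffBump.hasCompactSupport _
  have h1 : ∀ X : R4, ‖X‖ ≤ 3 → h X = 1 := fun X hX =>
    ContDiffBump.one_of_mem_closedBall _ (by simpa using hX)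
  let J : R4 → ENNReal := fun X => ‖X‖ₑ ^ (-(7 / 2) : ℝ) * ENNReal.ofReal |h X|
  have hJm : Measurable J := by fun_prop
  have hJ : ∫⁻ X, J X ≠ ⊤ := by
    have hi := integrable_norm_rpow_mul (show (7 / 2 : ℝ) < 4 by norm_num) hh hhc 0
    have h2 : ∫⁻ X, J X = ∫⁻ X, ENNReal.ofReal (‖X - 0‖ ^ (-(7 / 2) : ℝ) * |h X|) := by
      refine lintegral_congr_ae ?_
      filter_upwards [Measure.ae_ne volume (0 : R4)] with X hX
      have hn := norm_pos_iff.2 hX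
      rw [sub_zero, ENNReal.ofReal_mul (by positivity), ← ENNReal.ofReal_rpow_of_pos hn, ofReal_norm]
    rw [h2]
    exact (lintegral_ofReal_ne_top_iff_integrable hi.aestronglyMeasurable
      (.of_forall fun X => by positivity)).2 hi
  set c : ENNReal := ENNReal.ofReal (3 / 2) ^ (-(7 / 2) : ℝ) * ENNReal.ofReal (1 / 2) with hc
  have hc0 : c ≠ 0 := by
    rw [hc]
    refine mul_ne_zero ?_ (by simp)
    rw [ENNReal.ofReal_rpow_of_pos (by norm_num)]
    simp only [ne_eq, ENNReal.ofReal_eq_zero, not_le]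
    positivity
  have hct : c ≠ ⊤ := by
    rw [hc, ENNReal.ofReal_rpow_of_pos (by norm_num)]
    exact ENNReal.mul_ne_top ENNReal.ofReal_ne_top ENNReal.ofReal_ne_top
  have hlow : ∀ (y : R4) (θ : S3), ENNReal.ofReal (‖y - (θ : R4)‖ ^ (-(5 / 2) : ℝ)) ≤
      1 + c⁻¹ * ∫⁻ r in Ioc (1 : ℝ) 2, J (r • (θ : R4) - y) := by
    intro y θ
    set d : ℝ := ‖y - (θ : R4)‖ with hd
    -- For d > 2 the kernel is at most 1. For d ≤ 2 the interval (1, 1 + d/2] lies in (1, 2] and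
    -- 3d/2 ≤ 3, where `h` is 1.
    rcases lt_or_ge 2 d with h2 | h2
    · refine le_add_right ?_
      exact ENNReal.ofReal_le_one.2 (rpow_le_one_of_one_le_of_nonpos (by linarith) (by norm_num))
    -- At y = θ the real power of 0 with a nonzero exponent is 0 by convention.
    rcases (norm_nonneg (y - (θ : R4))).eq_or_lt with h0 | h0
    · rw [hd, ← h0, zero_rpow (by norm_num), ENNReal.ofReal_zero]
      exact zero_le
    rw [← hd] at h0
    refine le_add_left ?_
    have h3 : ENNReal.ofReal (d ^ (-(5 / 2) : ℝ)) =
        c⁻¹ * (ENNReal.ofReal (3 / 2 * d) ^ (-(7 / 2) : ℝ) * ENNReal.ofReal (d / 2)) := by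
      have h4 : ENNReal.ofReal (3 / 2 * d) ^ (-(7 / 2) : ℝ) * ENNReal.ofReal (d / 2) =
          c * ENNReal.ofReal (d ^ (-(5 / 2) : ℝ)) := by
        rw [hc, ENNReal.ofReal_rpow_of_pos (by positivity), ENNReal.ofReal_rpow_of_pos (by positivity),
          ← ENNReal.ofReal_mul (by positivity), ← ENNReal.ofReal_mul (by positivity),
          ← ENNReal.ofReal_mul (by positivity), mul_rpow (by norm_num) h0.le]
        congr 1
        have : d ^ (-(5 / 2) : ℝ) = d ^ (-(7 / 2) : ℝ) * d := by
          conv_rhs => rw [← rpow_add_one h0.ne']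
          norm_num
        rw [this]
        ring
      rw [h4, ← mul_assoc, ENNReal.inv_mul_cancel hc0 hct, one_mul]
    rw [h3]
    gcongr
    have h5 : ∫⁻ _ in Ioc (1 : ℝ) (1 + d / 2), ENNReal.ofReal (3 / 2 * d) ^ (-(7 / 2) : ℝ) =
        ENNReal.ofReal (3 / 2 * d) ^ (-(7 / 2) : ℝ) * ENNReal.ofReal (d / 2) := by
      rw [setLIntegral_const, Real.volume_Ioc]
      congr 2
      ring
    rw [← h5]
    refine (setLIntegral_mono' measurableSet_Ioc fun r hr => ?_).trans
      (lintegral_mono_set (Ioc_subset_Ioc_right (by linarith)))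
    have h6 : ‖r • (θ : R4) - y‖ ≤ 3 / 2 * d := by
      have : r • (θ : R4) - y = (r - 1) • (θ : R4) - (y - θ) := by
        rw [sub_smul, one_smul]; abel
      rw [this]
      refine (norm_sub_le _ _).trans ?_
      rw [norm_smul, norm_S3, mul_one, norm_of_nonneg (by linarith [hr.1])]
      linarith [hr.2]
    simp only [J]
    rw [h1 _ (by linarith), abs_one, ENNReal.ofReal_one, mul_one]
    rw [ENNReal.rpow_neg, ENNReal.rpow_neg, ENNReal.inv_le_inv, ← ofReal_norm]
    exact ENNReal.rpow_le_rpow (ENNReal.ofReal_le_ofReal h6) (by norm_num)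
  refine ⟨(sig univ + c⁻¹ * ∫⁻ X, J X).toReal + 1, by positivity, fun y => ?_⟩
  have hfin : sig univ + c⁻¹ * ∫⁻ X, J X ≠ ⊤ :=
    ENNReal.add_ne_top.2 ⟨measure_ne_top _ _, ENNReal.mul_ne_top (ENNReal.inv_ne_top.2 hc0) hJ⟩
  refine le_trans ?_ ((ENNReal.ofReal_toReal hfin).symm.le.trans
    (ENNReal.ofReal_le_ofReal (by linarith)))
  have hm2 : Measurable fun p : S3 × ℝ => J (p.2 • (p.1 : R4) - y) := hJm.comp (by fun_prop)
  have hswap : ∫⁻ θ : S3, (∫⁻ r in Ioc (1 : ℝ) 2, J (r • (θ : R4) - y)) ∂sig =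
      ∫⁻ r in Ioc (1 : ℝ) 2, ∫⁻ θ : S3, J (r • (θ : R4) - y) ∂sig :=
    lintegral_lintegral_swap hm2.aemeasurable
  calc _ ≤ ∫⁻ θ : S3, (1 + c⁻¹ * ∫⁻ r in Ioc (1 : ℝ) 2, J (r • (θ : R4) - y)) ∂sig :=
        lintegral_mono fun θ => hlow y θ
    _ = sig univ + c⁻¹ * ∫⁻ r in Ioc (1 : ℝ) 2, ∫⁻ θ : S3, J (r • (θ : R4) - y) ∂sig := by
        rw [lintegral_add_left measurable_const, lintegral_one, lintegral_const_mul' _ _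
          (ENNReal.inv_ne_top.2 hc0), hswap]
    _ ≤ _ := by
        gcongr
        rw [← lintegral_sub_right_eq_self J y, lintegral_polar (by fun_prop)]
        refine (setLIntegral_mono' measurableSet_Ioc fun r hr => ?_).trans
          (lintegral_mono_set (fun r (hr : r ∈ Ioc (1 : ℝ) 2) => (by linarith [hr.1] : (0 : ℝ) < r)))
        -- The polar density r³ is at least 1 for r > 1.
        refine le_mul_of_one_le_left' ?_
        rw [← ENNReal.ofReal_one]
        exact ENNReal.ofReal_le_ofReal (one_le_pow₀ hr.1.le)

/-- The Riesz potential of order `3/2` of `|h|`. -/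
def rieszPot (h : R4 → ℝ) (x : R4) : ℝ := ∫ y, ‖y - x‖ ^ (-(5 / 2) : ℝ) * |h y|

theorem exists_integral_rieszPot_le : ∃ C : ℝ, 0 < C ∧ ∀ h : R4 → ℝ, Continuous h →
    HasCompactSupport h → Integrable (fun θ : S3 => rieszPot h θ) sig ∧
      ∫ θ : S3, rieszPot h θ ∂sig ≤ C * ∫ y, |h y| := by
  obtain ⟨C, hC, hle⟩ := exists_lintegral_norm_rpow_le
  refine ⟨C, hC, fun h hh hhc => ?_⟩
  have hint := integrable_norm_rpow_mul (show (5 / 2 : ℝ) < 4 by norm_num) hh hhc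
  have hhi : Integrable fun y => |h y| := (hh.integrable_of_hasCompactSupport hhc).abs
  have hm : Measurable fun p : S3 × R4 => ‖p.2 - (p.1 : R4)‖ ^ (-(5 / 2) : ℝ) * |h p.2| := by
    fun_prop
  have hpm : StronglyMeasurable fun θ : S3 => rieszPot h θ :=
    hm.stronglyMeasurable.integral_prod_right
  have h0 : ∀ x, 0 ≤ rieszPot h x := fun x => integral_nonneg fun y => by positivity
  have hkey : ∫⁻ θ : S3, ENNReal.ofReal (rieszPot h θ) ∂sig ≤
      ENNReal.ofReal (C * ∫ y, |h y|) := by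
    have e1 : ∀ x, ENNReal.ofReal (rieszPot h x) =
        ∫⁻ y, ENNReal.ofReal (‖y - x‖ ^ (-(5 / 2) : ℝ) * |h y|) := fun x =>
      ofReal_integral_eq_lintegral_ofReal (hint x) (.of_forall fun y => by positivity)
    simp only [e1]
    rw [lintegral_lintegral_swap hm.ennreal_ofReal.aemeasurable, ENNReal.ofReal_mul hC.le,
      ofReal_integral_eq_lintegral_ofReal hhi (.of_forall fun y => abs_nonneg _),
      ← lintegral_const_mul' _ _ ENNReal.ofReal_ne_top]
    refine lintegral_mono fun y => ?_
    simp only [ENNReal.ofReal_mul (rpow_nonneg (norm_nonneg _) _)]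
    rw [lintegral_mul_const' _ _ ENNReal.ofReal_ne_top]
    gcongr
    exact hle y
  have hi : Integrable (fun θ : S3 => rieszPot h θ) sig :=
    (lintegral_ofReal_ne_top_iff_integrable hpm.aestronglyMeasurable
      (.of_forall fun θ => h0 _)).1 (ne_top_of_le_ne_top ENNReal.ofReal_ne_top hkey)
  refine ⟨hi, ?_⟩
  rw [← ofReal_integral_eq_lintegral_ofReal hi (.of_forall fun θ => h0 _)] at hkey
  exact (ENNReal.ofReal_le_ofReal_iff (mul_nonneg hC.le (integral_nonneg fun _ =>
    abs_nonneg _))).1 hkey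

/-! ### Pointwise bounds for potentials -/

/-- On bounded distances all kernels are absorbed into the single power d^{-5/2}, whose average over
the unit sphere is bounded uniformly in the pole. -/
theorem add_inv_le_rpow {d M : ℝ} (hd : 0 < d) (hM : 1 ≤ M) (hdM : d ≤ M) :
    d + d⁻¹ ≤ 2 * M ^ (7 / 2 : ℝ) * d ^ (-(5 / 2) : ℝ) := by
  have hM0 : 0 < M := by linarith
  have e1 : d = d ^ (7 / 2 : ℝ) * d ^ (-(5 / 2) : ℝ) := by
    rw [← rpow_add hd]; norm_num
  have e2 : d⁻¹ = d ^ (3 / 2 : ℝ) * d ^ (-(5 / 2) : ℝ) := by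
    rw [← rpow_add hd, ← rpow_neg_one]; norm_num
  have h1 : d ^ (7 / 2 : ℝ) ≤ M ^ (7 / 2 : ℝ) := rpow_le_rpow hd.le hdM (by norm_num)
  have h2 : d ^ (3 / 2 : ℝ) ≤ M ^ (7 / 2 : ℝ) :=
    (rpow_le_rpow hd.le hdM (by norm_num)).trans (rpow_le_rpow_of_exponent_le hM (by norm_num))
  have hp : 0 ≤ d ^ (-(5 / 2) : ℝ) := by positivity
  calc d + d⁻¹ = (d ^ (7 / 2 : ℝ) + d ^ (3 / 2 : ℝ)) * d ^ (-(5 / 2) : ℝ) := by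
        rw [add_mul, ← e1, ← e2]
    _ ≤ _ := by
        refine mul_le_mul_of_nonneg_right ?_ hp
        linarith

/-- The constant comparing the kernels `|x| + |x|⁻¹` and `|x|^{-5/2}` on the ball of radius
`3 L`. -/
def kernelConst (L : ℝ) : ℝ := 2 * (3 * L) ^ (7 / 2 : ℝ)

section Potential

variable {L : ℝ} (hL : 1 ≤ L) {h : R4 → ℝ} (hh : Continuous h) (hhc : HasCompactSupport h)
  (hsupp : ∀ y, h y ≠ 0 → ‖y‖ ≤ 2 * L) {x : R4} (hx : ‖x‖ = 1)

theorem rieszPot_nonneg (h : R4 → ℝ) (x : R4) : 0 ≤ rieszPot h x :=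
  integral_nonneg fun y => by positivity

include hL in
theorem kernelConst_pos : 0 < kernelConst L := by
  have : 0 < L := by linarith
  unfold kernelConst
  positivity

include hL hsupp hx in
theorem norm_add_inv_mul_le {y : R4} (hy : y ≠ x) : (‖y - x‖ + ‖y - x‖⁻¹) * |h y| ≤
    kernelConst L * (‖y - x‖ ^ (-(5 / 2) : ℝ) * |h y|) := by
  by_cases h0 : h y = 0
  · simp [h0]
  have h1 : ‖y - x‖ ≤ 3 * L := by
    have := norm_sub_le y x
    have := hsupp y h0
    linarith
  rw [← mul_assoc]
  exact mul_le_mul_of_nonneg_right (add_inv_le_rpow (norm_pos_iff.2 (sub_ne_zero.2 hy))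
    (by linarith) h1) (abs_nonneg _)

include hL hh hhc hsupp hx

theorem integral_norm_add_inv_mul_le :
    ∫ y, (‖y - x‖ + ‖y - x‖⁻¹) * |h y| ≤ kernelConst L * rieszPot h x := by
  rw [rieszPot, ← integral_const_mul]
  refine integral_mono_ae (integrable_norm_add_inv_mul hh hhc x)
    ((integrable_norm_rpow_mul (by norm_num) hh hhc x).const_mul _) ?_
  filter_upwards [Measure.ae_ne volume x] with y hy
  exact norm_add_inv_mul_le hL hsupp hx hy

theorem integral_inv_mul_le : ∫ y, ‖y - x‖⁻¹ * |h y| ≤ kernelConst L * rieszPot h x := by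
  refine le_trans (integral_mono_of_nonneg (.of_forall fun y => by positivity)
    (integrable_norm_add_inv_mul hh hhc x) (.of_forall fun y => ?_))
    (integral_norm_add_inv_mul_le hL hh hhc hsupp hx)
  exact mul_le_mul_of_nonneg_right (by simp) (abs_nonneg _)

theorem integral_abs_log_mul_le : ∫ y, |log ‖y - x‖| * |h y| ≤ kernelConst L * rieszPot h x := by
  refine le_trans (integral_mono_of_nonneg (.of_forall fun y => by positivity)
    (integrable_norm_add_inv_mul hh hhc x) ?_)
    (integral_norm_add_inv_mul_le hL hh hhc hsupp hx)
  filter_upwards [Measure.ae_ne volume x] with y hy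
  exact mul_le_mul_of_nonneg_right (abs_log_le_add_inv (norm_pos_iff.2 (sub_ne_zero.2 hy)))
    (abs_nonneg _)

/-- An exponential integrability estimate for logarithmic potentials of small mass. -/
theorem exp_mul_integral_log_le {k : ℝ} (hk : 0 ≤ k) (hδ : k * (∫ y, |h y|) ≤ 1) :
    exp (k * ∫ y, |log ‖y - x‖| * |h y|) ≤ 1 + k * (kernelConst L * rieszPot h x) := by
  have hhi : Integrable fun y => |h y| := (hh.integrable_of_hasCompactSupport hhc).abs
  have hdd := integrable_norm_add_inv_mul hh hhc x
  have hlogi : Integrable fun y => |log ‖y - x‖| * |h y| := by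
    have := integrable_mul_of_le_norm_add_inv (K := fun y => |log ‖y - x‖|) (x := x) hh.abs
      hhc.abs (by fun_prop) fun y hy => by
        rw [abs_abs]
        exact abs_log_le_add_inv (norm_pos_iff.2 (sub_ne_zero.2 hy))
    exact this
  set P := ∫ y, |log ‖y - x‖| * |h y|
  set δ := ∫ y, |h y| with hδdef
  have hδ0 : 0 ≤ δ := integral_nonneg fun _ => abs_nonneg _
  have hW := mul_nonneg hk (mul_nonneg (kernelConst_pos hL).le (rieszPot_nonneg h x))
  rcases hδ0.eq_or_lt with h0 | h0
  · have hz : ∀ᵐ y, |h y| = 0 :=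
      (integral_eq_zero_iff_of_nonneg (fun _ => abs_nonneg _) hhi).1 h0.symm
    have hP : P = 0 := by
      refine integral_eq_zero_of_ae ?_
      filter_upwards [hz] with y hy
      simp [hy]
    rw [hP, mul_zero, exp_zero]
    linarith
  -- Jensen's inequality in pointwise form: the tangent to exp at kP lies below exp(kδs), and
  -- convexity on [0, s] with weight kδ ≤ 1 bounds exp(kδs) through e^{|log d|} ≤ d + d⁻¹. Against
  -- |h| the left side integrates to exactly δ e^{kP}.
  have hpt : ∀ᵐ y, exp (k * P) * ((1 - k * P) * |h y| + k * δ * (|log ‖y - x‖| * |h y|)) ≤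
      |h y| + k * δ * ((‖y - x‖ + ‖y - x‖⁻¹) * |h y|) := by
    filter_upwards [Measure.ae_ne volume x] with y hy
    set s := |log ‖y - x‖|
    have hs : 0 ≤ s := abs_nonneg _
    have hd : 0 < ‖y - x‖ := norm_pos_iff.2 (sub_ne_zero.2 hy)
    have h1 : exp (k * P) * (1 - k * P + k * δ * s) ≤ exp (k * δ * s) := by
      have := add_one_le_exp (k * δ * s - k * P)
      calc _ ≤ exp (k * P) * exp (k * δ * s - k * P) := by
            refine mul_le_mul_of_nonneg_left ?_ (exp_pos _).le
            linarith
        _ = _ := by rw [← exp_add]; ring_nf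
    have h2 : exp (k * δ * s) ≤ 1 + k * δ * (‖y - x‖ + ‖y - x‖⁻¹) := by
      have hc := convexOn_exp.2 (mem_univ 0) (mem_univ s) (show 0 ≤ 1 - k * δ by linarith)
        (mul_nonneg hk hδ0) (by ring)
      simp only [smul_eq_mul, mul_zero, zero_add, exp_zero, mul_one] at hc
      have h3 : exp s ≤ ‖y - x‖ + ‖y - x‖⁻¹ := by
        have := inv_pos.2 hd
        rcases abs_cases (log ‖y - x‖) with ⟨he, -⟩ | ⟨he, -⟩
        · simp only [s, he, exp_log hd]
          linarith
        · simp only [s, he, exp_neg, exp_log hd]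
          linarith
      have h4 := mul_le_mul_of_nonneg_left h3 (mul_nonneg hk hδ0)
      have := mul_nonneg hk hδ0
      linarith
    have := mul_le_mul_of_nonneg_right (h1.trans h2) (abs_nonneg (h y))
    calc _ = exp (k * P) * (1 - k * P + k * δ * s) * |h y| := by ring
      _ ≤ _ := this
      _ = _ := by ring
  have hI := integral_mono_ae (((hhi.const_mul (1 - k * P)).add (hlogi.const_mul (k * δ))).const_mul
    (exp (k * P))) (hhi.add (hdd.const_mul (k * δ))) hpt
  simp only [Pi.add_apply] at hI
  rw [integral_const_mul, integral_add (hhi.const_mul _) (hlogi.const_mul _), integral_const_mul,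
    integral_const_mul, integral_add hhi (hdd.const_mul _), integral_const_mul] at hI
  have h5 := integral_norm_add_inv_mul_le hL hh hhc hsupp hx
  have h6 : δ * exp (k * P) ≤ δ * (1 + k * (kernelConst L * rieszPot h x)) := by
    have h7 := mul_le_mul_of_nonneg_left h5 (mul_nonneg hk hδ0)
    change exp (k * P) * ((1 - k * P) * δ + k * δ * P) ≤ _ at hI
    have e : exp (k * P) * ((1 - k * P) * δ + k * δ * P) = δ * exp (k * P) := by ring
    rw [e] at hI
    linarith
  exact le_of_mul_le_mul_left h6 h0

-- With u = |y - x|^{-1/2}, Cauchy–Schwarz bounds the squared potential by δ ∫ u⁴|h|, and u⁴b ≤ u⁵ +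
-- b⁵. The power u⁵ is again the kernel of `rieszPot`, so the weight b is decoupled from it.
omit hL hsupp hx in
theorem sq_integral_inv_mul_le {b : ℝ} (hb : 0 ≤ b) :
    (∫ y, ‖y - x‖⁻¹ * |h y|) ^ 2 * b ≤
      (∫ y, |h y|) * (rieszPot h x + (∫ y, |h y|) * b ^ 5) := by
  have hhi : Integrable fun y => |h y| := (hh.integrable_of_hasCompactSupport hhc).abs
  have h1i : Integrable fun y => ‖y - x‖⁻¹ * |h y| := by
    simpa [rpow_neg_one] using integrable_norm_rpow_mul (show (1 : ℝ) < 4 by norm_num) hh hhc x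
  have h5i := integrable_norm_rpow_mul (show (5 / 2 : ℝ) < 4 by norm_num) hh hhc x
  set P := ∫ y, ‖y - x‖⁻¹ * |h y|
  set δ := ∫ y, |h y| with hδdef
  have hδ0 : 0 ≤ δ := integral_nonneg fun _ => abs_nonneg _
  have hpt : ∀ᵐ y, b * (2 * (P * δ) * (‖y - x‖⁻¹ * |h y|) - P ^ 2 * |h y|) ≤
      δ ^ 2 * (‖y - x‖ ^ (-(5 / 2) : ℝ) * |h y|) + δ ^ 2 * b ^ 5 * |h y| := by
    filter_upwards [Measure.ae_ne volume x] with y hy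
    have hd : 0 < ‖y - x‖ := norm_pos_iff.2 (sub_ne_zero.2 hy)
    set u := ‖y - x‖ ^ (-(1 / 2) : ℝ) with hu
    have hu0 : 0 ≤ u := by positivity
    have e1 : ‖y - x‖⁻¹ = u ^ 2 := by
      rw [hu, ← rpow_natCast, ← rpow_mul hd.le, ← rpow_neg_one]; norm_num
    have e5 : ‖y - x‖ ^ (-(5 / 2) : ℝ) = u ^ 5 := by
      rw [hu, ← rpow_natCast, ← rpow_mul hd.le]; norm_num
    rw [e1, e5]
    have hy : u ^ 4 * b ≤ u ^ 5 + b ^ 5 := by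
      rcases le_total b u with hbu | hbu
      · have : u ^ 4 * b ≤ u ^ 4 * u := by gcongr
        have : 0 ≤ b ^ 5 := by positivity
        nlinarith
      · have : u ^ 4 * b ≤ b ^ 4 * b := by gcongr
        have : 0 ≤ u ^ 5 := by positivity
        nlinarith
    have hq : 2 * (P * δ) * u ^ 2 - P ^ 2 ≤ δ ^ 2 * u ^ 4 := by
      nlinarith [sq_nonneg (δ * u ^ 2 - P)]
    have h1 := mul_le_mul_of_nonneg_right hq hb
    have h2 := mul_le_mul_of_nonneg_left hy (sq_nonneg δ)
    have h3 := mul_le_mul_of_nonneg_right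
      (show (2 * (P * δ) * u ^ 2 - P ^ 2) * b ≤ δ ^ 2 * (u ^ 5 + b ^ 5) by linarith)
      (abs_nonneg (h y))
    calc _ = (2 * (P * δ) * u ^ 2 - P ^ 2) * b * |h y| := by ring
      _ ≤ _ := h3
      _ = _ := by ring
  have hI := integral_mono_ae (((h1i.const_mul (2 * (P * δ))).sub (hhi.const_mul (P ^ 2))).const_mul b)
    ((h5i.const_mul (δ ^ 2)).add (hhi.const_mul (δ ^ 2 * b ^ 5))) hpt
  simp only [Pi.add_apply, Pi.sub_apply] at hI
  rw [integral_const_mul, integral_sub (h1i.const_mul _) (hhi.const_mul _), integral_const_mul,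
    integral_const_mul, integral_add (h5i.const_mul _) (hhi.const_mul _), integral_const_mul,
    integral_const_mul] at hI
  change b * (2 * (P * δ) * P - P ^ 2 * δ) ≤ δ ^ 2 * rieszPot h x + δ ^ 2 * b ^ 5 * δ at hI
  rcases hδ0.eq_or_lt with h0 | h0
  · have hz : ∀ᵐ y, |h y| = 0 :=
      (integral_eq_zero_iff_of_nonneg (fun _ => abs_nonneg _) hhi).1 h0.symm
    have hP : P = 0 := by
      refine integral_eq_zero_of_ae ?_
      filter_upwards [hz] with y hy
      simp [hy]
    rw [hP, ← h0]
    simp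
  · refine le_of_mul_le_mul_left ?_ h0
    nlinarith

end Potential

/-- Averaging the pointwise bound over the sphere identifies the unknown constant `a` with the mean,
up to the averaged Riesz potential. -/
theorem abs_mean_sub_le {C : ℝ} {h : R4 → ℝ}
    (hi : Integrable (fun θ : S3 => rieszPot h θ) sig)
    (hle : ∫ θ : S3, rieszPot h θ ∂sig ≤ C * ∫ y, |h y|) {f : S3 → ℝ} (hf : Continuous f)
    {a c ε M : ℝ} (hc : 0 ≤ c) (hfa : ∀ θ : S3, |f θ - a| ≤ ε + c * rieszPot h θ)
    (hM : ∫ θ, f θ ∂sig = areaS3 * M) :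
    |M - a| ≤ ε + c * C / areaS3 * ∫ y, |h y| := by
  have hA := areaS3_pos
  have h1 : ∫ θ, (f θ - a) ∂sig = areaS3 * (M - a) := by
    rw [integral_sub (integrable_sphere hf) (integrable_const _), hM, integral_sphere_const]
    ring
  have h2 : areaS3 * |M - a| ≤ areaS3 * ε + c * (C * ∫ y, |h y|) := by
    rw [← abs_of_pos hA, ← abs_mul, ← h1, abs_of_pos hA]
    refine abs_integral_le_integral_abs.trans ?_
    have h3 := integral_mono (integrable_sphere (hf.sub continuous_const).abs)
      ((integrable_const ε).add (hi.const_mul c)) hfa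
    simp only [Pi.add_apply] at h3
    rw [integral_add (integrable_const _) (hi.const_mul _), integral_sphere_const,
      integral_const_mul] at h3
    have h4 := mul_le_mul_of_nonneg_left hle hc
    exact h3.trans (by linarith)
  have e : areaS3 * (ε + c * C / areaS3 * ∫ y, |h y|) = areaS3 * ε + c * (C * ∫ y, |h y|) := by
    field_simp
  exact le_of_mul_le_mul_left (h2.trans_eq e.symm) hA

/-- The mass of the bi-Laplacian of `v` on a shell. -/
def shellMass (L : ℝ) (v : R4 → ℝ) : ℝ := ∫ y, |shellCut L y * lap (lap v) y|

/-- The `L¹` norms of `v` on two annuli, one far out and one close to the origin. -/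
def annulusNorm (L : ℝ) (v : R4 → ℝ) : ℝ :=
  (∫ η in annulus, |v (L • η)|) + ∫ η in annulus, |v (L⁻¹ • η)|

theorem shellMass_nonneg (L : ℝ) (v : R4 → ℝ) : 0 ≤ shellMass L v :=
  integral_nonneg fun _ => abs_nonneg _

/-- Exponential and energy estimates on the unit sphere for a function with small bi-Laplacian. -/
theorem exists_sphere_estimates : ∃ C Cb : ℝ, 0 < C ∧ 0 ≤ Cb ∧ ∀ L : ℝ, 16 ≤ L → ∀ v : R4 → ℝ,
    ContDiffOn ℝ ∞ v {0}ᶜ → ∫ θ : S3, v θ ∂sig = 0 → ∀ ε, Cb / L * annulusNorm L v ≤ ε →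
    (∀ k : ℝ, 0 ≤ k → k / bihConst * shellMass L v ≤ 1 →
      ∫ θ : S3, exp (k * v θ) ∂sig ≤
        exp (k / bihConst * (2 * ε + kernelConst L * C / areaS3 * shellMass L v)) *
          (areaS3 + k / bihConst * (kernelConst L * (C * shellMass L v)))) ∧
    ∀ M : ℝ, ∫ θ : S3, euler v θ ∂sig = areaS3 * M →
      bihConst ^ 2 * ∫ θ : S3, (euler v θ - M) ^ 2 * exp (v θ) ∂sig ≤
        2 * (shellMass L v * (C * shellMass L v + shellMass L v * ∫ θ : S3, exp (5 * v θ) ∂sig)) +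
        2 * (2 * ε + kernelConst L * C / areaS3 * shellMass L v) ^ 2 *
          ∫ θ : S3, exp (v θ) ∂sig := by
  obtain ⟨C, hC, hW⟩ := exists_integral_rieszPot_le
  obtain ⟨C1, hC1, hlog⟩ := exists_abs_sub_le_log_potential
  obtain ⟨C2, hC2, heul⟩ := exists_abs_euler_sub_le_potential
  refine ⟨C, C1 + C2, hC, by positivity, fun L hL v hv hv0 ε hε => ?_⟩
  have hL0 : 0 < L := by linarith
  have hL2 : 2 ≤ L := by linarith
  have hL1 : 1 ≤ L := by linarith
  have hc0 := bihConst_pos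
  have hkc := kernelConst_pos hL1
  have hann : 0 ≤ annulusNorm L v := add_nonneg (integral_nonneg fun _ => abs_nonneg _)
    (integral_nonneg fun _ => abs_nonneg _)
  set h : R4 → ℝ := fun y => shellCut L y * lap (lap v) y with hdef
  have hh : Continuous h := continuous_mul_of_tsupport isOpen_punctured
    (contDiff_shellCut L).continuous (tsupport_shellCut_punctured hL2)
    (contDiffOn_lap isOpen_punctured (contDiffOn_lap isOpen_punctured hv)).continuousOn
  have hhc : HasCompactSupport h := (hasCompactSupport_shellCut hL2).mul_right
  have hsupp : ∀ y, h y ≠ 0 → ‖y‖ ≤ 2 * L := fun y hy =>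
    (shellCut_mem hL2 (left_ne_zero_of_mul hy)).2
  obtain ⟨hWi, hWle⟩ := hW h hh hhc
  have hvc : Continuous fun θ : S3 => v θ :=
    hv.continuousOn.comp_continuous continuous_subtype_val S3_ne_zero
  have hec : Continuous fun θ : S3 => euler v θ :=
    (contDiffOn_euler isOpen_punctured hv).continuousOn.comp_continuous continuous_subtype_val
      S3_ne_zero
  have hε1 : C1 / L * annulusNorm L v ≤ ε := hε.trans' (by gcongr; linarith)
  have hε2 : C2 / L * annulusNorm L v ≤ ε := hε.trans' (by gcongr; linarith)
  obtain ⟨a, ha⟩ := hlog L hL v hv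
  obtain ⟨a', ha'⟩ := heul L hL v hv
  set δ := shellMass L v with hδ
  have hδ' : ∫ y, |h y| = δ := rfl
  have hδ0 : 0 ≤ δ := shellMass_nonneg L v
  -- One ε comes from comparing the function with the unknown constant, the other from comparing
  -- that constant with the mean.
  set D := 2 * ε + kernelConst L * C / areaS3 * δ with hD
  have hP : ∀ θ : S3, ∫ y, |log ‖y - (θ : R4)‖| * |h y| ≤ kernelConst L * rieszPot h (θ : R4) := fun θ =>
    integral_abs_log_mul_le hL1 hh hhc hsupp (norm_S3 θ)
  have hP' : ∀ θ : S3, ∫ y, ‖y - (θ : R4)‖⁻¹ * |h y| ≤ kernelConst L * rieszPot h (θ : R4) := fun θ =>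
    integral_inv_mul_le hL1 hh hhc hsupp (norm_S3 θ)
  have ha1 : ∀ θ : S3, |bihConst * v θ - a| ≤ (∫ y, |log ‖y - (θ : R4)‖| * |h y|) + ε := fun θ =>
    (ha θ (norm_S3 θ)).trans (add_le_add_right hε1 _)
  have ha1' : ∀ θ : S3, |bihConst * euler v θ - a'| ≤ (∫ y, ‖y - (θ : R4)‖⁻¹ * |h y|) + ε := fun θ =>
    (ha' θ (norm_S3 θ)).trans (add_le_add_right hε2 _)
  constructor
  · intro k hk hkδ
    have hk' : 0 ≤ k / bihConst := by positivity
    have ham := abs_mean_sub_le hWi hWle (f := fun θ : S3 => bihConst * v θ)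
      (continuous_const.mul hvc) (a := a) (ε := ε) (M := 0) hkc.le
      (fun θ => (ha1 θ).trans (by linarith [hP θ]))
      (by rw [integral_const_mul, hv0, mul_zero, mul_zero])
    rw [hδ', abs_le] at ham
    have hpt : ∀ θ : S3, exp (k * v θ) ≤
        exp (k / bihConst * D) * (1 + k / bihConst * (kernelConst L * rieszPot h (θ : R4))) := fun θ => by
      have h1 := exp_mul_integral_log_le hL1 hh hhc hsupp (norm_S3 θ) hk' hkδ
      refine le_trans ?_ (mul_le_mul_of_nonneg_left h1 (exp_pos _).le)
      rw [← exp_add]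
      refine exp_le_exp.2 ?_
      have h2 := (abs_le.1 (ha1 θ)).2
      have h3 : bihConst * v θ ≤ D + ∫ y, |log ‖y - (θ : R4)‖| * |h y| := by linarith [ham.1]
      calc k * v θ = k / bihConst * (bihConst * v θ) := by field_simp
        _ ≤ k / bihConst * (D + ∫ y, |log ‖y - (θ : R4)‖| * |h y|) := by gcongr
        _ = _ := by ring
    have hWc := (hWi.const_mul (kernelConst L)).const_mul (k / bihConst)
    have hI := integral_mono (integrable_sphere (continuous_const.mul hvc).rexp)
      (((integrable_const 1).add hWc).const_mul (exp (k / bihConst * D))) hpt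
    simp only [Pi.add_apply] at hI
    rw [integral_const_mul, integral_add (integrable_const _) hWc, integral_sphere_const, mul_one,
      integral_const_mul, integral_const_mul] at hI
    refine hI.trans ?_
    gcongr
    exact hWle
  · intro M hM
    have ham := abs_mean_sub_le hWi hWle (f := fun θ : S3 => bihConst * euler v θ)
      (continuous_const.mul hec) (a := a') (ε := ε) (M := bihConst * M) hkc.le
      (fun θ => (ha1' θ).trans (by linarith [hP' θ]))
      (by rw [integral_const_mul, hM]; ring)
    rw [hδ', abs_le] at ham
    have hpt : ∀ θ : S3, bihConst ^ 2 * ((euler v θ - M) ^ 2 * exp (v θ)) ≤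
        2 * (δ * (rieszPot h (θ : R4) + δ * exp (5 * v θ))) + 2 * D ^ 2 * exp (v θ) := fun θ => by
      set P := ∫ y, ‖y - (θ : R4)‖⁻¹ * |h y|
      have hP0 : 0 ≤ P := integral_nonneg fun y => by positivity
      -- The weight b is e^{v}, so b⁵ becomes the fifth exponential moment.
      have h1 := sq_integral_inv_mul_le hh hhc (x := θ) (exp_pos (v θ)).le
      rw [hδ', ← exp_nat_mul] at h1
      push_cast at h1
      have h2 := abs_le.1 (ha1' θ)
      have h3 : (bihConst * (euler v θ - M)) ^ 2 ≤ (P + D) ^ 2 :=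
        sq_le_sq' (by linarith [ham.1, ham.2, h2.1]) (by linarith [ham.1, ham.2, h2.2])
      have h4 : (P + D) ^ 2 ≤ 2 * P ^ 2 + 2 * D ^ 2 := by nlinarith [sq_nonneg (P - D)]
      have h5 := mul_le_mul_of_nonneg_right (h3.trans h4) (exp_pos (v θ)).le
      calc _ = (bihConst * (euler v θ - M)) ^ 2 * exp (v θ) := by ring
        _ ≤ _ := h5
        _ = 2 * (P ^ 2 * exp (v θ)) + 2 * D ^ 2 * exp (v θ) := by ring
        _ ≤ _ := by linarith
    have hi5 : Integrable (fun θ : S3 => δ * exp (5 * v θ)) sig :=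
      integrable_sphere (continuous_const.mul (continuous_const.mul hvc).rexp)
    have hi1 : Integrable (fun θ : S3 => 2 * D ^ 2 * exp (v θ)) sig :=
      integrable_sphere (continuous_const.mul hvc.rexp)
    have hi2 : Integrable (fun θ : S3 => bihConst ^ 2 * ((euler v θ - M) ^ 2 * exp (v θ))) sig :=
      integrable_sphere (continuous_const.mul (((hec.sub continuous_const).pow 2).mul hvc.rexp))
    have hi3 : Integrable (fun θ : S3 => 2 * (δ * (rieszPot h (θ : R4) + δ * exp (5 * v θ)))) sig :=
      ((hWi.add hi5).const_mul δ).const_mul 2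
    have hI := integral_mono hi2 (hi3.add hi1) hpt
    simp only [Pi.add_apply] at hI
    rw [integral_const_mul, integral_add hi3 hi1,
      integral_const_mul, integral_const_mul, integral_add hWi hi5, integral_const_mul,
      integral_const_mul] at hI
    refine hI.trans ?_
    gcongr
    exact hWle

/-! ### Asymptotics on large and small spheres -/

/-- The mean of `w` over the sphere of radius `e^t`. -/
def sphMean (w : R4 → ℝ) (t : ℝ) : ℝ := sphInt w t / areaS3

/-- The rescaled function `w (e^t x)`, normalized to have mean zero on the unit sphere. -/
def rescaled (w : R4 → ℝ) (t : ℝ) (x : R4) : ℝ := w (exp t • x) - sphMean w t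

/-! ### Dilation to the unit sphere. -/

section Rescaling

variable {w : R4 → ℝ}

theorem euler_rescaled (t : ℝ) (x : R4) :
    euler (rescaled w t) x = euler w (exp t • x) := by
  have h : fderiv ℝ (rescaled w t) x = fderiv ℝ (fun y => w (exp t • y)) x := fderiv_sub_const _
  rw [euler, euler, h, fderiv_comp_smul]
  simp

theorem lap_lap_rescaled (t : ℝ) (x : R4) :
    lap (lap (rescaled w t)) x = exp t ^ 4 * lap (lap w) (exp t • x) := by
  have h : lap (rescaled w t) = lap fun y => w (exp t • y) := by
    have h1 : ∀ i, pd i (rescaled w t) = pd i fun y => w (exp t • y) := fun i => by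
      funext y
      have h2 : fderiv ℝ (rescaled w t) y = fderiv ℝ (fun y => w (exp t • y)) y :=
        fderiv_sub_const _
      exact congrArg (· (eb i)) h2
    funext y
    simp only [lap, h1]
  rw [h, lap_lap_comp_smul]

/-- The mass of Δ²w is dilation invariant in dimension four, so only the cutoff moves. -/
theorem shellMass_rescaled (L t : ℝ) :
    shellMass L (rescaled w t) = ∫ y, |shellCut L ((exp t)⁻¹ • y) * lap (lap w) y| := by
  have h := Measure.integral_comp_smul (volume : Measure R4)
    (fun y => |shellCut L ((exp t)⁻¹ • y) * lap (lap w) y|) (exp t)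
  have he := exp_pos t
  rw [finrank_R4, abs_of_pos (by positivity), smul_eq_mul] at h
  have h2 : ∀ y, |shellCut L y * lap (lap (rescaled w t)) y| =
      exp t ^ 4 * |shellCut L ((exp t)⁻¹ • exp t • y) * lap (lap w) (exp t • y)| := fun y => by
    rw [lap_lap_rescaled, smul_smul, inv_mul_cancel₀ he.ne', one_smul]
    simp only [abs_mul, abs_of_pos (pow_pos he 4)]
    ring
  rw [shellMass]
  simp only [h2]
  rw [integral_const_mul, h, ← mul_assoc, mul_inv_cancel₀ (by positivity), one_mul]

variable (hw : ContDiffOn ℝ ∞ w {0}ᶜ)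
include hw

theorem contDiffOn_rescaled (t : ℝ) : ContDiffOn ℝ ∞ (rescaled w t) {0}ᶜ :=
  (contDiffOn_comp_smul hw (exp_pos t).ne').sub contDiffOn_const

theorem integral_rescaled (t : ℝ) : ∫ θ : S3, rescaled w t θ ∂sig = 0 := by
  have hA := areaS3_pos.ne'
  simp only [rescaled]
  rw [integral_sub (integrable_slice hw.continuousOn t) (integrable_const _),
    integral_sphere_const, sphMean, mul_div_cancel₀ _ hA, sphInt, sub_self]

-- The moving shell eventually leaves every point other than the origin, and Δ²w is integrable:
-- dominated convergence.
omit hw in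
theorem tendsto_shellMass (hB : Integrable (lap (lap w))) {L : ℝ} (hL : 2 ≤ L) {l : Filter ℝ}
    (hl : l = atTop ∨ l = atBot) : Tendsto (fun t => shellMass L (rescaled w t)) l (𝓝 0) := by
  have hL0 : 0 < L := by linarith
  have hcg : l.IsCountablyGenerated := by rcases hl with rfl | rfl <;> infer_instance
  simp only [shellMass_rescaled]
  rw [← integral_zero R4 ℝ (μ := volume)]
  refine tendsto_integral_filter_of_dominated_convergence (fun y => |lap (lap w) y|)
    (.of_forall fun t => ?_) (.of_forall fun t => .of_forall fun y => ?_) hB.abs ?_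
  · exact (((contDiff_shellCut L).continuous.comp
      (continuous_const_smul _)).aestronglyMeasurable.mul hB.aestronglyMeasurable).norm
  · rw [norm_abs_eq_norm, norm_mul]
    exact mul_le_of_le_one_left (abs_nonneg _) (abs_shellCut_le_one _ _)
  · filter_upwards [Measure.ae_ne volume (0 : R4)] with y hy
    have hn := norm_pos_iff.2 hy
    refine tendsto_const_nhds.congr' ?_
    have hz : ∀ᶠ t in l, shellCut L ((exp t)⁻¹ • y) = 0 := by
      have hnorm : ∀ t : ℝ, ‖(exp t)⁻¹ • y‖ = exp (-t) * ‖y‖ := fun t => by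
        rw [← exp_neg, norm_smul, norm_of_nonneg (exp_pos _).le]
      rcases hl with rfl | rfl
      · have h1 : Tendsto (fun t : ℝ => exp (-t) * ‖y‖) atTop (𝓝 (0 * ‖y‖)) :=
          (tendsto_exp_neg_atTop_nhds_zero).mul_const _
        rw [zero_mul] at h1
        filter_upwards [h1.eventually_le_const (inv_pos.2 hL0)] with t ht
        exact shellCut_eq_zero_of_le hL ((hnorm t).trans_le ht)
      · have h1 : Tendsto (fun t : ℝ => exp (-t) * ‖y‖) atBot atTop :=
          (tendsto_exp_atTop.comp tendsto_neg_atBot_atTop).atTop_mul_const hn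
        filter_upwards [h1.eventually_ge_atTop (2 * L)] with t ht
        exact shellCut_eq_zero_of_ge hL (ht.trans_eq (hnorm t).symm)
    filter_upwards [hz] with t ht
    rw [ht, zero_mul, abs_zero]

theorem abs_sphMean_sub_le {Mq : ℝ} (hMq : ∀ t, |sphInt (euler w) t / areaS3| ≤ Mq) (s t : ℝ) :
    |sphMean w s - sphMean w t| ≤ Mq * |s - t| := by
  have hd : ∀ x ∈ univ, HasDerivWithinAt (sphMean w) (sphInt (euler w) x / areaS3) univ x :=
    fun x _ => ((hasDerivAt_sphInt hw x).div_const _).hasDerivWithinAt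
  exact convex_univ.norm_image_sub_le_of_norm_hasDerivWithin_le hd (fun x _ => hMq x)
    (mem_univ t) (mem_univ s)

/-- On each sphere of the dilated annulus, split into the oscillation, at most C0 in L¹, and the
drift of the mean, at most Mq(|a| + 2), since |log r| ≤ 2 on [1/2, 3]. The factor 81 is 27 for r³
times 3 for the length of the interval. -/
theorem integral_annulus_rescaled_le {Mq C0 : ℝ} (hMq : ∀ t, |sphInt (euler w) t / areaS3| ≤ Mq)
    (hC0 : ∀ t, ∫ θ : S3, |w (exp t • (θ : R4)) - sphInt w t / areaS3| ∂sig ≤ C0) (t a : ℝ) :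
    ∫ η in annulus, |rescaled w t (exp a • η)| ≤ 81 * (C0 + areaS3 * (Mq * (|a| + 2))) := by
  have hMq0 : 0 ≤ Mq := (abs_nonneg _).trans (hMq 0)
  have hC00 : 0 ≤ C0 := (integral_nonneg fun _ => abs_nonneg _).trans (hC0 0)
  have hA := areaS3_pos
  have hv := contDiffOn_comp_smul (contDiffOn_rescaled hw t) (exp_pos a).ne'
  have hsl : ∀ r ∈ Icc (1 / 2 : ℝ) 3, ∫ θ : S3, |rescaled w t (exp a • r • (θ : R4))| ∂sig ≤
      C0 + areaS3 * (Mq * (|a| + 2)) := by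
    intro r hr
    have hr0 : 0 < r := by linarith [hr.1]
    set s := t + (a + log r) with hs
    have e : ∀ θ : S3, rescaled w t (exp a • r • (θ : R4)) =
        (w (exp s • (θ : R4)) - sphMean w s) + (sphMean w s - sphMean w t) := fun θ => by
      rw [rescaled, smul_smul, smul_smul, hs, exp_add, exp_add, exp_log hr0, mul_assoc]
      ring
    have hlr : |log r| ≤ 2 := by
      have h1 := log_le_sub_one_of_pos hr0
      have h2 := log_le_sub_one_of_pos (inv_pos.2 hr0)
      have h3 : r⁻¹ ≤ 2 := by
        rw [inv_le_comm₀ hr0 (by norm_num)]; norm_num at hr ⊢; exact hr.1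
      rw [log_inv] at h2
      rw [abs_le]
      constructor <;> linarith [hr.2]
    have hms : |sphMean w s - sphMean w t| ≤ Mq * (|a| + 2) := by
      refine (abs_sphMean_sub_le hw hMq s t).trans ?_
      gcongr
      rw [hs, add_sub_cancel_left]
      exact (abs_add_le _ _).trans (by linarith)
    have hci : Integrable (fun θ : S3 => |w (exp s • (θ : R4)) - sphMean w s|) sig :=
      ((integrable_slice hw.continuousOn s).sub (integrable_const _)).abs
    calc _ ≤ ∫ θ : S3, (|w (exp s • (θ : R4)) - sphMean w s| + Mq * (|a| + 2)) ∂sig := by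
          refine integral_mono_of_nonneg (.of_forall fun θ => abs_nonneg _)
            (hci.add (integrable_const _)) (.of_forall fun θ => ?_)
          simp only [e]
          exact (abs_add_le _ _).trans (by linarith)
      _ = (∫ θ : S3, |w (exp s • (θ : R4)) - sphMean w s| ∂sig) + areaS3 * (Mq * (|a| + 2)) := by
          rw [integral_add hci (integrable_const _), integral_sphere_const]
      _ ≤ _ := by linarith [hC0 s, show (∫ θ : S3, |w (exp s • (θ : R4)) - sphMean w s| ∂sig) =
          ∫ θ : S3, |w (exp s • (θ : R4)) - sphInt w s / areaS3| ∂sig from rfl]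
  set B := C0 + areaS3 * (Mq * (|a| + 2)) with hB
  have hB0 : 0 ≤ B := by positivity
  have hint : Integrable (annulus.indicator fun η => |rescaled w t (exp a • η)|) :=
    (integrable_indicator_iff isClosed_annulus.measurableSet).2
      ((hv.continuousOn.mono annulus_subset).abs.integrableOn_compact isCompact_annulus)
  rw [← integral_indicator isClosed_annulus.measurableSet, integral_polar hint]
  have hmem : ∀ r : ℝ, 0 < r → ∀ θ : S3, (r • (θ : R4) ∈ annulus ↔ r ∈ Icc (1 / 2 : ℝ) 3) :=
    fun r hr θ => by
      simp only [annulus, mem_ofPred_eq, norm_smul, norm_S3, mul_one, norm_of_nonneg hr.le, mem_Icc]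
  have hcst : IntegrableOn ((Icc (1 / 2 : ℝ) 3).indicator fun _ => 27 * B) (Ioi 0) :=
    ((integrable_indicator_iff measurableSet_Icc).2
      (continuousOn_const.integrableOn_compact isCompact_Icc)).integrableOn
  refine (setIntegral_mono_on (integrable_polar hint) hcst measurableSet_Ioi fun r hr => ?_).trans ?_
  · by_cases hri : r ∈ Icc (1 / 2 : ℝ) 3
    · have h1 : ∀ θ : S3, annulus.indicator (fun η => |rescaled w t (exp a • η)|) (r • (θ : R4)) =
          |rescaled w t (exp a • r • (θ : R4))| := fun θ =>
        indicator_of_mem ((hmem r hr θ).2 hri) _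
      simp only [h1]
      rw [indicator_of_mem hri]
      have h2 : r ^ 3 ≤ 27 := by
        calc r ^ 3 ≤ 3 ^ 3 := pow_le_pow_left₀ (le_of_lt hr) hri.2 3
          _ = 27 := by norm_num
      exact mul_le_mul h2 (hsl r hri) (integral_nonneg fun _ => abs_nonneg _) (by norm_num)
    · have h1 : ∀ θ : S3, annulus.indicator (fun η => |rescaled w t (exp a • η)|) (r • (θ : R4)) =
          0 := fun θ => indicator_of_notMem (fun h => hri ((hmem r hr θ).1 h)) _
      simp only [h1]
      rw [indicator_of_notMem hri]
      simp
  · rw [setIntegral_indicator measurableSet_Icc, setIntegral_const, smul_eq_mul]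
    have h1 : volume.real (Ioi (0 : ℝ) ∩ Icc (1 / 2) 3) ≤ 3 := by
      refine (measureReal_mono inter_subset_right (by simp)).trans ?_
      rw [Real.volume_real_Icc]
      norm_num
    nlinarith [mul_le_mul_of_nonneg_right h1 (show 0 ≤ 27 * B by positivity)]

theorem annulusNorm_rescaled_le {Mq C0 : ℝ} (hMq : ∀ t, |sphInt (euler w) t / areaS3| ≤ Mq)
    (hC0 : ∀ t, ∫ θ : S3, |w (exp t • (θ : R4)) - sphInt w t / areaS3| ∂sig ≤ C0) (t : ℝ) {L : ℝ}
    (hL : 1 ≤ L) :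
    annulusNorm L (rescaled w t) ≤ 162 * (C0 + areaS3 * (Mq * (log L + 2))) := by
  have h0 : 0 < L := by linarith
  have h1 := integral_annulus_rescaled_le hw hMq hC0 t (log L)
  have h2 := integral_annulus_rescaled_le hw hMq hC0 t (-log L)
  rw [abs_neg] at h2
  rw [exp_neg] at h2
  rw [exp_log h0, abs_of_nonneg (log_nonneg hL)] at h1 h2
  rw [annulusNorm]
  linarith

end Rescaling

theorem exists_abs_le_of_tendsto {f : ℝ → ℝ} (hf : Continuous f) {a b : ℝ}
    (ha : Tendsto f atBot (𝓝 a)) (hb : Tendsto f atTop (𝓝 b)) : ∃ C, ∀ t, |f t| ≤ C := by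
  obtain ⟨T₁, hT₁⟩ := eventually_atBot.1 (ha.abs.eventually_le_const (lt_add_one |a|))
  obtain ⟨T₂, hT₂⟩ := eventually_atTop.1 (hb.abs.eventually_le_const (lt_add_one |b|))
  obtain ⟨C, hC⟩ := (isCompact_Icc (a := T₁) (b := T₂)).exists_bound_of_continuousOn hf.continuousOn
  refine ⟨max (|a| + 1) (max (|b| + 1) C), fun t => ?_⟩
  rcases le_total t T₁ with h1 | h1
  · exact (hT₁ t h1).trans (le_max_left _ _)
  rcases le_total T₂ t with h2 | h2
  · exact (hT₂ t h2).trans ((le_max_left _ _).trans (le_max_right _ _))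
  · exact (hC t ⟨h1, h2⟩).trans ((le_max_right _ _).trans (le_max_right _ _))

theorem tendsto_log_div (c a b : ℝ) :
    Tendsto (fun L : ℝ => c / L * (a + b * (log L + 2))) atTop (𝓝 0) := by
  have h1 : Tendsto (fun L : ℝ => L⁻¹) atTop (𝓝 0) := tendsto_inv_atTop_zero
  have h2 : Tendsto (fun L : ℝ => log L / L) atTop (𝓝 0) := by
    have := Real.isLittleO_log_id_atTop.tendsto_div_nhds_zero
    exact this
  have h3 := (h1.const_mul (c * (a + 2 * b))).add (h2.const_mul (c * b))
  rw [mul_zero, mul_zero, add_zero] at h3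
  refine h3.congr fun L => ?_
  ring

/-! ### Vanishing of the oscillation at both ends. -/

section RescaledLimits

variable {w : R4 → ℝ} (hw : ContDiffOn ℝ ∞ w {0}ᶜ)
include hw

theorem continuous_rescaled_sphere (t : ℝ) :
    Continuous fun θ : S3 => rescaled w t θ :=
  (contDiffOn_rescaled hw t).continuousOn.comp_continuous continuous_subtype_val S3_ne_zero

/-- Jensen's inequality: e^x ≥ 1 + x and the rescaled function has mean zero. -/
theorem le_integral_exp_rescaled (k t : ℝ) :
    areaS3 ≤ ∫ θ : S3, exp (k * rescaled w t θ) ∂sig := by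
  have hc : Continuous fun θ : S3 => k * rescaled w t θ :=
    continuous_const.mul (continuous_rescaled_sphere hw t)
  have h := integral_mono ((integrable_sphere hc).add (integrable_const 1))
    (integrable_sphere hc.rexp) fun θ => add_one_le_exp _
  simp only [Pi.add_apply] at h
  rwa [integral_add (integrable_sphere hc) (integrable_const _), integral_const_mul,
    integral_rescaled hw, mul_zero, zero_add, integral_sphere_const, mul_one] at h

variable {Mq C0 : ℝ} (hMq : ∀ t, |sphInt (euler w) t / areaS3| ≤ Mq)
  (hC0 : ∀ t, ∫ θ : S3, |w (exp t • (θ : R4)) - sphInt w t / areaS3| ∂sig ≤ C0)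
include hMq hC0

/-- The norms on the two annuli grow only like log L, whereas the cutoff error carries the factor
1/L. Hence L can be chosen from ε alone, before t. -/
theorem exists_rescaled_estimates : ∃ C : ℝ, 0 < C ∧ ∀ ε : ℝ, 0 < ε → ∃ L : ℝ, 16 ≤ L ∧ ∀ t : ℝ,
    (∀ k : ℝ, 0 ≤ k → k / bihConst * shellMass L (rescaled w t) ≤ 1 →
      ∫ θ : S3, exp (k * rescaled w t θ) ∂sig ≤
        exp (k / bihConst * (2 * ε + kernelConst L * C / areaS3 * shellMass L (rescaled w t))) *
          (areaS3 + k / bihConst * (kernelConst L * (C * shellMass L (rescaled w t))))) ∧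
    bihConst ^ 2 * ∫ θ : S3, (euler w (exp t • (θ : R4)) - sphInt (euler w) t / areaS3) ^ 2 *
        exp (rescaled w t θ) ∂sig ≤
      2 * (shellMass L (rescaled w t) * (C * shellMass L (rescaled w t) +
        shellMass L (rescaled w t) * ∫ θ : S3, exp (5 * rescaled w t θ) ∂sig)) +
      2 * (2 * ε + kernelConst L * C / areaS3 * shellMass L (rescaled w t)) ^ 2 *
        ∫ θ : S3, exp (rescaled w t θ) ∂sig := by
  obtain ⟨C, Cb, hC, hCb, hmain⟩ := exists_sphere_estimates
  refine ⟨C, hC, fun ε hε => ?_⟩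
  have hlim := tendsto_log_div (Cb * 162) (C0) (areaS3 * Mq)
  obtain ⟨L, hL1, hL⟩ := ((hlim.eventually_le_const hε).and (eventually_ge_atTop 16)).exists
  refine ⟨L, hL, fun t => ?_⟩
  have hL0 : 0 < L := by linarith
  have hann := annulusNorm_rescaled_le hw hMq hC0 t (by linarith : 1 ≤ L)
  have hε' : Cb / L * annulusNorm L (rescaled w t) ≤ ε := by
    refine le_trans (mul_le_mul_of_nonneg_left hann (by positivity)) (le_trans (le_of_eq ?_) hL1)
    ring
  obtain ⟨h1, h2⟩ := hmain L hL _ (contDiffOn_rescaled hw t) (integral_rescaled hw t) ε hε'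
  refine ⟨h1, ?_⟩
  have h3 := h2 (sphInt (euler w) t / areaS3) (by
    rw [mul_div_cancel₀ _ areaS3_pos.ne']
    simp only [euler_rescaled]
    rfl)
  simpa only [euler_rescaled] using h3

variable (hB : Integrable (lap (lap w))) {l : Filter ℝ} (hl : l = atTop ∨ l = atBot)
include hB hl

/-- The lower bound is Jensen's inequality. For the upper bound ε is fixed first and L after it;
then the shell mass tends to 0 along the filter. -/
theorem tendsto_integral_exp_rescaled {k : ℝ} (hk : 0 ≤ k) :
    Tendsto (fun t => ∫ θ : S3, exp (k * rescaled w t θ) ∂sig) l (𝓝 areaS3) := by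
  obtain ⟨C, hC, hmain⟩ := exists_rescaled_estimates hw hMq hC0
  refine tendsto_order.2 ⟨fun a ha => .of_forall fun t =>
    ha.trans_le (le_integral_exp_rescaled hw k t), fun a ha => ?_⟩
  have hA := areaS3_pos
  have hε : ∃ ε : ℝ, 0 < ε ∧ exp (k / bihConst * (2 * ε)) * areaS3 < a := by
    have hc : Tendsto (fun ε : ℝ => exp (k / bihConst * (2 * ε)) * areaS3) (𝓝[>] 0)
        (𝓝 (exp (k / bihConst * (2 * 0)) * areaS3)) :=
      (Continuous.tendsto (by fun_prop) 0).mono_left nhdsWithin_le_nhds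
    rw [mul_zero, mul_zero, exp_zero, one_mul] at hc
    obtain ⟨ε, h1, h2⟩ := ((hc.eventually_lt_const ha).and self_mem_nhdsWithin).exists
    exact ⟨ε, h2, h1⟩
  obtain ⟨ε, hε0, hε⟩ := hε
  obtain ⟨L, hL, hest⟩ := hmain ε hε0
  have hδ := tendsto_shellMass hB (by linarith : 2 ≤ L) hl
  have h1 : Tendsto (fun t => k / bihConst * shellMass L (rescaled w t)) l (𝓝 0) := by
    simpa using hδ.const_mul (k / bihConst)
  have h2 : Tendsto (fun t =>
      exp (k / bihConst * (2 * ε + kernelConst L * C / areaS3 * shellMass L (rescaled w t))) *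
          (areaS3 + k / bihConst * (kernelConst L * (C * shellMass L (rescaled w t))))) l
      (𝓝 (exp (k / bihConst * (2 * ε + kernelConst L * C / areaS3 * 0)) *
          (areaS3 + k / bihConst * (kernelConst L * (C * 0))))) := by
    have hcont : Continuous fun δ : ℝ =>
        exp (k / bihConst * (2 * ε + kernelConst L * C / areaS3 * δ)) *
          (areaS3 + k / bihConst * (kernelConst L * (C * δ))) := by fun_prop
    exact (hcont.tendsto 0).comp hδ
  simp only [mul_zero, add_zero] at h2
  filter_upwards [h1.eventually_le_const one_pos, h2.eventually_lt_const hε] with t ht1 ht2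
  exact ((hest t).1 k hk ht1).trans_lt ht2

/-- The first and fifth exponential moments converge, so every term other than the one with ε²
carries a vanishing shell mass. -/
theorem tendsto_integral_sq_mul_exp_rescaled :
    Tendsto (fun t => ∫ θ : S3, (euler w (exp t • (θ : R4)) - sphInt (euler w) t / areaS3) ^ 2 *
        exp (rescaled w t θ) ∂sig) l (𝓝 0) := by
  obtain ⟨C, hC, hmain⟩ := exists_rescaled_estimates hw hMq hC0
  have h5 := tendsto_integral_exp_rescaled hw hMq hC0 hB hl (show (0 : ℝ) ≤ 5 by norm_num)
  have h1 := tendsto_integral_exp_rescaled hw hMq hC0 hB hl (show (0 : ℝ) ≤ 1 by norm_num)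
  simp only [one_mul] at h1
  have hA := areaS3_pos
  have hc0 := bihConst_pos
  refine tendsto_order.2 ⟨fun a ha => .of_forall fun t =>
    ha.trans_le (integral_nonneg fun θ => by positivity), fun a ha => ?_⟩
  have hε : ∃ ε : ℝ, 0 < ε ∧ 2 * (2 * ε) ^ 2 * areaS3 < bihConst ^ 2 * a := by
    have hc : Tendsto (fun ε : ℝ => 2 * (2 * ε) ^ 2 * areaS3) (𝓝[>] 0)
        (𝓝 (2 * (2 * 0) ^ 2 * areaS3)) :=
      (Continuous.tendsto (by fun_prop) 0).mono_left nhdsWithin_le_nhds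
    have e : (2 * (2 * 0) ^ 2 * areaS3 : ℝ) = 0 := by ring
    rw [e] at hc
    obtain ⟨ε, h1, h2⟩ := ((hc.eventually_lt_const (by positivity :
      0 < bihConst ^ 2 * a)).and self_mem_nhdsWithin).exists
    exact ⟨ε, h2, h1⟩
  obtain ⟨ε, hε0, hε⟩ := hε
  obtain ⟨L, hL, hest⟩ := hmain ε hε0
  have hδ := tendsto_shellMass hB (by linarith : 2 ≤ L) hl
  have h2 := ((hδ.mul ((hδ.const_mul C).add (hδ.mul h5))).const_mul 2).add
    ((((hδ.const_mul (kernelConst L * C / areaS3)).const_add (2 * ε)).pow 2).const_mul 2 |>.mul h1)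
  simp only [mul_zero, zero_mul, add_zero, zero_add] at h2
  filter_upwards [h2.eventually_lt_const hε] with t ht
  exact lt_of_mul_lt_mul_left ((hest t).2.trans_lt ht) (by positivity)

end RescaledLimits

/-! ### Mixed volumes of round spheres -/

theorem integral_sphereMeasure {r : ℝ} (hr : 0 < r) (f : R4 → ℝ) :
    ∫ x, f x ∂(sphereMeasure r) = r ^ 3 * ∫ θ : S3, f (r • (θ : R4)) ∂sig := by
  have hemb : Topology.IsClosedEmbedding fun θ : S3 => r • (θ : R4) :=
    (Homeomorph.smulOfNeZero r hr.ne').isClosedEmbedding.comp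
      Metric.isClosed_sphere.isClosedEmbedding_subtypeVal
  rw [sphereMeasure, integral_smul_measure, hemb.measurableEmbedding.integral_map,
    ENNReal.toReal_ofReal (by positivity), smul_eq_mul]

theorem sq_integral_mul_le {f g : S3 → ℝ} (hf : Continuous f) (hg : Continuous g) :
    (∫ θ, f θ * g θ ∂sig) ^ 2 ≤ (∫ θ, f θ ^ 2 ∂sig) * ∫ θ, g θ ^ 2 ∂sig := by
  have h : ∀ x : ℝ, 0 ≤ (∫ θ, f θ ^ 2 ∂sig) * (x * x) + (2 * ∫ θ, f θ * g θ ∂sig) * x +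
      ∫ θ, g θ ^ 2 ∂sig := fun x => by
    have h1 : 0 ≤ ∫ θ, (x * f θ + g θ) ^ 2 ∂sig := integral_nonneg fun θ => sq_nonneg _
    have h2 : ∀ θ, (x * f θ + g θ) ^ 2 = x * x * f θ ^ 2 + 2 * x * (f θ * g θ) + g θ ^ 2 :=
      fun θ => by ring
    simp only [h2] at h1
    have i1 : Integrable (fun θ => x * x * f θ ^ 2) sig :=
      integrable_sphere (continuous_const.mul (hf.pow 2))
    have i2 : Integrable (fun θ => 2 * x * (f θ * g θ)) sig :=
      integrable_sphere (continuous_const.mul (hf.mul hg))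
    have i3 : Integrable (fun θ => x * x * f θ ^ 2 + 2 * x * (f θ * g θ)) sig := i1.add i2
    have i4 : Integrable (fun θ => g θ ^ 2) sig := integrable_sphere (hg.pow 2)
    rw [integral_add i3 i4, integral_add i1 i2, integral_const_mul,
      integral_const_mul] at h1
    linarith
  have := discrim_le_zero h
  rw [discrim] at this
  nlinarith

/-- The logarithm of the conformal radius: the mean of `w` plus `t`. -/
def logRadius (w : R4 → ℝ) (t : ℝ) : ℝ := sphMean w t + t

/-- The mean over the sphere of radius `e^t` of `1 + ∂_t w`. -/
def meanSlope (w : R4 → ℝ) (t : ℝ) : ℝ := sphInt (euler w) t / areaS3 + 1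

/-- The exponential moments of the oscillation of `w`. -/
def expMoment (w : R4 → ℝ) (k t : ℝ) : ℝ := ∫ θ : S3, exp (k * rescaled w t θ) ∂sig

/-- The integral of `(1 + ∂_t w) e^{2 z}`, where `z` is the oscillation of `w`. -/
def slopeMoment (w : R4 → ℝ) (t : ℝ) : ℝ :=
  ∫ θ : S3, (1 + euler w (exp t • (θ : R4))) * exp (2 * rescaled w t θ) ∂sig

/-- The integral of `(1 + ∂_t w)² e^{z}`, where `z` is the oscillation of `w`. -/
def slopeSqMoment (w : R4 → ℝ) (t : ℝ) : ℝ :=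
  ∫ θ : S3, (1 + euler w (exp t • (θ : R4))) ^ 2 * exp (rescaled w t θ) ∂sig

theorem expMoment_nonneg (w : R4 → ℝ) (k t : ℝ) : 0 ≤ expMoment w k t :=
  integral_nonneg fun _ => (exp_pos _).le

theorem slopeSqMoment_nonneg (w : R4 → ℝ) (t : ℝ) : 0 ≤ slopeSqMoment w t :=
  integral_nonneg fun _ => mul_nonneg (sq_nonneg _) (exp_pos _).le

theorem exp_mul_logRadius (w : R4 → ℝ) (k t : ℝ) (θ : S3) :
    exp (k * w (exp t • (θ : R4))) =
      exp (k * logRadius w t) * exp (-(k * t)) * exp (k * rescaled w t θ) := by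
  rw [← exp_add, ← exp_add, rescaled, logRadius]
  ring_nf

theorem integral_exp_three_sphereMeasure (w : R4 → ℝ) (t : ℝ) :
    ∫ x, exp (3 * w x) ∂(sphereMeasure (exp t)) = exp (3 * logRadius w t) * expMoment w 3 t := by
  rw [integral_sphereMeasure (exp_pos t)]
  simp only [exp_mul_logRadius w 3 t]
  rw [integral_const_mul, ← exp_nat_mul, ← expMoment, exp_neg]
  have := (exp_pos (3 * t)).ne'
  push_cast
  field_simp

theorem sphInt_exp_four (w : R4 → ℝ) (t : ℝ) :
    exp (4 * t) * sphInt (fun x => exp (4 * w x)) t =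
      exp (4 * logRadius w t) * expMoment w 4 t := by
  rw [sphInt]
  simp only [exp_mul_logRadius w 4 t]
  rw [integral_const_mul, ← expMoment, exp_neg]
  have := (exp_pos (4 * t)).ne'
  field_simp

/-- The normalizations agree because π²/2 is a quarter of the area 2π². Thus the quotient fixing μ
or ν is itself one of the ratios. -/
theorem isoQuotient_eq_C34 (w : R4 → ℝ) (r : ℝ) : isoQuotient w r = C34 w r := by
  have h0 : 0 ≤ ∫ x, exp (3 * w x) ∂(sphereMeasure r) := integral_nonneg fun _ => (exp_pos _).le
  have e1 : ((1 / 4 : ℝ)) ^ (4 / 3 : ℝ) = 1 / 4 * (1 / 4) ^ (1 / 3 : ℝ) := by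
    conv_rhs => rw [← rpow_one_add' (by norm_num) (by norm_num)]
    norm_num
  have e2 : (π ^ 2 / 2 : ℝ) ^ (1 / 3 : ℝ) = (1 / 4) ^ (1 / 3 : ℝ) * (2 * π ^ 2) ^ (1 / 3 : ℝ) := by
    rw [← mul_rpow (by norm_num) (by positivity)]
    congr 1
    ring
  rw [isoQuotient, C34, V3, V4, mul_rpow (by norm_num) h0, e1, e2]
  have : ((1 / 4 : ℝ)) ^ (1 / 3 : ℝ) ≠ 0 := by positivity
  field_simp

theorem V3_exp (w : R4 → ℝ) (t : ℝ) :
    V3 w (exp t) = exp (3 * logRadius w t) * (expMoment w 3 t / 4) := by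
  rw [V3, integral_exp_three_sphereMeasure]
  ring

/-! ### Mixed volumes in terms of the conformal radius and the moments. -/

section MixedVolumes

variable {w : R4 → ℝ} (hw : ContDiffOn ℝ ∞ w {0}ᶜ)
include hw

/-- H₁ = 3(1 + ∂_t w)e^{-w}/r lowers the exponent 3w to 2w. The 3 turns 1/12 into 1/4, and the
powers of r cancel. -/
theorem V2_exp (t : ℝ) : V2 w (exp t) = exp (2 * logRadius w t) * (slopeMoment w t / 4) := by
  have he := exp_pos t
  have h : ∀ θ : S3, symCurvature w 1 (exp t • (θ : R4)) * exp (3 * w (exp t • (θ : R4))) =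
      3 * (exp (2 * logRadius w t) * exp (-(3 * t))) *
        ((1 + euler w (exp t • (θ : R4))) * exp (2 * rescaled w t θ)) := fun θ => by
    rw [symCurvature_one hw (smul_S3_ne_zero he.ne' θ), norm_smul, norm_S3, mul_one,
      norm_of_nonneg he.le]
    have e1 : exp (-w (exp t • (θ : R4))) / exp t * exp (3 * w (exp t • (θ : R4))) =
        exp (2 * logRadius w t) * exp (-(3 * t)) * exp (2 * rescaled w t θ) := by
      rw [← exp_sub, ← exp_add, ← exp_add, ← exp_add, rescaled, logRadius]
      ring_nf
    linear_combination 3 * (1 + euler w (exp t • (θ : R4))) * e1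
  rw [V2, integral_sphereMeasure he]
  simp only [h]
  rw [integral_const_mul, ← slopeMoment, ← exp_nat_mul, exp_neg]
  have := (exp_pos (3 * t)).ne'
  push_cast
  field_simp
  ring

theorem V1_exp (t : ℝ) : V1 w (exp t) = exp (logRadius w t) * (slopeSqMoment w t / 4) := by
  have he := exp_pos t
  have h : ∀ θ : S3, symCurvature w 2 (exp t • (θ : R4)) * exp (3 * w (exp t • (θ : R4))) =
      3 * (exp (logRadius w t) * exp (-(3 * t))) *
        ((1 + euler w (exp t • (θ : R4))) ^ 2 * exp (rescaled w t θ)) := fun θ => by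
    rw [symCurvature_two hw (smul_S3_ne_zero he.ne' θ), norm_smul, norm_S3, mul_one,
      norm_of_nonneg he.le]
    have e1 : (exp (-w (exp t • (θ : R4))) / exp t) ^ 2 * exp (3 * w (exp t • (θ : R4))) =
        exp (logRadius w t) * exp (-(3 * t)) * exp (rescaled w t θ) := by
      rw [← exp_sub, ← exp_nat_mul, ← exp_add, ← exp_add, ← exp_add, rescaled, logRadius]
      push_cast
      ring_nf
    linear_combination 3 * (1 + euler w (exp t • (θ : R4))) ^ 2 * e1
  rw [V1, integral_sphereMeasure he]
  simp only [h]
  rw [integral_const_mul, ← slopeSqMoment, ← exp_nat_mul, exp_neg]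
  have := (exp_pos (3 * t)).ne'
  push_cast
  field_simp
  ring

/-! ### Limits of the isoperimetric ratios, given convergence of the moments. -/

section Moments

variable {l : Filter ℝ} {q : ℝ} (hE : ∀ k, 0 ≤ k → Tendsto (expMoment w k) l (𝓝 areaS3))
  (hZ : Tendsto (fun t => ∫ θ : S3, (euler w (exp t • (θ : R4)) - sphInt (euler w) t / areaS3) ^ 2 *
        exp (rescaled w t θ) ∂sig) l (𝓝 0)) (hq : Tendsto (meanSlope w) l (𝓝 q))
include hE hZ

/-- Cauchy–Schwarz with e^{kz} = e^{z/2} e^{(k - 1/2)z}. The second factor leads to the moment of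
order 2k - 1, which must be nonnegative. -/
theorem tendsto_integral_mul_exp {k : ℝ} (hk : 1 ≤ 2 * k) : Tendsto (fun t => ∫ θ : S3,
    (euler w (exp t • (θ : R4)) - sphInt (euler w) t / areaS3) * exp (k * rescaled w t θ) ∂sig)
    l (𝓝 0) := by
  have hle : ∀ t, |∫ θ : S3, (euler w (exp t • (θ : R4)) - sphInt (euler w) t / areaS3) *
      exp (k * rescaled w t θ) ∂sig| ≤ √((∫ θ : S3, (euler w (exp t • (θ : R4)) -
        sphInt (euler w) t / areaS3) ^ 2 * exp (rescaled w t θ) ∂sig) *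
          expMoment w (2 * k - 1) t) := fun t => by
    have hrc := continuous_rescaled_sphere hw t
    have hec := continuous_slice (contDiffOn_euler isOpen_punctured hw).continuousOn t
    have h := sq_integral_mul_le
      (f := fun θ : S3 => (euler w (exp t • (θ : R4)) - sphInt (euler w) t / areaS3) *
        exp (1 / 2 * rescaled w t θ)) (g := fun θ : S3 => exp ((k - 1 / 2) * rescaled w t θ))
      ((hec.sub continuous_const).mul (continuous_const.mul hrc).rexp)
      (continuous_const.mul hrc).rexp
    refine abs_le_sqrt (le_trans (le_of_eq ?_) (h.trans (le_of_eq ?_)))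
    · congr 2
      funext θ
      rw [mul_assoc, ← exp_add]
      ring_nf
    · rw [expMoment]
      congr 2
      · funext θ
        rw [mul_pow, ← exp_nat_mul]
        push_cast
        ring_nf
      · funext θ
        rw [← exp_nat_mul]
        push_cast
        ring_nf
  have h0 := (hZ.mul (hE (2 * k - 1) (by linarith))).sqrt
  rw [zero_mul, sqrt_zero] at h0
  exact squeeze_zero_norm hle h0

include hq

theorem tendsto_slopeMoment : Tendsto (slopeMoment w) l (𝓝 (areaS3 * q)) := by
  have h := (hq.mul (hE 2 (by norm_num))).add (tendsto_integral_mul_exp hw hE hZ (k := 2)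
    (by norm_num))
  rw [add_zero, mul_comm] at h
  refine h.congr fun t => ?_
  have hrc := continuous_rescaled_sphere hw t
  have hec := continuous_slice (contDiffOn_euler isOpen_punctured hw).continuousOn t
  rw [expMoment, ← integral_const_mul, ← integral_add, slopeMoment]
  · congr 1
    funext θ
    rw [meanSlope]
    ring
  · exact integrable_sphere (continuous_const.mul (continuous_const.mul hrc).rexp)
  · exact integrable_sphere ((hec.sub continuous_const).mul (continuous_const.mul hrc).rexp)

/-- Expand the square around the mean slope: the mixed term and the quadratic term vanish in the
limit. -/
theorem tendsto_slopeSqMoment : Tendsto (slopeSqMoment w) l (𝓝 (areaS3 * q ^ 2)) := by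
  have h := (((hq.pow 2).mul (hE 1 (by norm_num))).add ((hq.const_mul 2).mul
    (tendsto_integral_mul_exp hw hE hZ (k := 1) (by norm_num)))).add hZ
  rw [mul_zero, add_zero, add_zero, mul_comm] at h
  refine h.congr fun t => ?_
  have hrc := continuous_rescaled_sphere hw t
  have hec := continuous_slice (contDiffOn_euler isOpen_punctured hw).continuousOn t
  have i1 : Integrable (fun θ : S3 => meanSlope w t ^ 2 * exp (1 * rescaled w t θ)) sig :=
    integrable_sphere (continuous_const.mul (continuous_const.mul hrc).rexp)
  have i2 : Integrable (fun θ : S3 => 2 * meanSlope w t * ((euler w (exp t • (θ : R4)) -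
      sphInt (euler w) t / areaS3) * exp (1 * rescaled w t θ))) sig :=
    integrable_sphere (continuous_const.mul ((hec.sub continuous_const).mul
      (continuous_const.mul hrc).rexp))
  have i3 : Integrable (fun θ : S3 => (euler w (exp t • (θ : R4)) -
      sphInt (euler w) t / areaS3) ^ 2 * exp (rescaled w t θ)) sig :=
    integrable_sphere (((hec.sub continuous_const).pow 2).mul hrc.rexp)
  have i12 : Integrable (fun θ : S3 => meanSlope w t ^ 2 * exp (1 * rescaled w t θ) +
    2 * meanSlope w t * ((euler w (exp t • (θ : R4)) -
      sphInt (euler w) t / areaS3) * exp (1 * rescaled w t θ))) sig := i1.add i2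
  rw [expMoment, ← integral_const_mul, ← integral_const_mul, ← integral_add i1 i2,
    ← integral_add i12 i3, slopeSqMoment]
  congr 1
  funext θ
  rw [meanSlope, one_mul]
  ring

-- The powers of the conformal radius cancel. Positivity of q plays no role, so this limit exists
-- even when q = 0.
omit hw hZ hq in
theorem tendsto_C34 (hF : Tendsto (fun t => exp (4 * logRadius w t) / V4 w (exp t)) l
    (𝓝 (q / (areaS3 / 4)))) : Tendsto (fun t => C34 w (exp t)) l (𝓝 q) := by
  have hA := areaS3_pos
  have ha : (π ^ 2 / 2 : ℝ) = areaS3 / 4 := by rw [areaS3]; ring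
  have h1 : Tendsto (fun t => (expMoment w 3 t / 4) ^ (4 / 3 : ℝ)) l
      (𝓝 ((areaS3 / 4) ^ (4 / 3 : ℝ))) :=
    ((hE 3 (by norm_num)).div_const 4).rpow_const (Or.inr (by norm_num))
  have h2 := (h1.div_const ((areaS3 / 4) ^ (1 / 3 : ℝ))).mul hF
  have e : (areaS3 / 4) ^ (4 / 3 : ℝ) / (areaS3 / 4) ^ (1 / 3 : ℝ) * (q / (areaS3 / 4)) = q := by
    rw [← rpow_sub (by positivity), show (4 / 3 - 1 / 3 : ℝ) = 1 by norm_num, rpow_one]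
    field_simp
  rw [e] at h2
  refine h2.congr fun t => ?_
  rw [C34, V3_exp, ha, mul_rpow (exp_pos _).le
    (div_nonneg (expMoment_nonneg w 3 t) (by norm_num)), ← exp_mul]
  rw [show 3 * logRadius w t * (4 / 3) = 4 * logRadius w t by ring]
  ring

theorem tendsto_C23 : Tendsto (fun t => C23 w (exp t)) l (𝓝 q) := by
  have hA := areaS3_pos
  have ha : (π ^ 2 / 2 : ℝ) = areaS3 / 4 := by rw [areaS3]; ring
  have h1 : Tendsto (fun t => (expMoment w 3 t / 4) ^ (2 / 3 : ℝ)) l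
      (𝓝 ((areaS3 / 4) ^ (2 / 3 : ℝ))) :=
    ((hE 3 (by norm_num)).div_const 4).rpow_const (Or.inr (by norm_num))
  have h2 := ((tendsto_slopeMoment hw hE hZ hq).div_const 4).div
    (h1.const_mul ((areaS3 / 4) ^ (1 / 3 : ℝ))) (by positivity)
  have e : areaS3 * q / 4 / ((areaS3 / 4) ^ (1 / 3 : ℝ) * (areaS3 / 4) ^ (2 / 3 : ℝ)) = q := by
    rw [← rpow_add (by positivity), show (1 / 3 + 2 / 3 : ℝ) = 1 by norm_num, rpow_one]
    field_simp
  rw [e] at h2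
  refine h2.congr fun t => ?_
  rw [C23, V2_exp hw, V3_exp, ha, mul_rpow (exp_pos _).le
    (div_nonneg (expMoment_nonneg w 3 t) (by norm_num)), ← exp_mul]
  rw [show 3 * logRadius w t * (2 / 3) = 2 * logRadius w t by ring]
  have := (exp_pos (2 * logRadius w t)).ne'
  simp only [Pi.div_apply]
  field_simp

/-- Numerator and denominator scale like q^{4/3} and q^{1/3}. Positivity of q keeps V₂ away from
zero and makes the division legitimate. -/
theorem tendsto_C12 (hq0 : 0 < q) : Tendsto (fun t => C12 w (exp t)) l (𝓝 q) := by
  have hA := areaS3_pos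
  have ha : (π ^ 2 / 2 : ℝ) = areaS3 / 4 := by rw [areaS3]; ring
  have hT2 := tendsto_slopeMoment hw hE hZ hq
  have h1 : Tendsto (fun t => (slopeSqMoment w t / 4) ^ (2 / 3 : ℝ)) l
      (𝓝 ((areaS3 * q ^ 2 / 4) ^ (2 / 3 : ℝ))) :=
    ((tendsto_slopeSqMoment hw hE hZ hq).div_const 4).rpow_const (Or.inr (by norm_num))
  have h2 : Tendsto (fun t => (slopeMoment w t / 4) ^ (1 / 3 : ℝ)) l
      (𝓝 ((areaS3 * q / 4) ^ (1 / 3 : ℝ))) :=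
    (hT2.div_const 4).rpow_const (Or.inr (by norm_num))
  have h3 := h1.div (h2.const_mul ((areaS3 / 4) ^ (1 / 3 : ℝ))) (by positivity)
  have e : (areaS3 * q ^ 2 / 4) ^ (2 / 3 : ℝ) /
      ((areaS3 / 4) ^ (1 / 3 : ℝ) * (areaS3 * q / 4) ^ (1 / 3 : ℝ)) = q := by
    rw [← mul_rpow (by positivity) (by positivity)]
    have e1 : areaS3 / 4 * (areaS3 * q / 4) = (areaS3 / 4) ^ 2 * q := by ring
    have e2 : areaS3 * q ^ 2 / 4 = areaS3 / 4 * q ^ 2 := by ring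
    rw [e1, e2, mul_rpow (by positivity) (by positivity), mul_rpow (by positivity) (by positivity),
      ← rpow_natCast, ← rpow_natCast, ← rpow_mul hq0.le, ← rpow_mul (by positivity)]
    push_cast
    rw [show (2 * (1 / 3) : ℝ) = 2 / 3 by norm_num, mul_div_mul_left _ _ (by positivity),
      ← rpow_sub hq0, show (2 * (2 / 3) - 1 / 3 : ℝ) = 1 by norm_num, rpow_one]
  rw [e] at h3
  refine h3.congr' ?_
  filter_upwards [hT2.eventually_const_lt (show 0 < areaS3 * q by positivity)] with t ht
  rw [C12, V1_exp hw, V2_exp hw, ha, mul_rpow (exp_pos _).le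
    (div_nonneg (slopeSqMoment_nonneg w t) (by norm_num)),
    mul_rpow (exp_pos _).le (by positivity), ← exp_mul, ← exp_mul]
  rw [show 2 * logRadius w t * (1 / 3) = logRadius w t * (2 / 3) by ring]
  have := (exp_pos (logRadius w t * (2 / 3))).ne'
  simp only [Pi.div_apply]
  field_simp

/-- The mixed ratios are weighted geometric means: the exponents add up to 1, so a common limit is
preserved. -/
theorem tendsto_isoRatio (hF : Tendsto (fun t => exp (4 * logRadius w t) / V4 w (exp t)) l
    (𝓝 (q / (areaS3 / 4)))) (hq0 : 0 < q) {k m : ℕ} (hk : 1 ≤ k) (hkm : k < m) (hm : m ≤ 4) :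
    Tendsto (fun t => isoRatio w k m (exp t)) l (𝓝 q) := by
  have h34 := tendsto_C34 hE hF
  have h23 := tendsto_C23 hw hE hZ hq
  have h12 := tendsto_C12 hw hE hZ hq hq0
  have hp : ∀ {f : ℝ → ℝ} (a : ℝ), Tendsto f l (𝓝 q) →
      Tendsto (fun t => f t ^ a) l (𝓝 (q ^ a)) := fun a hf => hf.rpow_const (Or.inl hq0.ne')
  have h24 := (hp (1 / 3) h34).mul (hp (2 / 3) h23)
  have h13 := (hp (1 / 4) h23).mul (hp (3 / 4) h12)
  have h14 := ((hp (1 / 9) h34).mul (hp (2 / 9) h23)).mul (hp (2 / 3) h12)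
  rw [← rpow_add hq0, show (1 / 3 + 2 / 3 : ℝ) = 1 by norm_num, rpow_one] at h24
  rw [← rpow_add hq0, show (1 / 4 + 3 / 4 : ℝ) = 1 by norm_num, rpow_one] at h13
  rw [← rpow_add hq0, ← rpow_add hq0, show (1 / 9 + 2 / 9 + 2 / 3 : ℝ) = 1 by norm_num,
    rpow_one] at h14
  interval_cases m <;> interval_cases k <;> first | omega | assumption

end Moments

end MixedVolumes

/-! ### The ratio of the area to the volume -/

theorem monotoneOn_of_hasDerivAt {f f' : ℝ → ℝ} {D : Set ℝ} (hD : Convex ℝ D)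
    (hf : ∀ x, HasDerivAt f (f' x) x) (h : ∀ x ∈ D, 0 ≤ f' x) : MonotoneOn f D :=
  monotoneOn_of_deriv_nonneg hD (fun x _ => (hf x).continuousAt.continuousWithinAt)
    (fun x _ => (hf x).differentiableAt.differentiableWithinAt) fun x hx => by
      rw [(hf x).deriv]
      exact h x (interior_subset hx)

theorem antitoneOn_of_hasDerivAt {f f' : ℝ → ℝ} {D : Set ℝ} (hD : Convex ℝ D)
    (hf : ∀ x, HasDerivAt f (f' x) x) (h : ∀ x ∈ D, f' x ≤ 0) : AntitoneOn f D :=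
  antitoneOn_of_deriv_nonpos hD (fun x _ => (hf x).continuousAt.continuousWithinAt)
    (fun x _ => (hf x).differentiableAt.differentiableWithinAt) fun x hx => by
      rw [(hf x).deriv]
      exact h x (interior_subset hx)

/-! ### A monotone form of l'Hôpital's rule for F/V with F' = pF and V' = FS. -/

section Ratio

variable {F V p S : ℝ → ℝ} {A q : ℝ} (hA : 0 < A) (hF : ∀ t, HasDerivAt F (p t * F t) t)
  (hV : ∀ t, HasDerivAt V (F t * S t) t) (hF0 : ∀ t, 0 < F t) (hV0 : ∀ t, 0 < V t)
  (hS : ∀ t, A ≤ S t)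

-- If F stayed above η, then V would grow at least at the rate Aη and would therefore be negative
-- far to the left.
include hA hV hF0 hV0 hS in
theorem exists_lt_of_le {η : ℝ} (hη : 0 < η) (T : ℝ) : ∃ s ≤ T, F s < η := by
  by_contra! h
  have hd : ∀ x, HasDerivAt (fun s => V s - A * η * s) (F x * S x - A * η) x := fun x =>
    ((hV x).sub ((hasDerivAt_id x).const_mul (A * η))).congr_deriv (by ring)
  have hm := monotoneOn_of_hasDerivAt (convex_Iic T) hd fun x hx => by
    have := mul_le_mul (h x hx) (hS x) hA.le (hF0 x).le
    linarith
  have hAη : 0 < A * η := by positivity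
  have hs : T - V T / (A * η) ≤ T := by linarith [div_pos (hV0 T) hAη]
  have h1 := hm (mem_Iic.2 hs) (mem_Iic.2 le_rfl) hs
  have h2 : A * η * (V T / (A * η)) = V T := by field_simp
  have h3 := hV0 (T - V T / (A * η))
  simp only at h1
  linarith

include hA hV hF0 hS in
theorem exists_lt_of_ge {B : ℝ} (hB : ∀ t, V t ≤ B) {η : ℝ} (hη : 0 < η) (T : ℝ) :
    ∃ s ≥ T, F s < η := by
  by_contra! h
  have hd : ∀ x, HasDerivAt (fun s => V s - A * η * s) (F x * S x - A * η) x := fun x =>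
    ((hV x).sub ((hasDerivAt_id x).const_mul (A * η))).congr_deriv (by ring)
  have hm := monotoneOn_of_hasDerivAt (convex_Ici T) hd fun x hx => by
    have := mul_le_mul (h x hx) (hS x) hA.le (hF0 x).le
    linarith
  have hAη : 0 < A * η := by positivity
  have hs : T ≤ T + (B - V T + 1) / (A * η) := by
    have : 0 < (B - V T + 1) / (A * η) := div_pos (by linarith [hB T]) hAη
    linarith
  have h1 := hm (mem_Ici.2 le_rfl) (mem_Ici.2 hs) hs
  have h2 : A * η * ((B - V T + 1) / (A * η)) = B - V T + 1 := by field_simp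
  have h3 := hB (T + (B - V T + 1) / (A * η))
  simp only at h1
  linarith

-- For c on one side of q/A the function F - cV is eventually monotone. This compares F/V with c
-- without assuming that F has a limit.
include hF hV hF0 in
theorem eventually_deriv_sub_neg {l : Filter ℝ} (hSl : Tendsto S l (𝓝 A))
    (hp : Tendsto p l (𝓝 q)) {c : ℝ} (hc : q < c * A) :
    (∀ t, HasDerivAt (fun s => F s - c * V s) (F t * (p t - c * S t)) t) ∧
      ∀ᶠ t in l, F t * (p t - c * S t) ≤ 0 := by
  refine ⟨fun t => ((hF t).sub ((hV t).const_mul c)).congr_deriv (by ring), ?_⟩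
  filter_upwards [(hp.sub (hSl.const_mul c)).eventually_lt_const (show q - c * A < 0 by linarith)]
    with t ht
  exact mul_nonpos_of_nonneg_of_nonpos (hF0 t).le ht.le

include hF hV hF0 in
theorem eventually_deriv_sub_pos {l : Filter ℝ} (hSl : Tendsto S l (𝓝 A))
    (hp : Tendsto p l (𝓝 q)) {c : ℝ} (hc : c * A < q) :
    (∀ t, HasDerivAt (fun s => F s - c * V s) (F t * (p t - c * S t)) t) ∧
      ∀ᶠ t in l, 0 ≤ F t * (p t - c * S t) := by
  refine ⟨fun t => ((hF t).sub ((hV t).const_mul c)).congr_deriv (by ring), ?_⟩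
  filter_upwards [(hp.sub (hSl.const_mul c)).eventually_const_lt (show 0 < q - c * A by linarith)]
    with t ht
  exact mul_nonneg (hF0 t).le ht.le

include hA hF hV hF0 hV0 hS

/-- With q < 0, F would decrease on a left half-line and so stay above F(T) there, although V' = FS
is integrable at -∞. -/
theorem nonneg_of_tendsto_atBot (hp : Tendsto p atBot (𝓝 q)) : 0 ≤ q := by
  by_contra! hq
  obtain ⟨T, hT⟩ := eventually_atBot.1 (hp.eventually_lt_const hq)
  have ha := antitoneOn_of_hasDerivAt (convex_Iic T) hF fun x hx =>
    mul_nonpos_of_nonpos_of_nonneg (hT x hx).le (hF0 x).le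
  obtain ⟨s, hs, hlt⟩ := exists_lt_of_le hA hV hF0 hV0 hS (hF0 T) T
  exact absurd (ha (mem_Iic.2 hs) (mem_Iic.2 le_rfl) hs) (not_le.2 hlt)

/-- F - cV is monotone near -∞, and its sign is read off from its behaviour there. V tends to 0 and
F is small along a sequence, which is enough. -/
theorem tendsto_div_atBot (hSl : Tendsto S atBot (𝓝 A)) (hp : Tendsto p atBot (𝓝 q))
    (hVl : Tendsto V atBot (𝓝 0)) : Tendsto (fun t => F t / V t) atBot (𝓝 (q / A)) := by
  have hq := nonneg_of_tendsto_atBot hA hF hV hF0 hV0 hS hp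
  refine tendsto_order.2 ⟨fun c hc => ?_, fun c hc => ?_⟩
  · obtain ⟨c', hc1, hc2⟩ := exists_between hc
    obtain ⟨hd, he⟩ := eventually_deriv_sub_pos hF hV hF0 hSl hp ((lt_div_iff₀ hA).1 hc2)
    obtain ⟨T, hT⟩ := eventually_atBot.1 he
    have hm := monotoneOn_of_hasDerivAt (convex_Iic T) hd hT
    filter_upwards [eventually_le_atBot T] with t ht
    have h0 : 0 ≤ F t - c' * V t := by
      have h1 : Tendsto (fun s => -(c' * V s)) atBot (𝓝 0) := by simpa using (hVl.const_mul c').neg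
      refine le_of_tendsto h1 ?_
      filter_upwards [eventually_le_atBot t] with s hs
      have := hm (mem_Iic.2 (hs.trans ht)) (mem_Iic.2 ht) hs
      simp only at this
      linarith [hF0 s]
    rw [lt_div_iff₀ (hV0 t)]
    have := mul_lt_mul_of_pos_right hc1 (hV0 t)
    linarith
  · obtain ⟨c', hc1, hc2⟩ := exists_between hc
    have hc0 : 0 ≤ c' := (div_nonneg hq hA.le).trans hc1.le
    obtain ⟨hd, he⟩ := eventually_deriv_sub_neg hF hV hF0 hSl hp ((div_lt_iff₀ hA).1 hc1)
    obtain ⟨T, hT⟩ := eventually_atBot.1 he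
    have hm := antitoneOn_of_hasDerivAt (convex_Iic T) hd hT
    filter_upwards [eventually_le_atBot T] with t ht
    have h0 : F t - c' * V t ≤ 0 := by
      refine le_of_forall_pos_le_add fun η hη => ?_
      obtain ⟨s, hs, hlt⟩ := exists_lt_of_le hA hV hF0 hV0 hS hη t
      have := hm (mem_Iic.2 (hs.trans ht)) (mem_Iic.2 ht) hs
      simp only at this
      linarith [mul_nonneg hc0 (hV0 s).le]
    rw [div_lt_iff₀ (hV0 t)]
    have := mul_lt_mul_of_pos_right hc2 (hV0 t)
    linarith

/-- If V is unbounded, the value of F - cV at T is negligible against V. If V stays bounded, F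
cannot remain bounded below; then q > 0 is impossible, so q = 0 and F tends to 0. -/
theorem tendsto_div_atTop (hSl : Tendsto S atTop (𝓝 A)) (hp : Tendsto p atTop (𝓝 q))
    (hq : 0 ≤ q) : Tendsto (fun t => F t / V t) atTop (𝓝 (q / A)) := by
  have hVm : Monotone V := by
    rw [← monotoneOn_univ]
    exact monotoneOn_of_hasDerivAt convex_univ hV fun x _ =>
      mul_nonneg (hF0 x).le (hA.le.trans (hS x))
  rcases tendsto_atTop_of_monotone hVm with hVl | ⟨B, hVl⟩
  · have hK : ∀ K : ℝ, Tendsto (fun t => K / V t) atTop (𝓝 0) := fun K => hVl.const_div_atTop K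
    refine tendsto_order.2 ⟨fun c hc => ?_, fun c hc => ?_⟩
    · obtain ⟨c', hc1, hc2⟩ := exists_between hc
      obtain ⟨hd, he⟩ := eventually_deriv_sub_pos hF hV hF0 hSl hp ((lt_div_iff₀ hA).1 hc2)
      obtain ⟨T, hT⟩ := eventually_atTop.1 he
      have hm := monotoneOn_of_hasDerivAt (convex_Ici T) hd hT
      filter_upwards [eventually_ge_atTop T, (hK (F T - c' * V T)).eventually_const_lt
        (show c - c' < 0 by linarith)] with t ht hlt
      have h1 := hm (mem_Ici.2 le_rfl) (mem_Ici.2 ht) ht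
      simp only at h1
      have h2 := div_le_div_of_nonneg_right h1 (hV0 t).le
      rw [sub_div _ (c' * V t), mul_div_assoc, div_self (hV0 t).ne'] at h2
      linarith
    · obtain ⟨c', hc1, hc2⟩ := exists_between hc
      obtain ⟨hd, he⟩ := eventually_deriv_sub_neg hF hV hF0 hSl hp ((div_lt_iff₀ hA).1 hc1)
      obtain ⟨T, hT⟩ := eventually_atTop.1 he
      have hm := antitoneOn_of_hasDerivAt (convex_Ici T) hd hT
      filter_upwards [eventually_ge_atTop T, (hK (F T - c' * V T)).eventually_lt_const
        (show 0 < c - c' by linarith)] with t ht hlt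
      have h1 := hm (mem_Ici.2 le_rfl) (mem_Ici.2 ht) ht
      simp only at h1
      have h2 := div_le_div_of_nonneg_right h1 (hV0 t).le
      rw [sub_div _ (c' * V t), mul_div_assoc, div_self (hV0 t).ne'] at h2
      linarith
  · have hVB : ∀ t, V t ≤ B := hVm.ge_of_tendsto hVl
    have hB0 : 0 < B := (hV0 0).trans_le (hVB 0)
    have hsmall := fun η (hη : 0 < η) T => exists_lt_of_ge hA hV hF0 hS hVB hη T
    have hq0 : q = 0 := by
      by_contra hne
      obtain ⟨T, hT⟩ := eventually_atTop.1
        (hp.eventually_const_lt (lt_of_le_of_ne hq (Ne.symm hne)))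
      have hm := monotoneOn_of_hasDerivAt (convex_Ici T) hF fun x hx =>
        mul_nonneg (hT x hx).le (hF0 x).le
      obtain ⟨s, hs, hlt⟩ := hsmall _ (hF0 T) T
      exact absurd (hm (mem_Ici.2 le_rfl) (mem_Ici.2 hs) hs) (not_le.2 hlt)
    have hFl : Tendsto F atTop (𝓝 0) := by
      refine tendsto_order.2 ⟨fun a ha => .of_forall fun t => ha.trans (hF0 t), fun a ha => ?_⟩
      have hc : 0 < a / (2 * B) := by positivity
      obtain ⟨hd, he⟩ := eventually_deriv_sub_neg hF hV hF0 hSl hp (c := a / (2 * B))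
        (by rw [hq0]; positivity)
      obtain ⟨T, hT⟩ := eventually_atTop.1 he
      have hm := antitoneOn_of_hasDerivAt (convex_Ici T) hd hT
      obtain ⟨s, hs, hlt⟩ := hsmall (a / 2) (by positivity) T
      filter_upwards [eventually_ge_atTop s] with t ht
      have h1 := hm (mem_Ici.2 hs) (mem_Ici.2 (le_trans hs ht)) ht
      simp only at h1
      have h2 : a / (2 * B) * V t ≤ a / 2 := by
        calc _ ≤ a / (2 * B) * B := by gcongr; exact hVB t
          _ = a / 2 := by field_simp
      have h3 := mul_pos hc (hV0 s)
      linarith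
    have := hFl.div hVl hB0.ne'
    rwa [hq0, zero_div, ← zero_div B]

end Ratio

/-! ### Growth of the conformal radius and of the volume. -/

section RadiusGrowth

variable {w : R4 → ℝ} (hw : ContDiffOn ℝ ∞ w {0}ᶜ)
include hw

theorem hasDerivAt_logRadius (t : ℝ) : HasDerivAt (logRadius w) (meanSlope w t) t :=
  ((hasDerivAt_sphInt hw t).div_const _).add (hasDerivAt_id t)

theorem hasDerivAt_exp_logRadius (t : ℝ) : HasDerivAt (fun t => exp (4 * logRadius w t))
    (4 * meanSlope w t * exp (4 * logRadius w t)) t :=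
  ((hasDerivAt_logRadius hw t).const_mul 4).exp.congr_deriv (by ring)

theorem continuousOn_exp_four : ContinuousOn (fun x => exp (4 * w x)) {0}ᶜ :=
  (continuousOn_const.mul hw.continuousOn).rexp

theorem hasDerivAt_V4 (harea : FiniteAreaOverOrigin w) (t : ℝ) :
    HasDerivAt (fun t => V4 w (exp t)) (exp (4 * logRadius w t) * expMoment w 4 t) t := by
  rw [← sphInt_exp_four]
  exact hasDerivAt_integral_ball (continuousOn_exp_four hw) harea t

omit hw in
theorem V4_pos (harea : FiniteAreaOverOrigin w) {r : ℝ} (hr : 0 < r) : 0 < V4 w r := by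
  refine (setIntegral_pos_iff_support_of_nonneg_ae (.of_forall fun _ => (exp_pos _).le)
    (harea r)).2 ?_
  have : Function.support (fun x => exp (4 * w x)) = univ :=
    eq_univ_of_forall fun x => (exp_pos _).ne'
  rw [this, univ_inter]
  exact Metric.measure_ball_pos _ _ hr

omit hw in
theorem tendsto_V4_atBot (harea : FiniteAreaOverOrigin w) :
    Tendsto (fun t => V4 w (exp t)) atBot (𝓝 0) :=
  tendsto_integral_ball_atBot harea

/-- Completeness forces the radius to grow at least subexponentially fast. -/
theorem nonneg_of_completeAtInfinity (hc : CompleteAtInfinity w)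
    (hS : Tendsto (expMoment w 1) atTop (𝓝 areaS3)) {q : ℝ}
    (hq : Tendsto (meanSlope w) atTop (𝓝 q)) : 0 ≤ q := by
  by_contra! hq0
  have hA := areaS3_pos
  -- A slope eventually below κ < 0 makes the conformal radius decay like e^{κt}.
  obtain ⟨κ, hκ1, hκ2⟩ := exists_between hq0
  obtain ⟨T, hT⟩ := eventually_atTop.1 ((hq.eventually_lt_const hκ1).and
    (hS.eventually_lt_const (show areaS3 < 2 * areaS3 by linarith)))
  have hdec : ∀ t, 0 ≤ t → logRadius w (T + t) ≤ logRadius w T + κ * t := fun t ht => by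
    have hd : ∀ x, HasDerivAt (fun s => logRadius w s - κ * s) (meanSlope w x - κ) x := fun x =>
      ((hasDerivAt_logRadius hw x).sub ((hasDerivAt_id x).const_mul κ)).congr_deriv (by ring)
    have hm := antitoneOn_of_hasDerivAt (convex_Ici T) hd fun x hx => by linarith [(hT x hx).1]
    have h1 := hm (mem_Ici.2 le_rfl) (mem_Ici.2 (show T ≤ T + t by linarith)) (by linarith)
    simp only at h1
    linarith
  -- Every radial ray tends to infinity, so completeness gives it infinite length.
  have hlen : ∀ θ : S3, ∫⁻ t in Ici (0 : ℝ),
      ENNReal.ofReal (exp (w (exp (T + t) • (θ : R4))) * exp (T + t)) = ⊤ := fun θ => by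
    have hcurve : ContDiff ℝ 1 fun t : ℝ => exp (T + t) • (θ : R4) := by fun_prop
    have h1 := hc (fun t => exp (T + t) • (θ : R4)) hcurve.contDiffOn
      (fun t _ => smul_S3_ne_zero (exp_pos _).ne' θ) (by
        have : ∀ t : ℝ, ‖exp (T + t) • (θ : R4)‖ = exp (T + t) := fun t => by
          rw [norm_smul, norm_S3, mul_one, norm_of_nonneg (exp_pos _).le]
        simp only [this]
        exact tendsto_exp_atTop.comp (tendsto_atTop_add_const_left _ _ tendsto_id))
    rw [← h1]
    refine setLIntegral_congr_fun measurableSet_Ici fun t ht => ?_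
    have hd : HasDerivAt (fun t : ℝ => exp (T + t) • (θ : R4)) (exp (T + t) • (θ : R4)) t := by
      have h2 : HasDerivAt (fun t : ℝ => exp (T + t)) (exp (T + t)) t :=
        (((hasDerivAt_id t).const_add T).exp).congr_deriv (by simp)
      exact h2.smul_const (θ : R4)
    have hdw := hd.hasDerivWithinAt.derivWithin (uniqueDiffOn_Ici 0 t ht)
    simp only [hdw, norm_smul, norm_S3, mul_one, norm_of_nonneg (exp_pos _).le]
  have hcp : Continuous fun p : S3 × ℝ => exp (w (exp (T + p.2) • (p.1 : R4))) * exp (T + p.2) := by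
    have h1 : Continuous fun p : S3 × ℝ => w (exp (T + p.2) • (p.1 : R4)) :=
      hw.continuousOn.comp_continuous (by fun_prop) fun p => smul_S3_ne_zero (exp_pos _).ne' _
    exact h1.rexp.mul (by fun_prop)
  -- Tonelli: the total length of all rays is infinite on one side and bounded by a multiple of ∫
  -- e^{κt} dt on the other.
  have hswap : ∫⁻ θ : S3, (∫⁻ t in Ici (0 : ℝ),
      ENNReal.ofReal (exp (w (exp (T + t) • (θ : R4))) * exp (T + t))) ∂sig =
      ∫⁻ t in Ici (0 : ℝ), ∫⁻ θ : S3,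
        ENNReal.ofReal (exp (w (exp (T + t) • (θ : R4))) * exp (T + t)) ∂sig :=
    lintegral_lintegral_swap hcp.measurable.ennreal_ofReal.aemeasurable
  simp only [hlen, lintegral_const] at hswap
  have hu : sig univ ≠ 0 := fun h => by
    have := sig_real_univ
    rw [measureReal_def, h, ENNReal.toReal_zero] at this
    linarith
  rw [ENNReal.top_mul hu] at hswap
  have hbound : ∀ t ∈ Ici (0 : ℝ), ∫⁻ θ : S3,
      ENNReal.ofReal (exp (w (exp (T + t) • (θ : R4))) * exp (T + t)) ∂sig ≤
      ENNReal.ofReal (2 * areaS3 * exp (logRadius w T) * exp (κ * t)) := fun t ht => by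
    have ht0 : 0 ≤ t := ht
    have hci : Integrable (fun θ : S3 => exp (w (exp (T + t) • (θ : R4))) * exp (T + t)) sig :=
      integrable_sphere (hcp.comp (Continuous.prodMk_left t))
    rw [← ofReal_integral_eq_lintegral_ofReal hci (.of_forall fun θ => by positivity)]
    refine ENNReal.ofReal_le_ofReal ?_
    have e : ∀ θ : S3, exp (w (exp (T + t) • (θ : R4))) * exp (T + t) =
        exp (logRadius w (T + t)) * exp (1 * rescaled w (T + t) θ) := fun θ => by
      have h1 := exp_mul_logRadius w 1 (T + t) θ
      simp only [one_mul] at h1 ⊢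
      rw [h1, exp_neg]
      field_simp
    simp only [e]
    rw [integral_const_mul, ← expMoment]
    have h1 := (hT (T + t) (by linarith)).2.le
    have h2 := exp_le_exp.2 (hdec t ht0)
    rw [exp_add] at h2
    calc _ ≤ exp (logRadius w T) * exp (κ * t) * (2 * areaS3) :=
          mul_le_mul h2 h1 (expMoment_nonneg _ _ _) (by positivity)
      _ = _ := by ring
  have hfin : ∫⁻ t in Ici (0 : ℝ),
      ENNReal.ofReal (2 * areaS3 * exp (logRadius w T) * exp (κ * t)) < ⊤ := by
    have hi : IntegrableOn (fun t : ℝ => 2 * areaS3 * exp (logRadius w T) * exp (κ * t)) (Ici 0) := by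
      rw [integrableOn_Ici_iff_integrableOn_Ioi]
      exact (integrableOn_exp_mul_Ioi hκ2 0).const_mul _
    exact hi.lintegral_lt_top
  exact absurd hswap (ne_of_gt ((setLIntegral_mono' measurableSet_Ici hbound).trans_lt hfin))

end RadiusGrowth

theorem tendsto_atTop_of_comp_exp {f : ℝ → ℝ} {a : ℝ}
    (h : Tendsto (fun t => f (exp t)) atTop (𝓝 a)) : Tendsto f atTop (𝓝 a) := by
  refine (h.comp tendsto_log_atTop).congr' ?_
  filter_upwards [eventually_gt_atTop 0] with r hr
  simp [exp_log hr]

theorem tendsto_nhdsGT_of_comp_exp {f : ℝ → ℝ} {a : ℝ}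
    (h : Tendsto (fun t => f (exp t)) atBot (𝓝 a)) : Tendsto f (𝓝[>] 0) (𝓝 a) := by
  refine (h.comp tendsto_log_nhdsGT_zero).congr' ?_
  filter_upwards [self_mem_nhdsWithin] with r hr
  simp [exp_log hr]

/-- The isoperimetric quotient and the isoperimetric ratios have limits at the origin and at
infinity; the difference of the limits is determined by the total `Q` curvature. -/
theorem exists_limits_isoQuotient {w : R4 → ℝ} (hw : ContDiffOn ℝ ∞ w {0}ᶜ)
    (hcomplete : CompleteAtInfinity w) (harea : FiniteAreaOverOrigin w)
    (hQ : Integrable (fun x => |QCurvature (conformalMetric w) x| * exp (4 * w x)))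
    (r₁ r₂ : ℝ) (hr₁ : 0 < r₁) (hr₁₂ : r₁ ≤ r₂)
    (hRinfty : ∀ x : R4, r₂ ≤ ‖x‖ → 0 ≤ scalarCurvature (conformalMetric w) x)
    (hRorigin : ∀ x : R4, x ≠ 0 → ‖x‖ < r₁ → 0 ≤ scalarCurvature (conformalMetric w) x) :
    ∃ β ν : ℝ, ν - β = -(1 / (4 * π ^ 2) * totalQ w) ∧
      Tendsto (isoQuotient w) (𝓝[>] 0) (𝓝 β) ∧ Tendsto (isoQuotient w) atTop (𝓝 ν) ∧
      (0 < β → ∀ k l : ℕ, 1 ≤ k → k < l → l ≤ 4 → Tendsto (isoRatio w k l) (𝓝[>] 0) (𝓝 β)) ∧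
      (0 < ν → ∀ k l : ℕ, 1 ≤ k → k < l → l ≤ 4 → Tendsto (isoRatio w k l) atTop (𝓝 ν)) := by
  obtain ⟨β, ν, hβ, hν, hβν, C0, hC0⟩ :=
    exists_limits_sphInt_euler hw hQ r₁ r₂ hr₁ hr₁₂ hRinfty hRorigin
  have hA := areaS3_pos
  have hB := integrable_lap_lap hw hQ
  obtain ⟨Mq, hMq⟩ := exists_abs_le_of_tendsto
    ((continuous_sphInt (contDiffOn_euler isOpen_punctured hw).continuousOn).div_const areaS3)
    (by simpa using hβ.sub_const 1) (by simpa using hν.sub_const 1)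
  have hE : ∀ l : Filter ℝ, l = atTop ∨ l = atBot → ∀ k, 0 ≤ k →
      Tendsto (expMoment w k) l (𝓝 areaS3) := fun l hl k hk =>
    tendsto_integral_exp_rescaled hw hMq hC0 hB hl hk
  have hZ := fun (l : Filter ℝ) (hl : l = atTop ∨ l = atBot) =>
    tendsto_integral_sq_mul_exp_rescaled hw hMq hC0 hB hl
  have hV := hasDerivAt_V4 hw harea
  have hF := hasDerivAt_exp_logRadius hw
  have hF0 : ∀ t, 0 < exp (4 * logRadius w t) := fun t => exp_pos _
  have hV0 : ∀ t, 0 < V4 w (exp t) := fun t => V4_pos harea (exp_pos t)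
  have hS : ∀ t, areaS3 ≤ expMoment w 4 t := le_integral_exp_rescaled hw 4
  have hν0 := nonneg_of_completeAtInfinity hw hcomplete (hE atTop (.inl rfl) 1 zero_le_one) hν
  have hbot := tendsto_div_atBot hA hF hV hF0 hV0 hS (hE atBot (.inr rfl) 4 (by norm_num))
    (hβ.const_mul 4) (tendsto_V4_atBot harea)
  have htop := tendsto_div_atTop hA hF hV hF0 hV0 hS (hE atTop (.inl rfl) 4 (by norm_num))
    (hν.const_mul 4) (by positivity)
  -- The factor 4 comes from the logarithmic derivative of e^{4ρ}, which is four times the mean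
  -- slope.
  have e : ∀ q : ℝ, 4 * q / areaS3 = q / (areaS3 / 4) := fun q => by field_simp
  rw [e] at hbot htop
  have hiso : isoQuotient w = C34 w := funext (isoQuotient_eq_C34 w)
  refine ⟨β, ν, hβν, ?_, ?_, fun hβ0 k l hk hkl hl => ?_, fun hν1 k l hk hkl hl => ?_⟩
  · rw [hiso]
    exact tendsto_nhdsGT_of_comp_exp (tendsto_C34 (hE atBot (.inr rfl)) hbot)
  · rw [hiso]
    exact tendsto_atTop_of_comp_exp (tendsto_C34 (hE atTop (.inl rfl)) htop)
  · exact tendsto_nhdsGT_of_comp_exp (tendsto_isoRatio hw (hE atBot (.inr rfl))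
      (hZ atBot (.inr rfl)) hβ hbot hβ0 hk hkl hl)
  · exact tendsto_atTop_of_comp_exp (tendsto_isoRatio hw (hE atTop (.inl rfl))
      (hZ atTop (.inl rfl)) hν htop hν1 hk hkl hl)

end ConformalR4

end

theorem mainTheorem2 (w : R4 → ℝ) (hw : ContDiffOn ℝ ∞ w {0}ᶜ)
    (hcomplete : CompleteAtInfinity w) (harea : FiniteAreaOverOrigin w)
    (hQ : Integrable (fun x => |QCurvature (conformalMetric w) x| * exp (4 * w x)))
    (r₁ r₂ : ℝ) (hr₁ : 0 < r₁) (hr₁₂ : r₁ ≤ r₂)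
    (hRinfty : ∀ x : R4, r₂ ≤ ‖x‖ → 0 ≤ scalarCurvature (conformalMetric w) x)
    (hRorigin : ∀ x : R4, x ≠ 0 → ‖x‖ < r₁ → 0 ≤ scalarCurvature (conformalMetric w) x) :
    (∃ μ : ℝ, Tendsto (fun r => isoQuotient w r - 1) (𝓝[>] 0) (𝓝 μ) ∧
      (0 < 1 + μ - 1 / (4 * π ^ 2) * totalQ w →
        ∀ k l : ℕ, 1 ≤ k → k < l → l ≤ 4 →
          ∃ ν : ℝ, Tendsto (isoRatio w k l) atTop (𝓝 ν) ∧
            1 - 1 / (4 * π ^ 2) * totalQ w = ν - μ)) ∧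
    (∃ ν : ℝ, Tendsto (isoQuotient w) atTop (𝓝 ν) ∧
      (0 < ν + 1 / (4 * π ^ 2) * totalQ w →
        ∀ k l : ℕ, 1 ≤ k → k < l → l ≤ 4 →
          ∃ μ : ℝ, Tendsto (fun r => isoRatio w k l r - 1) (𝓝[>] 0) (𝓝 μ) ∧
            1 - 1 / (4 * π ^ 2) * totalQ w = ν - μ)) := by
  -- With μ = β - 1 the jump formula turns the first positivity hypothesis into ν > 0 and the second
  -- into β > 0.
  obtain ⟨β, ν, hβν, hβ, hν, hβk, hνk⟩ := exists_limits_isoQuotient hw hcomplete harea hQ r₁ r₂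
    hr₁ hr₁₂ hRinfty hRorigin
  refine ⟨⟨β - 1, hβ.sub_const 1, fun h k l hk hkl hl => ⟨ν, hνk (by linarith) k l hk hkl hl,
    by linarith⟩⟩, ⟨ν, hν, fun h k l hk hkl hl => ⟨β - 1,
    (hβk (by linarith) k l hk hkl hl).sub_const 1, by linarith⟩⟩⟩
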